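/- All problems below are languages over a fixed finite alphabet: instances are encoded explicitly, with numbers in binary, graphs by adjacency matrices, multigraphs by lists of edges, and elections by a list of the candidates and, for every voter, the list of the candidates in the order of the vote. For languages $A,B$, *$A$ logspace many-one reduces to $B$* ($A\le_m^{\log}B$) if there is a total function $f$ on words, computable by a deterministic Turing machine (read-only input tape, write-only output tape) using work space $O(\log n)$ on inputs of length $n$, such that $x\in A \iff f(x)\in B$ for all words $x$. $A$ and $B$ are *logspace many-one equivalent* if $A\le_m^{\log}B$ and $B\le_m^{\log}A$. * **2-Approval-CCRV!**: Given a finite set $C$ of candidates, registered voters $V$ and unregistered voters $W$, each with a total-order vote over $C$, a preferred candidate $p\in C$ and an integer $k\ge 0$: are there $V'\subseteq V$ and $W'\subseteq W$ with $\|V'\|=\|W'\|=k$ such that $p$ is a winner of the election $(C,(V-V')\cup W')$ under 2-Approval? (Each voter gives one point to each of the candidates ranked first and second, and no points to the others; the winners are the candidates with the highest score.) * **Exact Perfect Matching**: Given a finite simple graph $G=(V,E)$, a set $R\subseteq E$ of red edges and an integer $k\ge 0$: does $G$ have a perfect matching with exactly $k$ red edges? * **Restricted Exact Perfect Matching**: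 Exact Perfect Matching restricted to instances with $\|R\|=\|V\|/2$. * **Exact Red-Blue Perfect $b$-Matching for Multigraphs**: Given a finite loopless multigraph $G=(V,E)$, a capacity function $b:V\to\mathbb{N}$, disjoint sets $R,B\subseteq E$ of red and blue edges, and integers $k,\ell\ge 0$: is there a set $E'\subseteq E$ with exactly $k$ red and exactly $\ell$ blue edges such that each $v\in V$ is incident with exactly $b(v)$ edges in $E'$? **Theorem.** 2-Approval-CCRV! is logspace many-one equivalent to Exact Perfect Matching. Moreover, 1. 2-Approval-CCRV! $\le_m^{\log}$ Exact Red-Blue Perfect $b$-Matching for Multigraphs $\le_m^{\log}$ Exact Perfect Matching; 2. Exact Perfect Matching $\le_m^{\log}$ Restricted Exact Perfect Matching $\le_m^{\log}$ 2-Approval-CCRV!. -/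

import Mathlib

/-! ## Deterministic Turing machines with read-only input and write-only output -/

/-- The four-letter alphabet over which all problems are encoded. -/
inductive Letter where
  | bit (b : Bool)
  | comma
  | semicolon
deriving DecidableEq, Fintype

/-- What the input head can see: a letter of the input word or one of the two endmarkers. -/
inductive InputSymbol where
  | leftEnd
  | letter (a : Letter)
  | rightEnd

/-- Head movements. -/
inductive HeadMove where
  | left
  | stay
  | right

/-- What a machine does in one step: enter a new state, move the input head, write a symbol on
each work tape, move the head of each work tape, and print at most one letter on the output tape. -/
structure StepAction (Q K Γ : Type) where
  state : Q
  inputMove : HeadMove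
  write : K → Γ
  workMove : K → HeadMove
  print : Option Letter

/-- A deterministic Turing machine with a two-way read-only input tape (with endmarkers), a finite
family of two-way infinite work tapes, and a one-way write-only output tape. The machine halts when
its transition function returns `none`. -/
structure Transducer where
  /-- the states -/
  Q : Type
  /-- the names of the work tapes -/
  K : Type
  /-- the work alphabet -/
  Γ : Type
  [finQ : Finite Q]
  [finK : Finite K]
  [finΓ : Finite Γ]
  start : Q
  blank : Γ
  trans : Q → InputSymbol → (K → Γ) → Option (StepAction Q K Γ)

namespace Transducer

/-- Configurations. The input head is at a position in `0, …, n + 1`, where `n` is the length of the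
input; positions `0` and `n + 1` hold the endmarkers. -/
structure Cfg (M : Transducer) where
  state : M.Q
  inputPos : ℕ
  tape : M.K → ℤ → M.Γ
  head : M.K → ℤ
  output : List Letter

/-- The symbol at a position of the input tape. -/
def readInput (x : List Letter) : ℕ → InputSymbol
  | 0 => .leftEnd
  | i + 1 =>
    match x[i]? with
    | some a => .letter a
    | none => .rightEnd

/-- The input head cannot leave the part of the input tape between the endmarkers. -/
def moveInput (x : List Letter) (i : ℕ) : HeadMove → ℕ
  | .left => i - 1
  | .stay => i
  | .right => min (i + 1) (x.length + 1)

/-- Moving a head on a work tape. -/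
def moveWork (h : ℤ) : HeadMove → ℤ
  | .left => h - 1
  | .stay => h
  | .right => h + 1

/-- The initial configuration. -/
def initialCfg (M : Transducer) : M.Cfg where
  state := M.start
  inputPos := 0
  tape := fun _ _ => M.blank
  head := fun _ => 0
  output := []

/-- One step on input `x`; `none` if the machine has halted. -/
def step (M : Transducer) (x : List Letter) (c : M.Cfg) : Option M.Cfg :=
  (M.trans c.state (readInput x c.inputPos) (fun i => c.tape i (c.head i))).map fun a =>
    { state := a.state
      inputPos := moveInput x c.inputPos a.inputMove
      tape := fun i => Function.update (c.tape i) (c.head i) (a.write i)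
      head := fun i => moveWork (c.head i) (a.workMove i)
      output := c.output ++ a.print.toList }

/-- `M` started on `x` ever reaches the configuration `c`. -/
def Reaches (M : Transducer) (x : List Letter) (c : M.Cfg) : Prop :=
  StateTransition.Reaches (M.step x) M.initialCfg c

/-- On input `x` the machine halts with `y` on its output tape. -/
def Outputs (M : Transducer) (x y : List Letter) : Prop :=
  ∃ c, M.Reaches x c ∧ M.step x c = none ∧ c.output = y

/-- On input `x` the work heads visit only cells at distance at most `s` from where they start.
Neither the input tape nor the output tape counts as work space. -/
def UsesSpaceAtMost (M : Transducer) (x : List Letter) (s : ℕ) : Prop :=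
  ∀ c, M.Reaches x c → ∀ i, (c.head i).natAbs ≤ s

end Transducer

/-- `f` is computed by a deterministic Turing machine in work space `O(log n)`. -/
def LogspaceComputable (f : List Letter → List Letter) : Prop :=
  ∃ (M : Transducer) (a : ℕ), ∀ x : List Letter,
    M.Outputs x (f x) ∧ M.UsesSpaceAtMost x (a * (Nat.log 2 x.length + 1))

/-- Logspace many-one reducibility between languages. -/
def LogspaceReduces (A B : Language Letter) : Prop :=
  ∃ f : List Letter → List Letter, LogspaceComputable f ∧ ∀ x, x ∈ A ↔ f x ∈ B

/-- Logspace many-one equivalence of languages. -/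
def LogspaceEquivalent (A B : Language Letter) : Prop :=
  LogspaceReduces A B ∧ LogspaceReduces B A

/-! ## Encoding finite tables of natural numbers -/

/-- A table of natural numbers as a word: every number is written in binary and followed by a comma,
and every row is followed by a semicolon. -/
def encodeTable (T : List (List ℕ)) : List Letter :=
  T.flatMap fun row =>
    (row.flatMap fun a => (Computability.encodeNat a).map Letter.bit ++ [Letter.comma]) ++
      [Letter.semicolon]

/-! ## Exact perfect matching -/

/-- A finite simple graph with a set of red edges and a number `k`. -/
structure MatchingInstance where
  n : ℕ
  G : SimpleGraph (Fin n)
  R : Set (Sym2 (Fin n))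
  red_subset : R ⊆ G.edgeSet
  k : ℕ

namespace MatchingInstance

/-- There is a perfect matching with exactly `k` red edges. -/
def Yes (I : MatchingInstance) : Prop :=
  ∃ M : I.G.Subgraph, M.IsPerfectMatching ∧ (M.edgeSet ∩ I.R).ncard = I.k

open Classical in
/-- The entry of the adjacency matrix: `0` for no edge, `1` for a nonred edge, `2` for a red edge. -/
noncomputable def entry (I : MatchingInstance) (u v : Fin I.n) : ℕ :=
  if s(u, v) ∈ I.R then 2 else if I.G.Adj u v then 1 else 0

/-- The number `k`, followed by the rows of the adjacency matrix. -/
noncomputable def encode (I : MatchingInstance) : List Letter :=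
  encodeTable ([I.k] :: List.ofFn fun u => List.ofFn fun v => I.entry u v)

end MatchingInstance

/-- Exact Perfect Matching. -/
def exactPerfectMatching : Language Letter :=
  {w | ∃ I : MatchingInstance, I.Yes ∧ I.encode = w}

/-- Restricted Exact Perfect Matching: the number of red edges is half the number of vertices. -/
def restrictedExactPerfectMatching : Language Letter :=
  {w | ∃ I : MatchingInstance, 2 * I.R.ncard = I.n ∧ I.Yes ∧ I.encode = w}

/-! ## Exact red-blue perfect `b`-matching for multigraphs -/

/-- A finite loopless multigraph with vertices `Fin n` and edges `Fin m`, where `ends e` are the two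
endpoints of the edge `e` (in either order), with vertex capacities `b`, disjoint sets of red and of
blue edges, and two numbers. -/
structure RedBlueInstance where
  n : ℕ
  m : ℕ
  ends : Fin m → Fin n × Fin n
  loopless : ∀ e, (ends e).1 ≠ (ends e).2
  b : Fin n → ℕ
  R : Finset (Fin m)
  B : Finset (Fin m)
  red_blue_disjoint : Disjoint R B
  k : ℕ
  l : ℕ

namespace RedBlueInstance

/-- There is a set of edges, exactly `k` of them red and exactly `l` of them blue, such that every
vertex `v` is incident with exactly `b v` of them. -/
def Yes (I : RedBlueInstance) : Prop :=
  ∃ E : Finset (Fin I.m), (E ∩ I.R).card = I.k ∧ (E ∩ I.B).card = I.l ∧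
    ∀ v, (E.filter fun e => (I.ends e).1 = v ∨ (I.ends e).2 = v).card = I.b v

/-- The numbers `k` and `l`, the capacities of the vertices, and for each edge a row consisting of
its endpoints and its color (`1` for red, `2` for blue, `0` for uncolored). -/
def encode (I : RedBlueInstance) : List Letter :=
  encodeTable ([I.k, I.l] :: List.ofFn I.b :: List.ofFn fun e =>
    [((I.ends e).1 : ℕ), ((I.ends e).2 : ℕ), if e ∈ I.R then 1 else if e ∈ I.B then 2 else 0])

end RedBlueInstance

/-- Exact Red-Blue Perfect `b`-Matching for Multigraphs. -/
def exactRedBluePerfectBMatching : Language Letter :=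
  {w | ∃ I : RedBlueInstance, I.Yes ∧ I.encode = w}

/-! ## Elections and control by replacing voters -/

/-- A total-order vote over the candidates `Fin m`: the candidate `σ i` is ranked at place `i`,
where place `0` is the top. -/
abbrev Vote (m : ℕ) := Equiv.Perm (Fin m)

/-- A family of scoring vectors, one for each number of candidates. -/
abbrev ScoringRule := (m : ℕ) → Fin m → ℤ

/-- The vectors `⟨1, 1, 0, …, 0⟩`. -/
def twoApproval : ScoringRule := fun _ i => if (i : ℕ) < 2 then 1 else 0

/-- The score of candidate `c` when the voters are those in `S`. -/
def score (α : ScoringRule) {m : ℕ} {ι : Type} (vote : ι → Vote m) (S : Finset ι) (c : Fin m) : ℤ :=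
  ∑ v ∈ S, α m ((vote v).symm c)

/-- The candidates with the highest score are the winners. -/
def winners (α : ScoringRule) {m : ℕ} {ι : Type} (vote : ι → Vote m) (S : Finset ι) : Set (Fin m) :=
  {p | ∀ c, score α vote S c ≤ score α vote S p}

/-- Candidates `Fin m`, registered voters `Fin r` with their votes, unregistered voters `Fin s` with
their votes, a preferred candidate `p` and a number `k`. -/
structure ReplacingInstance where
  m : ℕ
  r : ℕ
  s : ℕ
  V : Fin r → Vote m
  W : Fin s → Vote m
  p : Fin m
  k : ℕ

namespace ReplacingInstance

/-- Replacing exactly `k` registered voters by unregistered voters can make `p` a winner. -/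
def YesExact (I : ReplacingInstance) (α : ScoringRule) : Prop :=
  ∃ (V₀ : Finset (Fin I.r)) (W₀ : Finset (Fin I.s)), V₀.card = I.k ∧ W₀.card = I.k ∧
    I.p ∈ winners α (Sum.elim I.V I.W) ((Finset.univ \ V₀).disjSum W₀)

/-- The preferred candidate and the number `k`, the list of the candidates, and for each voter a row
consisting of `0` (registered) or `1` (unregistered) and the candidates from the top down. -/
def encode (I : ReplacingInstance) : List Letter :=
  encodeTable ([(I.p : ℕ), I.k] :: List.range I.m ::
    ((List.ofFn fun i => 0 :: List.ofFn fun j => (I.V i j : ℕ)) ++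
      List.ofFn fun i => 1 :: List.ofFn fun j => (I.W i j : ℕ)))

end ReplacingInstance

/-- Exact constructive control by replacing voters (CCRV!) for a scoring rule. -/
def ccrvExact (α : ScoringRule) : Language Letter :=
  {w | ∃ I : ReplacingInstance, I.YesExact α ∧ I.encode = w}

/-! ### Implementation of register programs on Turing machines with binary counters. -/

namespace Logspace

/-! ## Fragments of machines -/

/-! Under 2-Approval a vote is an edge joining its two approved candidates, and a score is a degree.
Each of the four reductions exploits this or adjusts a graph by gadgets.

Elections to `b`-matchings (`hasControl_iff_hasBMatching`): of `r` registered voters, the `r - k`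
kept ones are red edges and the `k` added ones blue edges. Exchanging a voter for one that approves
`p` gives `p` a point and any other candidate at most one (`exists_exchange`), so `p` may be assumed
to reach the largest possible score `t`, which is found by counting. Every candidate gets capacity
`t`, and all candidates except `p` are joined by `t` parallel edges to one further vertex that
absorbs the points missing up to `t`.

`b`-matchings to matchings (`hasMatching_gadget`): a vertex becomes `b v` slots, an edge becomes a
path on `2 * M + 2` vertices whose ends are joined to the slots of its endpoints. A path is matched
within itself (edge unused) or with both ends at slots (edge used). The second pairing carries one
red edge if the edge is red and `M` red edges if it is blue. If `M` exceeds the number of edges, the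
total `k + M * l` determines both `k` and `l`.

Matchings to restricted matchings (`hasMatching_pendant`, `card_two_pendant`): pendant edges are
forced into every perfect matching and can be used to add vertices. One of them is red, and `n / 2`
red edges at its inner end can never be used; together they bring the number of red edges to half
the number of vertices.

Restricted matchings to elections (`hasControl_edges`): vertices are candidates, red edges are
registered voters, other edges are unregistered voters, and one more registered voter gives `p` its
only point. Then `p` wins exactly if no vertex is covered twice. The restriction on the number of
red edges makes the numbers of removed and added voters agree, and the number of chosen edges is
then half the number of vertices, so that every vertex is covered.

For the space bounds, `LF` is a class of functions closed under composition and under recursion with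
polynomially bounded values. Its members are computed by register programs whose registers hold
numbers of `O(log n)` bits (`LF.compiles`, `logspaceComputable_of_LF`). A word-valued function is
handled through its length and its letters (`LogGen`), which makes it closed under composition
without storing intermediate words (`LF.subst`). Numbers in the input are binary and may be
exponentially large, but they matter only in comparison with counts bounded by the input length, so
they are read truncated (`entry`, `cap`). Words that encode no instance are recognized and sent to a
fixed word outside the target language. -/

abbrev Word := List Letter

/-- The contents of all the tapes of a machine with `R` work tapes. -/
structure Mem (R : ℕ) where
  pos : ℕ
  tape : Fin R → ℤ → Option Bool
  head : Fin R → ℤ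
  out : Word

def Mem.act {R : ℕ} {Q : Type} (x : Word) (m : Mem R)
    (a : StepAction Q (Fin R) (Option Bool)) : Mem R where
  pos := Transducer.moveInput x m.pos a.inputMove
  tape i := Function.update (m.tape i) (m.head i) (a.write i)
  head i := Transducer.moveWork (m.head i) (a.workMove i)
  out := m.out ++ a.print.toList

/-- The extra cell pays for position `-1`, which a head visits to find the left end of a counter
even if `S = 0`. -/
def Mem.InSpace {R : ℕ} (S : ℕ) (m : Mem R) : Prop := ∀ i, (m.head i).natAbs ≤ S + 1

/-- A piece of a machine: it runs until it leaves its own states through one of the exits `E`. -/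
structure Frag (R : ℕ) (E : Type) where
  Q : Type
  fin : Finite Q
  start : Q
  trans : Q → InputSymbol → (Fin R → Option Bool) → StepAction (Q ⊕ E) (Fin R) (Option Bool)

namespace Frag

variable {R : ℕ} {E E' : Type}

def action (F : Frag R E) (x : Word) (q : F.Q) (m : Mem R) :
    StepAction (F.Q ⊕ E) (Fin R) (Option Bool) :=
  F.trans q (Transducer.readInput x m.pos) (fun i => m.tape i (m.head i))

/-- Running a fragment from an inner state until it exits, within space `S`. -/
inductive Run (F : Frag R E) (x : Word) (S : ℕ) : F.Q → Mem R → E → Mem R → Prop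
  | exit {q m e} : m.InSpace S → (F.action x q m).state = .inr e →
      Run F x S q m e (m.act x (F.action x q m))
  | step {q m q' e m'} : m.InSpace S → (F.action x q m).state = .inl q' →
      Run F x S q' (m.act x (F.action x q m)) e m' → Run F x S q m e m'

def mapState {Q Q' K Γ : Type} (f : Q → Q') (a : StepAction Q K Γ) : StepAction Q' K Γ where
  state := f a.state
  inputMove := a.inputMove
  write := a.write
  workMove := a.workMove
  print := a.print

/-- Run `F`, then the fragment belonging to the exit taken. -/
def bind [Finite E] (F : Frag R E) (G : E → Frag R E') : Frag R E' where
  Q := F.Q ⊕ Σ e, (G e).Q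
  fin := by
    have := F.fin
    have := fun e => (G e).fin
    infer_instance
  start := .inl F.start
  trans
    | .inl q, s, v => mapState
        (Sum.elim (fun q => .inl (.inl q)) (fun e => .inl (.inr ⟨e, (G e).start⟩))) (F.trans q s v)
    | .inr ⟨e, q⟩, s, v => mapState (Sum.map (fun q => .inr ⟨e, q⟩) id) ((G e).trans q s v)

/-- Repeat `F` as long as it exits through `none`. -/
def loop (F : Frag R (Option E)) : Frag R E where
  Q := F.Q
  fin := F.fin
  start := F.start
  trans q s v := mapState (Sum.elim .inl (fun e => e.elim (.inl F.start) .inr)) (F.trans q s v)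

theorem Run.bind_right [Finite E] {F : Frag R E} {G : E → Frag R E'} {x : Word} {S : ℕ} {e : E}
    {q : (G e).Q} {m m' : Mem R} {e' : E'} (h : (G e).Run x S q m e' m') :
    (F.bind G).Run x S (.inr ⟨e, q⟩) m e' m' := by
  induction h with
  | @exit q m e' h1 h2 =>
    refine Run.exit (F := F.bind G) (q := .inr ⟨e, q⟩) h1 ?_
    change Sum.map _ id ((G e).action x q m).state = _
    rw [h2]; rfl
  | @step q m q' e' m' h1 h2 _ ih =>
    refine Run.step (F := F.bind G) (q' := .inr ⟨e, q'⟩) h1 ?_ ih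
    change Sum.map _ id ((G e).action x q m).state = _
    rw [h2]; rfl

theorem Run.bind [Finite E] {F : Frag R E} {G : E → Frag R E'} {x : Word} {S : ℕ} {e : E}
    {q : F.Q} {m m' m'' : Mem R} {e' : E'} (h : F.Run x S q m e m')
    (h' : (G e).Run x S (G e).start m' e' m'') :
    (F.bind G).Run x S (.inl q) m e' m'' := by
  induction h with
  | @exit q m e h1 h2 =>
    refine Run.step (F := F.bind G) (q := .inl q) (q' := .inr ⟨e, (G e).start⟩) h1 ?_
      h'.bind_right
    change Sum.elim _ _ (F.action x q m).state = _
    rw [h2]; rfl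
  | @step q m q' e m' h1 h2 _ ih =>
    refine Run.step (F := F.bind G) (q := .inl q) (q' := .inl q') h1 ?_ (ih h')
    change Sum.elim _ _ (F.action x q m).state = _
    rw [h2]; rfl

/-- The exit is a variable `o` with an equation, because an induction on the run needs its indices
to be variables. -/
theorem Run.loop_exit {F : Frag R (Option E)} {x : Word} {S : ℕ} {e : E}
    {q : F.Q} {m m' : Mem R} {o : Option E} (h : F.Run x S q m o m') (ho : o = some e) :
    F.loop.Run x S q m e m' := by
  induction h with
  | @exit q m o h1 h2 =>
    refine Run.exit (F := F.loop) (q := q) h1 ?_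
    change Sum.elim _ _ (F.action x q m).state = _
    rw [h2, ho]; rfl
  | @step q m q' o m' h1 h2 _ ih =>
    refine Run.step (F := F.loop) (q := q) (q' := q') h1 ?_ (ih ho)
    change Sum.elim _ _ (F.action x q m).state = _
    rw [h2]; rfl

theorem Run.loop_again {F : Frag R (Option E)} {x : Word} {S : ℕ} {e : E}
    {q : F.Q} {m m' m'' : Mem R} {o : Option E} (h : F.Run x S q m o m') (ho : o = none)
    (h' : F.loop.Run x S F.start m' e m'') :
    F.loop.Run x S q m e m'' := by
  induction h with
  | @exit q m o h1 h2 =>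
    refine Run.step (F := F.loop) (q := q) (q' := F.start) h1 ?_ h'
    change Sum.elim _ _ (F.action x q m).state = _
    rw [h2, ho]; rfl
  | @step q m q' o m' h1 h2 _ ih =>
    refine Run.step (F := F.loop) (q := q) (q' := q') h1 ?_ (ih ho h')
    change Sum.elim _ _ (F.action x q m).state = _
    rw [h2]; rfl

/-- The machine that runs a fragment and halts when the fragment exits. -/
def machine (F : Frag R Unit) : Transducer :=
  haveI := F.fin
  { Q := F.Q ⊕ Unit
    K := Fin R
    Γ := Option Bool
    start := .inl F.start
    blank := none
    trans := fun q s v => q.elim (fun q => some (F.trans q s v)) (fun _ => none) }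

def toCfg (F : Frag R Unit) (q : F.Q ⊕ Unit) (m : Mem R) : F.machine.Cfg :=
  { state := q, inputPos := m.pos, tape := m.tape, head := m.head, output := m.out }

theorem step_toCfg (F : Frag R Unit) (x : Word) (q : F.Q) (m : Mem R) :
    F.machine.step x (F.toCfg (.inl q) m) =
      some (F.toCfg (F.action x q m).state (m.act x (F.action x q m))) := rfl

/-- By determinism every reachable configuration lies on the given run, whose constructors carry the
space bound. The memory in which the run ends is not covered by them, hence `hS`. -/
theorem Run.machine {F : Frag R Unit} {x : Word} {S : ℕ} {q : F.Q} {m m' : Mem R} {e : Unit}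
    (h : F.Run x S q m e m') (hS : m'.InSpace S) :
    StateTransition.Reaches (F.machine.step x) (F.toCfg (.inl q) m) (F.toCfg (.inr ()) m') ∧
    ∀ c, StateTransition.Reaches (F.machine.step x) (F.toCfg (.inl q) m) c →
      ∀ i, (c.head i).natAbs ≤ S + 1 := by
  induction h with
  | @exit q m e h1 h2 =>
    have hs := step_toCfg F x q m
    rw [h2] at hs
    refine ⟨Relation.ReflTransGen.single hs, fun c hc => ?_⟩
    rcases Relation.ReflTransGen.cases_head hc with rfl | ⟨c', hc', hc⟩
    · exact h1
    · obtain rfl := Option.mem_unique hs hc'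
      rcases Relation.ReflTransGen.cases_head hc with rfl | ⟨c', hc', hc⟩
      · exact hS
      · change c' ∈ (none : Option _) at hc'
        cases hc'
  | @step q m q' e m' h1 h2 _ ih =>
    have hs := step_toCfg F x q m
    rw [h2] at hs
    obtain ⟨ih1, ih2⟩ := ih hS
    refine ⟨Relation.ReflTransGen.head hs ih1, fun c hc => ?_⟩
    rcases Relation.ReflTransGen.cases_head hc with rfl | ⟨c', hc', hc⟩
    · exact h1
    · obtain rfl := Option.mem_unique hs hc'
      exact ih2 c hc

/-! ## Fragments acting on a single work tape -/

/-- Runs of a machine part that only uses one work tape. -/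
inductive TRun {Q : Type} (δ : Q → Option Bool → (Q ⊕ E) × Option Bool × HeadMove) (S : ℕ) :
    Q → (ℤ → Option Bool) → ℤ → E → (ℤ → Option Bool) → ℤ → Prop
  | exit {q t h e} : h.natAbs ≤ S + 1 → (δ q (t h)).1 = .inr e →
      TRun δ S q t h e (Function.update t h (δ q (t h)).2.1)
        (Transducer.moveWork h (δ q (t h)).2.2)
  | step {q t h q' e t' h'} : h.natAbs ≤ S + 1 → (δ q (t h)).1 = .inl q' →
      TRun δ S q' (Function.update t h (δ q (t h)).2.1)
        (Transducer.moveWork h (δ q (t h)).2.2) e t' h' →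
      TRun δ S q t h e t' h'

def onTape {Q : Type} [Finite Q] (r : Fin R)
    (δ : Q → Option Bool → (Q ⊕ E) × Option Bool × HeadMove) (q₀ : Q) : Frag R E where
  Q := Q
  fin := inferInstance
  start := q₀
  trans q _ v :=
    { state := (δ q (v r)).1
      inputMove := .stay
      write := Function.update v r (δ q (v r)).2.1
      workMove := Function.update (fun _ => .stay) r (δ q (v r)).2.2
      print := none }

theorem act_onTape {Q : Type} [Finite Q] (r : Fin R)
    (δ : Q → Option Bool → (Q ⊕ E) × Option Bool × HeadMove) (q₀ : Q) (x : Word) (q : Q)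
    (m : Mem R) :
    m.act x ((onTape r δ q₀).action x q m) =
      { pos := m.pos
        tape := Function.update m.tape r (Function.update (m.tape r) (m.head r)
          (δ q (m.tape r (m.head r))).2.1)
        head := Function.update m.head r (Transducer.moveWork (m.head r)
          (δ q (m.tape r (m.head r))).2.2)
        out := m.out } := by
  simp only [Mem.act, action, onTape, Transducer.moveInput, Option.toList_none, List.append_nil,
    Mem.mk.injEq, true_and, and_true]
  constructor
  · funext i
    by_cases hi : i = r
    · subst hi; simp
    · simp [hi]
  · funext i
    by_cases hi : i = r
    · subst hi; simp
    · simp [hi, Transducer.moveWork]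

theorem TRun.run {Q : Type} [Finite Q] {r : Fin R}
    {δ : Q → Option Bool → (Q ⊕ E) × Option Bool × HeadMove} {q₀ : Q} {x : Word} {S : ℕ}
    {q : Q} {t t' : ℤ → Option Bool} {h h' : ℤ} {e : E} (H : TRun δ S q t h e t' h')
    (m : Mem R) (hm : m.InSpace S) (ht : m.tape r = t) (hh : m.head r = h) :
    (onTape r δ q₀).Run x S q m e
      { m with tape := Function.update m.tape r t', head := Function.update m.head r h' } := by
  induction H generalizing m with
  | @exit q t h e h1 h2 =>
    subst ht hh
    have := act_onTape r δ q₀ x q m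
    rw [← this]
    exact Run.exit hm h2
  | @step q t h q' e t' h' h1 h2 h3 ih =>
    subst ht hh
    refine Run.step hm h2 ?_
    rw [act_onTape]
    have hm' : Mem.InSpace S { m with
        tape := Function.update m.tape r (Function.update (m.tape r) (m.head r)
          (δ q (m.tape r (m.head r))).2.1)
        head := Function.update m.head r (Transducer.moveWork (m.head r)
          (δ q (m.tape r (m.head r))).2.2) } := by
      intro i
      by_cases hi : i = r
      · subst hi
        simp only [Function.update_self]
        -- The new head position is within space because the rest of the run starts there and either
        -- constructor of `TRun` records the bound.
        cases h3 <;> assumption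
      · simpa [hi] using hm i
    have := ih _ hm' (by simp) (by simp)
    simpa using this

/-! ## Binary counters -/

/-- The least significant bit comes first, and zeros at the high end are allowed; so decrementing
never has to shorten the list. -/
def bitsVal (l : List Bool) : ℕ := l.foldr (fun b v => b.toNat + 2 * v) 0

@[simp] theorem bitsVal_nil : bitsVal [] = 0 := rfl

@[simp] theorem bitsVal_cons (b : Bool) (l : List Bool) :
    bitsVal (b :: l) = b.toNat + 2 * bitsVal l := rfl

theorem bitsVal_lt (l : List Bool) : bitsVal l < 2 ^ l.length := by
  induction l with
  | nil => simp
  | cons b l ih => cases b <;> simp [pow_succ] <;> omega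

theorem bitsVal_replicate_false (n : ℕ) : bitsVal (List.replicate n false) = 0 := by
  induction n with
  | zero => rfl
  | succ n ih => simp [List.replicate_succ, ih]

/-- The tape on which a list is written to the right of the origin. -/
def tapeOf (l : List Bool) : ℤ → Option Bool := fun i => if 0 ≤ i then l[i.toNat]? else none

theorem tapeOf_nil : tapeOf [] = fun _ => none := by
  funext i; simp [tapeOf]

theorem tapeOf_neg (l : List Bool) : tapeOf l (-1) = none := by
  simp [tapeOf]

theorem tapeOf_append_cons (p l : List Bool) (b : Bool) :
    tapeOf (p ++ b :: l) p.length = some b := by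
  simp [tapeOf]

theorem tapeOf_length (p : List Bool) : tapeOf p p.length = none := by
  simp [tapeOf]

theorem update_tapeOf (p l : List Bool) (b b' : Bool) :
    Function.update (tapeOf (p ++ b :: l)) p.length (some b') = tapeOf (p ++ b' :: l) := by
  funext i
  by_cases hi : i = p.length
  · subst hi; simp [tapeOf]
  · simp only [ne_eq, hi, not_false_eq_true, Function.update_of_ne, tapeOf]
    split_ifs with h
    · lift i to ℕ using h
      simp only [Int.toNat_natCast]
      have : i ≠ p.length := by exact_mod_cast hi
      rcases lt_or_gt_of_ne this with h | h
      · rw [List.getElem?_append_left h, List.getElem?_append_left h]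
      · rw [List.getElem?_append_right h.le, List.getElem?_append_right h.le]
        obtain ⟨k, hk⟩ : ∃ k, i - p.length = k + 1 := ⟨i - p.length - 1, by omega⟩
        rw [hk]; simp
    · rfl

theorem update_tapeOf_length (p : List Bool) (b : Bool) :
    Function.update (tapeOf p) p.length (some b) = tapeOf (p ++ [b]) := by
  funext i
  by_cases hi : i = p.length
  · subst hi; simp [tapeOf]
  · simp only [ne_eq, hi, not_false_eq_true, Function.update_of_ne, tapeOf]
    split_ifs with h
    · lift i to ℕ using h
      simp only [Int.toNat_natCast]
      have : i ≠ p.length := by exact_mod_cast hi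
      rcases lt_or_gt_of_ne this with h | h
      · rw [List.getElem?_append_left h]
      · rw [List.getElem?_eq_none h.le, List.getElem?_eq_none (by simp; omega)]
    · rfl

/-- The return sweep shared by both counter operations: the head goes left to the blank at `-1`,
rewriting each bit by `g`, and steps back to `0`. With `g = id` it only rewinds; with `g` constantly
`false` it resets the counter. -/
theorem trun_back {Q : Type} {δ : Q → Option Bool → (Q ⊕ E) × Option Bool × HeadMove} {S : ℕ}
    {q : Q} {g : Bool → Bool} {e : E} (h₁ : ∀ b, δ q (some b) = (.inl q, some (g b), .left))
    (h₂ : δ q none = (.inr e, none, .right)) (p l : List Bool) (hp : p.length ≤ S) :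
    TRun δ S q (tapeOf (p ++ l)) (p.length - 1) e (tapeOf (p.map g ++ l)) 0 := by
  induction p using List.reverseRecOn generalizing l with
  | nil =>
    have := TRun.exit (δ := δ) (S := S) (q := q) (t := tapeOf l) (h := -1) (e := e) (by simp)
      (by rw [tapeOf_neg, h₂])
    rw [tapeOf_neg, h₂] at this
    have hu : Function.update (tapeOf l) (-1) none = tapeOf l := by
      rw [Function.update_eq_self_iff, tapeOf_neg]
    simpa [hu, Transducer.moveWork] using this
  | append_singleton p b ih =>
    have hlen : (((p ++ [b]).length : ℕ) : ℤ) - 1 = p.length := by simp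
    rw [hlen, List.append_assoc, List.singleton_append]
    simp only [List.length_append, List.length_singleton] at hp
    refine TRun.step (q' := q) (by simp; omega) (by rw [tapeOf_append_cons, h₁]) ?_
    rw [tapeOf_append_cons, h₁]
    simp only [update_tapeOf, Transducer.moveWork]
    have := ih (g b :: l) (by omega)
    simpa using this

/-- The transition function that adds one to a binary counter. -/
def incStep : Bool → Option Bool → (Bool ⊕ Unit) × Option Bool × HeadMove
  | false, some true => (.inl false, some false, .right)
  | false, _ => (.inl true, some true, .left)
  | true, some b => (.inl true, some b, .left)
  | true, none => (.inr (), none, .right)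

def incBits : List Bool → List Bool
  | [] => [true]
  | false :: l => true :: l
  | true :: l => false :: incBits l

theorem bitsVal_incBits (l : List Bool) : bitsVal (incBits l) = bitsVal l + 1 := by
  induction l with
  | nil => rfl
  | cons b l ih => cases b <;> simp [incBits, ih] <;> omega

/-- The list gets longer only if all its bits are `true`, and then the new value is `2 ^ l.length`.
-/
theorem length_incBits (l : List Bool) (S : ℕ) (hl : l.length ≤ S) (h : bitsVal l + 1 < 2 ^ S) :
    (incBits l).length ≤ S := by
  induction l generalizing S with
  | nil =>
    cases S with
    | zero => simp at h
    | succ S => simp [incBits]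
  | cons b l ih =>
    cases S with
    | zero => simp at hl
    | succ S =>
      cases b
      · simpa [incBits] using hl
      · simp only [bitsVal_cons, Bool.toNat_true, pow_succ] at h
        simp only [List.length_cons, add_le_add_iff_right] at hl
        simpa [incBits] using ih S hl (by omega)

theorem trun_inc (p l : List Bool) (S : ℕ) (h : p.length + l.length ≤ S)
    (h' : p.length + (incBits l).length ≤ S) :
    TRun incStep S false (tapeOf (p ++ l)) p.length () (tapeOf (p ++ incBits l)) 0 := by
  induction l generalizing p with
  | nil =>
    rw [List.append_nil]
    refine TRun.step (q' := true) (by simp; omega) (by rw [tapeOf_length]; rfl) ?_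
    rw [tapeOf_length]
    simp only [incStep, update_tapeOf_length, Transducer.moveWork, incBits]
    have := trun_back (δ := incStep) (S := S) (q := true) (g := id) (e := ()) (fun b => rfl) rfl p
      [true] (by omega)
    simpa using this
  | cons b l ih =>
    simp only [List.length_cons] at h
    cases b
    · refine TRun.step (q' := true) (by simp; omega) (by rw [tapeOf_append_cons]; rfl) ?_
      rw [tapeOf_append_cons]
      simp only [incStep, update_tapeOf, Transducer.moveWork, incBits]
      have := trun_back (δ := incStep) (S := S) (q := true) (g := id) (e := ()) (fun b => rfl) rfl
        p (true :: l) (by omega)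
      simpa using this
    · refine TRun.step (q' := false) (by simp; omega) (by rw [tapeOf_append_cons]; rfl) ?_
      rw [tapeOf_append_cons]
      simp only [incStep, update_tapeOf, Transducer.moveWork]
      have := ih (p ++ [false]) (by simp; omega) (by simp [incBits] at h' ⊢; omega)
      simpa [incBits] using this

/-- The transition function that tests whether a binary counter is zero, and subtracts one if it is
not. -/
def decStep : Option Bool → Option Bool → (Option Bool ⊕ Bool) × Option Bool × HeadMove
  | none, some false => (.inl none, some true, .right)
  | none, some true => (.inl (some true), some false, .left)
  | none, none => (.inl (some false), none, .left)
  | some true, some b => (.inl (some true), some b, .left)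
  | some false, some _ => (.inl (some false), some false, .left)
  | some e, none => (.inr e, none, .right)

/-- The `n` bits already passed were all `false` and have been turned into `true` as borrows. The
next `true` in `l` becomes `false` and ends the borrowing. If there is none, the counter was zero
and the sweep back restores the zeros; truncated subtraction makes the formula for the value correct
in this case too. -/
theorem trun_dec (n : ℕ) (l : List Bool) (S : ℕ) (h : n + l.length ≤ S) :
    ∃ l' : List Bool, l'.length = n + l.length ∧ bitsVal l' = 2 ^ n * bitsVal l - 1 ∧
    TRun decStep S none (tapeOf (List.replicate n true ++ l)) n (decide (bitsVal l ≠ 0))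
      (tapeOf l') 0 := by
  induction l generalizing n with
  | nil =>
    refine ⟨List.replicate n false, by simp, by simp [bitsVal_replicate_false], ?_⟩
    have e : tapeOf (List.replicate n true) n = none := by
      simpa using tapeOf_length (List.replicate n true)
    rw [List.append_nil]
    simp only [List.length_nil, add_zero] at h
    refine TRun.step (q' := some false) (by simp; omega) (by rw [e]; rfl) ?_
    rw [e]
    have e' : Function.update (tapeOf (List.replicate n true)) (n : ℤ) none =
        tapeOf (List.replicate n true) := by
      rw [Function.update_eq_self_iff, e]
    simp only [decStep, Transducer.moveWork, e']
    have := trun_back (δ := decStep) (S := S) (q := some false) (g := fun _ => false) (e := false)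
      (fun b => rfl) rfl (List.replicate n true) [] (by simpa using h)
    simpa using this
  | cons b l ih =>
    simp only [List.length_cons] at h
    have e : tapeOf (List.replicate n true ++ b :: l) n = some b := by
      simpa using tapeOf_append_cons (List.replicate n true) l b
    have e' (b') : Function.update (tapeOf (List.replicate n true ++ b :: l)) (n : ℤ) (some b') =
        tapeOf (List.replicate n true ++ b' :: l) := by
      simpa using update_tapeOf (List.replicate n true) l b b'
    cases b
    · obtain ⟨l', h1, h2, h3⟩ := ih (n + 1) (by omega)
      refine ⟨l', by simp; omega, ?_, TRun.step (q' := none) (by simp; omega) (by rw [e]; rfl) ?_⟩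
      · rw [h2]; simp only [bitsVal_cons, Bool.toNat_false, pow_succ]; congr 1; ring
      · rw [e]
        simp only [decStep, e', Transducer.moveWork]
        simpa [List.replicate_succ'] using h3
    · refine ⟨List.replicate n true ++ false :: l, by simp, ?_,
        TRun.step (q' := some true) (by simp; omega) (by rw [e]; rfl) ?_⟩
      · clear e e' h ih
        induction n with
        | zero => simp
        | succ n ih =>
          have : 0 < 2 ^ n := by positivity
          simp only [List.replicate_succ, List.cons_append, bitsVal_cons, ih, Bool.toNat_true,
            pow_succ]
          rw [mul_right_comm]
          have : 0 < 2 ^ n * (1 + 2 * bitsVal l) := by positivity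
          omega
      · rw [e]
        simp only [decStep, e', Transducer.moveWork]
        have := trun_back (δ := decStep) (S := S) (q := some true) (g := id) (e := true)
          (fun b => rfl) rfl (List.replicate n true) (false :: l) (by simp; omega)
        simpa using this

end Frag

end Logspace

namespace Logspace

/-! ## Register programs -/

/-- The position of the input head, the contents of the registers and the output. -/
structure RState where
  pos : ℕ
  reg : ℕ → ℕ
  out : Word

/-- The tapes of a machine hold the given registers in binary, within space `S`. -/
structure Rep {R : ℕ} (S : ℕ) (m : Mem R) (σ : RState) : Prop where
  pos : m.pos = σ.pos
  out : m.out = σ.out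
  head : ∀ i, m.head i = 0
  tape : ∀ i : Fin R, ∃ l : List Bool, l.length ≤ S ∧ Frag.bitsVal l = σ.reg i ∧
    m.tape i = Frag.tapeOf l

theorem Rep.inSpace {R S : ℕ} {m : Mem R} {σ : RState} (h : Rep S m σ) : m.InSpace S := by
  intro i; simp [h.head i]

theorem Rep.lt {R S : ℕ} {m : Mem R} {σ : RState} (h : Rep S m σ) {r : ℕ} (hr : r < R) :
    σ.reg r < 2 ^ S := by
  obtain ⟨l, h1, h2, -⟩ := h.tape ⟨r, hr⟩
  change _ = σ.reg r at h2
  rw [← h2]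
  exact (Frag.bitsVal_lt l).trans_le (Nat.pow_le_pow_right (by norm_num) h1)

def RState.set (σ : RState) (r v : ℕ) : RState := { σ with reg := Function.update σ.reg r v }

@[simp] theorem RState.set_pos (σ : RState) (r v : ℕ) : (σ.set r v).pos = σ.pos := rfl
@[simp] theorem RState.set_out (σ : RState) (r v : ℕ) : (σ.set r v).out = σ.out := rfl
@[simp] theorem RState.set_reg (σ : RState) (r v : ℕ) :
    (σ.set r v).reg = Function.update σ.reg r v := rfl

theorem RState.set_set (σ : RState) (r v w : ℕ) : (σ.set r v).set r w = σ.set r w := by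
  simp [RState.set]

theorem RState.set_eq_self (σ : RState) (r : ℕ) : σ.set r (σ.reg r) = σ := by
  simp [RState.set]

namespace Frag

variable {R : ℕ} {E E' : Type} {x : Word} {S : ℕ}

/-- Started in `σ`, the fragment exits through `e` in `τ`. -/
def Does (F : Frag R E) (x : Word) (S : ℕ) (σ : RState) (e : E) (τ : RState) : Prop :=
  ∀ m, Rep S m σ → ∃ m', F.Run x S F.start m e m' ∧ Rep S m' τ

theorem Does.bind [Finite E] {F : Frag R E} {G : E → Frag R E'} {σ τ υ : RState} {e : E} {e' : E'}
    (h : F.Does x S σ e τ) (h' : (G e).Does x S τ e' υ) : (F.bind G).Does x S σ e' υ := by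
  intro m hm
  obtain ⟨m', h1, h2⟩ := h m hm
  obtain ⟨m'', h3, h4⟩ := h' m' h2
  exact ⟨m'', h1.bind h3, h4⟩

theorem Does.loop_exit {F : Frag R (Option E)} {σ τ : RState} {e : E}
    (h : F.Does x S σ (some e) τ) : F.loop.Does x S σ e τ := by
  intro m hm
  obtain ⟨m', h1, h2⟩ := h m hm
  exact ⟨m', h1.loop_exit rfl, h2⟩

theorem Does.loop_again {F : Frag R (Option E)} {σ τ υ : RState} {e : E}
    (h : F.Does x S σ none τ) (h' : F.loop.Does x S τ e υ) : F.loop.Does x S σ e υ := by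
  intro m hm
  obtain ⟨m', h1, h2⟩ := h m hm
  obtain ⟨m'', h3, h4⟩ := h' m' h2
  exact ⟨m'', h1.loop_again rfl h3, h4⟩

def seq (F G : Frag R Unit) : Frag R Unit := F.bind fun _ => G

theorem Does.seq {F G : Frag R Unit} {σ τ υ : RState}
    (h : F.Does x S σ () τ) (h' : G.Does x S τ () υ) : (F.seq G).Does x S σ () υ :=
  Does.bind h h'

/-- One step that touches no work tape. -/
def single (E : Type) (mv : HeadMove) (pr : Option Letter) (ex : InputSymbol → E) : Frag R E where
  Q := Unit
  fin := inferInstance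
  start := ()
  trans _ s v := ⟨.inr (ex s), mv, v, fun _ => .stay, pr⟩

theorem single_does (mv : HeadMove) (pr : Option Letter) (ex : InputSymbol → E) (σ : RState) :
    (single (R := R) E mv pr ex).Does x S σ (ex (Transducer.readInput x σ.pos))
      ⟨Transducer.moveInput x σ.pos mv, σ.reg, σ.out ++ pr.toList⟩ := by
  intro m hm
  refine ⟨_, Run.exit (F := single E mv pr ex) (q := ()) hm.inSpace (by rw [← hm.pos]; rfl), ?_⟩
  refine ⟨by rw [← hm.pos]; rfl, by rw [← hm.out]; rfl, hm.head, fun i => ?_⟩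
  obtain ⟨l, h1, h2, h3⟩ := hm.tape i
  refine ⟨l, h1, h2, ?_⟩
  rw [← h3]
  exact Function.update_eq_self _ _

def pure (e : E) : Frag R E := single E .stay none fun _ => e

theorem pure_does (e : E) (σ : RState) : (pure (R := R) e).Does x S σ e σ := by
  have := single_does (R := R) (x := x) (S := S) .stay none (fun _ => e) σ
  simpa [Transducer.moveInput, pure] using this

theorem onTape_does {Q : Type} [Finite Q] {r : Fin R}
    {δ : Q → Option Bool → (Q ⊕ E) × Option Bool × HeadMove} {q₀ : Q} {σ : RState} {e : E} {v : ℕ}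
    (h : ∀ l : List Bool, l.length ≤ S → bitsVal l = σ.reg r →
      ∃ l' : List Bool, l'.length ≤ S ∧ bitsVal l' = v ∧
        TRun δ S q₀ (tapeOf l) 0 e (tapeOf l') 0) :
    (onTape r δ q₀).Does x S σ e (σ.set r v) := by
  intro m hm
  obtain ⟨l, h1, h2, h3⟩ := hm.tape r
  obtain ⟨l', h4, h5, h6⟩ := h l h1 h2
  refine ⟨_, h6.run m hm.inSpace h3 (hm.head r), hm.pos, hm.out, fun i => ?_, fun i => ?_⟩
  · by_cases hi : i = r
    · subst hi; simp
    · simpa [hi] using hm.head i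
  · by_cases hi : i = r
    · subst hi; exact ⟨l', h4, by simpa using h5, by simp⟩
    · obtain ⟨l, h1, h2, h3⟩ := hm.tape i
      refine ⟨l, h1, ?_, by simpa [hi] using h3⟩
      have : (i : ℕ) ≠ r := fun h => hi (Fin.ext h)
      simpa [this] using h2

def inc (r : Fin R) : Frag R Unit := onTape r incStep false

theorem inc_does (r : Fin R) {σ : RState} (h : σ.reg r + 1 < 2 ^ S) :
    (inc r).Does x S σ () (σ.set r (σ.reg r + 1)) := by
  refine onTape_does fun l h1 h2 => ⟨incBits l, ?_, ?_, ?_⟩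
  · exact length_incBits l S h1 (by rwa [h2])
  · rw [bitsVal_incBits, h2]
  · simpa using trun_inc [] l S (by simpa using h1)
      (by simpa using length_incBits l S h1 (by rwa [h2]))

def dec (r : Fin R) : Frag R Bool := onTape r decStep none

theorem dec_does (r : Fin R) (σ : RState) :
    (dec r).Does x S σ (decide (σ.reg r ≠ 0)) (σ.set r (σ.reg r - 1)) := by
  refine onTape_does fun l h1 h2 => ?_
  obtain ⟨l', h3, h4, h5⟩ := trun_dec 0 l S (by simpa using h1)
  refine ⟨l', by omega, by simpa [h2] using h4, ?_⟩
  simpa [h2] using h5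

/-- Run `F` as often as the register `r` says, counting down. -/
def forReg (r : Fin R) (F : Frag R Unit) : Frag R Unit :=
  loop ((dec r).bind fun b => bif b then F.bind fun _ => pure none else pure (some ()))

/-- The index of `P` is the number of rounds that remain, which is the content of `r` by `hr`; hence
the body starts with `r` already decremented and must leave it alone. -/
theorem forReg_of_invariant {r : Fin R} {F : Frag R Unit} {P : ℕ → RState → Prop} {n : ℕ}
    (hr : ∀ i σ, P i σ → σ.reg r = i)
    (hF : ∀ i < n, ∀ σ, P (i + 1) σ → ∃ τ, F.Does x S (σ.set r i) () τ ∧ P i τ)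
    {σ : RState} (hσ : P n σ) : ∃ τ, (forReg r F).Does x S σ () τ ∧ P 0 τ := by
  induction n generalizing σ with
  | zero =>
    refine ⟨σ, Does.loop_exit ?_, hσ⟩
    have := dec_does (x := x) (S := S) r σ
    have h0 : σ.set r (σ.reg r - 1) = σ := by
      conv_rhs => rw [← RState.set_eq_self σ r]
      rw [hr 0 σ hσ]
    rw [h0, hr 0 σ hσ] at this
    exact Does.bind this (pure_does _ _)
  | succ n ih =>
    have := dec_does (x := x) (S := S) r σ
    rw [hr _ σ hσ] at this
    obtain ⟨τ, h1, h2⟩ := hF n (by omega) σ hσ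
    obtain ⟨υ, h3, h4⟩ := ih (fun i hi => hF i (by omega)) h2
    exact ⟨υ, Does.loop_again (Does.bind this (Does.bind h1 (pure_does _ _))) h3, h4⟩

theorem forReg_does {r : Fin R} {F : Frag R Unit} (f : ℕ → RState) (n : ℕ)
    (hr : ∀ i, (f i).reg r = i)
    (hF : ∀ i < n, F.Does x S ((f (i + 1)).set r i) () (f i)) :
    (forReg r F).Does x S (f n) () (f 0) := by
  obtain ⟨τ, h, rfl⟩ := forReg_of_invariant (P := fun i σ => σ = f i) (n := n)
    (fun i σ h => h ▸ hr i) (fun i hi σ h => ⟨f i, h ▸ hF i hi, rfl⟩) rfl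
  exact h

def clear (r : Fin R) : Frag R Unit := forReg r (pure ())

theorem clear_does (r : Fin R) (σ : RState) : (clear r).Does x S σ () (σ.set r 0) := by
  have := forReg_does (x := x) (S := S) (r := r) (F := pure ()) (fun i => σ.set r i) (σ.reg r)
    (fun i => by simp) (fun i _ => by rw [RState.set_set]; exact pure_does _ _)
  rwa [RState.set_eq_self] at this

/-- Copy `a` to `b`, using the scratch register `c`. -/
def copy (a b c : Fin R) : Frag R Unit :=
  ((clear b).seq (clear c)).seq ((forReg a ((inc b).seq (inc c))).seq (forReg c (inc a)))

theorem copy_does {a b c : Fin R} (hab : a ≠ b) (hac : a ≠ c) (hbc : b ≠ c) (σ : RState) :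
    (copy a b c).Does x S σ () ((σ.set b (σ.reg a)).set c 0) := by
  intro m hm
  -- A number that is represented at all is below `2 ^ S`, so that copying needs no space
  -- hypothesis. The bound is extracted from one representation before the statement about all of
  -- them is resumed.
  have hlt := hm.lt a.2
  revert m
  change (copy a b c).Does x S σ () ((σ.set b (σ.reg a)).set c 0)
  have hab' : (a : ℕ) ≠ b := fun h => hab (Fin.ext h)
  have hac' : (a : ℕ) ≠ c := fun h => hac (Fin.ext h)
  have hbc' : (b : ℕ) ≠ c := fun h => hbc (Fin.ext h)
  generalize hn : σ.reg a = n at *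
  refine Does.seq (Does.seq (clear_does b σ) (clear_does c _)) (Does.seq (τ :=
    ((σ.set b n).set c n).set a 0) ?_ ?_)
  -- With `i` rounds left, `a` holds `i` and both `b` and `c` hold `n - i`. This loop empties `a`,
  -- and the next one moves `c` back into `a`.
  · have := forReg_does (x := x) (S := S) (r := a) (F := (inc b).seq (inc c))
      (fun i => ((σ.set b (n - i)).set c (n - i)).set a i) n (fun i => by simp) ?_
    · convert this using 1
      simp only [RState.set, RState.mk.injEq, true_and, and_true]
      rw [Nat.sub_self, eq_comm, Function.update_eq_self_iff]
      · simp [← hn, hac', hab']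
      · rw [Nat.sub_zero]
    · intro i hi
      refine Does.seq (inc_does b (σ := _) ?_) ?_
      · simp [hbc', hab'.symm]; omega
      · convert inc_does c (σ := _) _ using 1
        · simp only [RState.set, RState.mk.injEq, true_and, and_true]
          funext j
          by_cases h1 : j = a
          · subst h1; simp [hab', hac']
          · by_cases h2 : j = c
            · subst h2; simp [hbc'.symm, hac'.symm]; omega
            · by_cases h3 : j = b
              · subst h3; simp [hbc', hab'.symm]; omega
              · simp [h1, h2, h3]
        · simp [hbc'.symm, hac'.symm]; omega
  · have := forReg_does (x := x) (S := S) (r := c) (F := inc a)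
      (fun i => ((σ.set b n).set a (n - i)).set c i) n (fun i => by simp) ?_
    · convert this using 1
      · simp only [RState.set, RState.mk.injEq, true_and, and_true]
        funext i
        by_cases hi : i = a
        · subst hi; simp [hac']
        · simp [hi, Function.update_apply]
      · simp only [RState.set, RState.mk.injEq, true_and, and_true]
        funext i
        by_cases hi : i = a
        · subst hi; simp [hac', hab', hn]
        · simp [hi, Function.update_apply]
    · intro i hi
      convert inc_does a (σ := _) _ using 1
      · simp only [RState.set, RState.mk.injEq, true_and, and_true]
        funext j
        by_cases h1 : j = a
        · subst h1; simp [hac']; omega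
        · by_cases h2 : j = c
          · subst h2; simp [hac'.symm]
          · simp [h1, h2, Function.update_apply]
      · simp [hac']; omega

/-! ## Reading the input -/

/-- Letters as numbers, `0` standing for no letter. -/
def letterCode : Option Letter → ℕ
  | none => 0
  | some (.bit false) => 1
  | some (.bit true) => 2
  | some .comma => 3
  | some .semicolon => 4

theorem letterCode_le (a : Option Letter) : letterCode a ≤ 4 := by
  rcases a with _ | (_ | _) | _ | _ <;> simp [letterCode]

theorem letterCode_injective : Function.Injective letterCode := by
  rintro (_ | (_ | _) | _ | _) (_ | (_ | _) | _ | _) <;> simp [letterCode]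

def toLetter : InputSymbol → Option Letter
  | .letter a => some a
  | _ => none

def isLeftEnd : InputSymbol → Bool
  | .leftEnd => true
  | _ => false

def isRightEnd : InputSymbol → Bool
  | .rightEnd => true
  | _ => false

theorem readInput_succ (x : List Letter) (i : ℕ) :
    Transducer.readInput x (i + 1) = x[i]?.elim .rightEnd .letter := by
  change (match x[i]? with
    | some a => InputSymbol.letter a
    | none => InputSymbol.rightEnd) = _
  cases x[i]? <;> rfl

theorem toLetter_readInput (x : List Letter) (i : ℕ) :
    toLetter (Transducer.readInput x (i + 1)) = x[i]? := by
  rw [readInput_succ]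
  cases x[i]? <;> rfl

theorem isLeftEnd_readInput (x : List Letter) (i : ℕ) :
    isLeftEnd (Transducer.readInput x i) = decide (i = 0) := by
  cases i with
  | zero => rfl
  | succ i => rw [readInput_succ]; cases x[i]? <;> rfl

theorem isRightEnd_readInput (x : List Letter) (i : ℕ) :
    isRightEnd (Transducer.readInput x (i + 1)) = decide (x.length ≤ i) := by
  rw [readInput_succ]
  cases h : x[i]? with
  | none => simpa [isRightEnd] using h
  | some a => simpa [isRightEnd] using (List.getElem?_eq_some_iff.1 h).1

/-- Move the input head to the left end. -/
def rewind : Frag R Unit :=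
  loop ((single Bool .stay none isLeftEnd).bind fun b =>
    bif b then pure (some ()) else single _ .left none fun _ => none)

theorem rewind_does (σ : RState) : (rewind (R := R)).Does x S σ () { σ with pos := 0 } := by
  obtain ⟨p, s, o⟩ := σ
  induction p with
  | zero =>
    refine Does.loop_exit (Does.bind (single_does _ _ _ _) ?_)
    rw [isLeftEnd_readInput]
    simpa [Transducer.moveInput] using pure_does _ _
  | succ p ih =>
    refine Does.loop_again (Does.bind (single_does _ _ _ _) ?_) ih
    rw [isLeftEnd_readInput]
    simpa [Transducer.moveInput] using
      single_does (R := R) (x := x) (S := S) .left none (fun _ => (none : Option Unit))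
        ⟨p + 1, s, o⟩

def incN (r : Fin R) : ℕ → Frag R Unit
  | 0 => pure ()
  | n + 1 => (inc r).seq (incN r n)

theorem incN_does (r : Fin R) (n : ℕ) {σ : RState} (h : σ.reg r + n < 2 ^ S) :
    (incN r n).Does x S σ () (σ.set r (σ.reg r + n)) := by
  induction n generalizing σ with
  | zero => rw [add_zero, RState.set_eq_self]; exact pure_does _ _
  | succ n ih =>
    refine Does.seq (inc_does r (by omega)) ?_
    have := ih (σ := σ.set r (σ.reg r + 1)) (by simp; omega)
    rw [RState.set_set] at this
    convert this using 2
    simp; omega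

theorem moveRight_does (σ : RState) : (single (R := R) Unit .right none fun _ => ()).Does x S σ ()
    { σ with pos := min (σ.pos + 1) (x.length + 1) } := by
  simpa [Transducer.moveInput] using single_does (R := R) (x := x) (S := S) .right none
    (fun _ => ()) σ

/-- Put the code of the letter at the position given by `a` into `b`; the register `a` is lost. -/
def readAt (a b : Fin R) : Frag R Unit :=
  (((clear b).seq (forReg a (single _ .right none fun _ => ()))).seq
    ((single _ .right none fun _ => ()).seq
      ((single _ .stay none toLetter).bind fun l => incN b (letterCode l)))).seq rewind

theorem readAt_does {a b : Fin R} (hab : a ≠ b) {σ : RState} (h0 : σ.pos = 0)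
    (hS : 4 < 2 ^ S) :
    (readAt a b).Does x S σ () ((σ.set b (letterCode x[σ.reg a]?)).set a 0) := by
  obtain ⟨p, s, o⟩ := σ
  subst h0
  have hab' : (a : ℕ) ≠ b := fun h => hab (Fin.ext h)
  generalize hn : s a = n
  refine Does.seq (Does.seq (Does.seq (clear_does b _) (υ := ⟨min n (x.length + 1), ((RState.mk 0 s o).set b 0).set a 0 |>.reg, o⟩) ?_)
      (Does.seq (moveRight_does _) (Does.bind (single_does _ _ _ _)
        (incN_does b _ ?_)))) ?_
  · have := forReg_does (x := x) (S := S) (r := a) (F := single _ .right none fun _ => ())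
      (fun i => ⟨min (n - i) (x.length + 1), ((RState.mk 0 s o).set b 0).set a i |>.reg, o⟩) n
      (fun i => by simp) ?_
    · convert this using 1
      · simp [RState.set, ← hn]
        simp [hab']
      · rw [Nat.sub_zero]
    · intro i hi
      convert moveRight_does _ using 1
      simp [RState.set]
      omega
  · simp only [RState.set_reg, ne_eq, hab'.symm, not_false_eq_true, Function.update_of_ne,
      Function.update_self, zero_add]
    exact (letterCode_le _).trans_lt hS
  · convert rewind_does _ using 1
    -- Position `0` holds the left endmarker, hence one extra move to the right. For an index beyond
    -- the word the head ends on the right endmarker, which is read as code `0`, just like `none`.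
    have : min (min n (x.length + 1) + 1) (x.length + 1) = min n x.length + 1 := by omega
    simp only [RState.set, hn, this, toLetter_readInput, ne_eq, hab'.symm, not_false_eq_true,
      Function.update_of_ne, Function.update_self, zero_add, Transducer.moveInput,
      Option.toList_none, List.append_nil, RState.mk.injEq, and_true, true_and]
    have e : x[min n x.length]? = x[n]? := by
      rcases le_total n x.length with h | h
      · rw [min_eq_left h]
      · rw [min_eq_right h, List.getElem?_eq_none le_rfl, List.getElem?_eq_none h]
    rw [e]
    funext j
    by_cases h1 : j = a
    · subst h1; simp [hab']
    · by_cases h2 : j = b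
      · subst h2; simp [hab'.symm]
      · simp [h1, h2]

/-- Put the length of the input into `b`. -/
def readLength (b : Fin R) : Frag R Unit :=
  ((clear b).seq (loop ((single Unit .right none fun _ => ()).bind fun _ =>
    (single _ .stay none isRightEnd).bind fun e =>
      bif e then pure (some ()) else (inc b).bind fun _ => pure none))).seq rewind

theorem readLength_does (b : Fin R) {σ : RState} (h0 : σ.pos = 0) (hS : x.length < 2 ^ S) :
    (readLength b).Does x S σ () (σ.set b x.length) := by
  obtain ⟨p, s, o⟩ := σ
  subst h0
  refine Does.seq (τ := ⟨x.length + 1, Function.update s b x.length, o⟩)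
    (Does.seq (clear_does b _) ?_) (rewind_does _)
  -- Here `k` is the number of letters not yet counted; the head position and the counter agree
  -- throughout.
  have key : ∀ k ≤ x.length, (loop ((single (R := R) Unit .right none fun _ => ()).bind fun _ =>
    (single _ .stay none isRightEnd).bind fun e =>
      bif e then pure (some ()) else (inc b).bind fun _ => pure none)).Does x S
      ⟨x.length - k, Function.update s b (x.length - k), o⟩ ()
      ⟨x.length + 1, Function.update s b x.length, o⟩ := by
    intro k hk
    induction k with
    | zero =>
      refine Does.loop_exit (Does.bind (moveRight_does _) (Does.bind (single_does _ _ _ _) ?_))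
      simp only [tsub_zero, min_self, isRightEnd_readInput, le_refl, decide_true, cond_true]
      simpa [Transducer.moveInput] using pure_does _ _
    | succ k ih =>
      refine Does.loop_again (Does.bind (moveRight_does _) (Does.bind (single_does _ _ _ _) ?_))
        (ih (by omega))
      have e : min (x.length - (k + 1) + 1) (x.length + 1) = x.length - (k + 1) + 1 := by omega
      have e' : ¬ x.length ≤ x.length - (k + 1) := by omega
      simp only [e, isRightEnd_readInput, e', decide_false, cond_false]
      refine Does.bind (inc_does b (by simp; omega)) ?_
      convert pure_does _ _ using 1
      simp [Transducer.moveInput, RState.set]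
      constructor
      · omega
      · congr 1; omega
  have := key x.length le_rfl
  rw [Nat.sub_self] at this
  exact this

/-! ## Printing -/

def codeLetter : ℕ → Option Letter
  | 0 => none
  | 1 => some (.bit false)
  | 2 => some (.bit true)
  | 3 => some .comma
  | _ => some .semicolon

theorem codeLetter_letterCode (a : Option Letter) : codeLetter (letterCode a) = a := by
  rcases a with _ | (_ | _) | _ | _ <;> rfl

/-- Print the letter whose code is in `r`, which is lost, if the code is at most `n` more than
`k`. -/
def printFrom (r : Fin R) : ℕ → ℕ → Frag R Unit
  | k, 0 => single _ .stay (codeLetter k) fun _ => ()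
  | k, n + 1 => (dec r).bind fun b =>
      bif b then printFrom r (k + 1) n else single _ .stay (codeLetter k) fun _ => ()

theorem printFrom_does (r : Fin R) (k n : ℕ) (σ : RState) (h : σ.reg r ≤ n) :
    ∃ τ : RState, (printFrom r k n).Does x S σ () τ ∧ (∀ i ≠ (r : ℕ), τ.reg i = σ.reg i) ∧
      τ.pos = σ.pos ∧ τ.out = σ.out ++ (codeLetter (k + σ.reg r)).toList := by
  induction n generalizing k σ with
  | zero =>
    refine ⟨_, single_does _ _ _ _, fun i _ => rfl, rfl, ?_⟩
    simp only [nonpos_iff_eq_zero] at h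
    simp [h]
  | succ n ih =>
    by_cases h0 : σ.reg r = 0
    · refine ⟨⟨σ.pos, (σ.set r 0).reg, σ.out ++ (codeLetter k).toList⟩,
        Does.bind (dec_does r σ) (e' := ()) ?_, ?_, rfl, ?_⟩
      · simp only [h0, ne_eq, not_true_eq_false, decide_false, cond_false]
        exact single_does _ _ _ _
      · intro i hi; simp [hi]
      · simp [h0]
    · obtain ⟨τ, h1, h2, h3, h4⟩ := ih (k + 1) (σ.set r (σ.reg r - 1)) (by simp; omega)
      refine ⟨τ, Does.bind (dec_does r σ) ?_, fun i hi => ?_, h3, ?_⟩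
      · simpa [h0] using h1
      · rw [h2 i hi]; simp [hi]
      · rw [h4]; simp
        congr 2; omega

def print (r : Fin R) : Frag R Unit := printFrom r 0 4

theorem print_does (r : Fin R) (σ : RState) {a : Option Letter} (h : σ.reg r = letterCode a) :
    ∃ τ : RState, (print r).Does x S σ () τ ∧ (∀ i ≠ (r : ℕ), τ.reg i = σ.reg i) ∧
      τ.pos = σ.pos ∧ τ.out = σ.out ++ a.toList := by
  have := printFrom_does (x := x) (S := S) r 0 4 σ (h ▸ letterCode_le a)
  rwa [h, zero_add, codeLetter_letterCode] at this

end Frag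

end Logspace

/-! ### Compilation of polynomially bounded recursion to logspace machines. -/

namespace Logspace

open Frag

/-! ## Logspace functions -/

/-- Functions of a word and finitely many numbers that can be computed in logarithmic space. In the
recursion all intermediate values have to be polynomially bounded. -/
inductive LF : (Word → List ℕ → ℕ) → Prop
  | var (i : ℕ) : LF fun _ e => e.getD i 0
  | zero : LF fun _ _ => 0
  | succ {f} : LF f → LF fun x e => f x e + 1
  | len : LF fun x _ => x.length
  | read {f} : LF f → LF fun x e => letterCode x[f x e]?
  | comp {f} {gs : List (Word → List ℕ → ℕ)} : LF f → (∀ g ∈ gs, LF g) →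
      LF fun x e => f x (gs.map fun g => g x e)
  | prec {n f g} : LF n → LF f → LF g →
      (∃ c : ℕ, ∀ x e, ∀ i ≤ n x e,
        Nat.rec (f x e) (fun i a => g x (a :: i :: e)) i ≤ (x.length + e.sum + 2) ^ c) →
      LF fun x e => Nat.rec (f x e) (fun i a => g x (a :: i :: e)) (n x e)

/-- Polynomial bounds are always powers of `x.length + e.sum + 2`. The summand `2` makes the base at
least `2`, so that a sum of bounds is again a bound of the same shape. -/
theorem pow_add_pow_le {N : ℕ} (hN : 2 ≤ N) (a b : ℕ) : N ^ a + N ^ b ≤ N ^ (a + b + 1) := by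
  have h1 : N ^ a ≤ N ^ (a + b) := Nat.pow_le_pow_right (by omega) (by omega)
  have h2 : N ^ b ≤ N ^ (a + b) := Nat.pow_le_pow_right (by omega) (by omega)
  calc N ^ a + N ^ b ≤ N ^ (a + b) * 2 := by omega
    _ ≤ N ^ (a + b) * N := Nat.mul_le_mul_left _ hN
    _ = _ := (pow_succ _ _).symm

theorem list_bounded {gs : List (Word → List ℕ → ℕ)}
    (h : ∀ g ∈ gs, ∃ c : ℕ, ∀ x e, g x e ≤ (x.length + e.sum + 2) ^ c) :
    ∃ c : ℕ, ∀ x e, x.length + (gs.map fun g => g x e).sum + 2 ≤ (x.length + e.sum + 2) ^ c := by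
  induction gs with
  | nil => exact ⟨1, fun x e => by simp⟩
  | cons g gs ih =>
    obtain ⟨c, hc⟩ := ih fun g hg => h g (by simp [hg])
    obtain ⟨c', hc'⟩ := h g (by simp)
    refine ⟨c + c' + 1, fun x e => ?_⟩
    refine le_trans ?_ (pow_add_pow_le (by omega) c c')
    have := hc x e
    have := hc' x e
    simp only [List.map_cons, List.sum_cons]
    omega

theorem LF.bounded {f} (hf : LF f) : ∃ c : ℕ, ∀ x e, f x e ≤ (x.length + e.sum + 2) ^ c := by
  induction hf with
  | var i =>
    refine ⟨1, fun x e => ?_⟩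
    rw [pow_one]
    beta_reduce
    by_cases hi : i < e.length
    · have := List.single_le_sum (l := e) (by simp) (e.getD i 0)
        (by rw [List.getD_eq_getElem _ _ hi]; exact List.getElem_mem hi)
      omega
    · rw [List.getD_eq_default _ _ (by omega)]; omega
  | zero => exact ⟨0, fun x e => by simp⟩
  | succ _ ih =>
    obtain ⟨c, hc⟩ := ih
    refine ⟨c + 0 + 1, fun x e => le_trans ?_ (pow_add_pow_le (by omega) c 0)⟩
    have := hc x e
    simpa using this
  | len => exact ⟨1, fun x e => by rw [pow_one]; beta_reduce; omega⟩
  | read _ _ =>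
    refine ⟨2, fun x e => (letterCode_le _).trans ?_⟩
    calc 4 = 2 ^ 2 := rfl
      _ ≤ _ := Nat.pow_le_pow_left (by omega) 2
  | comp _ _ ih ih' =>
    obtain ⟨c, hc⟩ := ih
    obtain ⟨c', hc'⟩ := list_bounded ih'
    refine ⟨c' * c, fun x e => (hc x _).trans ?_⟩
    rw [pow_mul]
    exact Nat.pow_le_pow_left (hc' x e) c
  | prec _ _ _ hb =>
    obtain ⟨c, hc⟩ := hb
    exact ⟨c, fun x e => hc x e _ le_rfl⟩

/-- Replacing the input word by the output of a logspace computation. -/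
theorem LF.subst {w : Word → Word} {l a : Word → List ℕ → ℕ} (hl : LF l) (ha : LF a)
    (hl' : ∀ x, l x [] = (w x).length) (ha' : ∀ x i, a x [i] = letterCode (w x)[i]?) {f} (hf : LF f) :
    LF fun x e => f (w x) e := by
  have hl₀ : LF fun x _ => (w x).length := by
    have := LF.comp (gs := []) hl (by simp)
    simpa [hl'] using this
  obtain ⟨k, hk⟩ := hl₀.bounded
  induction hf with
  | var i => exact LF.var i
  | zero => exact LF.zero
  | succ _ ih => exact ih.succ
  | len => exact hl₀
  -- The point of composing logspace functions: a letter of `w x` is computed anew whenever it is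
  -- read, and `w x` is never stored.
  | @read f _ ih =>
    have := LF.comp (gs := [fun x e => f (w x) e]) ha (by simpa using ih)
    simpa [ha'] using this
  | @comp f gs _ _ ih ih' =>
    have := LF.comp (gs := gs.map fun g x e => g (w x) e) ih (by simpa using ih')
    simpa [Function.comp_def] using this
  | prec _ _ _ hb ih₁ ih₂ ih₃ =>
    refine LF.prec ih₁ ih₂ ih₃ ?_
    obtain ⟨c, hc⟩ := hb
    -- If `N` is the base belonging to `x`, then the length of `w x` is at most `N ^ k`, so the base
    -- belonging to `w x` is at most `N ^ k + N`.
    refine ⟨(k + 1 + 1) * c, fun x e i hi => (hc (w x) e i hi).trans ?_⟩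
    rw [pow_mul]
    refine Nat.pow_le_pow_left (le_trans ?_ (pow_add_pow_le (by omega) k 1)) c
    have := hk x e
    rw [pow_one]
    omega

/-- The fragment puts the number `v` into the register `d` and does not change the registers
below `d`. -/
def Frag.Puts {R : ℕ} (F : Frag R Unit) (x : Word) (S : ℕ) (σ : RState) (d v : ℕ) : Prop :=
  ∃ τ, F.Does x S σ () τ ∧ τ.pos = 0 ∧ τ.out = σ.out ∧ (∀ r < d, τ.reg r = σ.reg r) ∧ τ.reg d = v

/-- There are fragments that compute `f` with the arguments in the registers `ρ`. -/
def Compiles (f : Word → List ℕ → ℕ) : Prop :=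
  ∀ (ρ : List ℕ) (d : ℕ), (∀ r ∈ ρ, r < d) → ∃ R₀, ∀ R, R₀ ≤ R → ∃ (F : Frag R Unit) (c : ℕ),
    ∀ x S σ, σ.pos = 0 → (x.length + (ρ.map σ.reg).sum + 2) ^ c < 2 ^ S →
      F.Puts x S σ d (f x (ρ.map σ.reg))

theorem pow_lt_of_le {N c c' S : ℕ} (hN : 2 ≤ N) (h : N ^ c' < 2 ^ S) (hc : c ≤ c') :
    N ^ c < 2 ^ S :=
  (Nat.pow_le_pow_right (by omega) hc).trans_lt h

theorem map_reg_congr {ρ : List ℕ} {d : ℕ} (hρ : ∀ r ∈ ρ, r < d) {s t : ℕ → ℕ}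
    (h : ∀ r < d, s r = t r) : ρ.map s = ρ.map t :=
  List.map_congr_left fun r hr => h r (hρ r hr)

theorem copy_puts {R : ℕ} {x : Word} {S : ℕ} {a b c : Fin R} (hba : b < a) (hbc : b < c)
    (hac : a ≠ c) {σ : RState} (h0 : σ.pos = 0) : (copy a b c).Puts x S σ b (σ.reg a) := by
  have h1 : (b : ℕ) < a := hba
  have h2 : (b : ℕ) < c := hbc
  refine ⟨_, copy_does hba.ne' hac hbc.ne σ, h0, rfl, fun r hr => ?_, ?_⟩
  · have h3 : r ≠ b := by omega
    have h4 : r ≠ c := by omega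
    simp [h3, h4]
  · simp [h2.ne]

theorem Compiles.var (i : ℕ) : Compiles fun _ e => e.getD i 0 := by
  intro ρ d hρ
  refine ⟨d + 2, fun R hR => ?_⟩
  by_cases hi : i < ρ.length
  · have hlt : ρ[i] < d := hρ _ (List.getElem_mem hi)
    refine ⟨copy ⟨ρ[i], by omega⟩ ⟨d, by omega⟩ ⟨d + 1, by omega⟩, 0, fun x S σ h0 _ =>
      ⟨_, copy_does (by simp; omega) (by simp; omega) (by simp) σ, h0, rfl, fun r hr => ?_, ?_⟩⟩
    · have h3 : r ≠ d := by omega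
      have h4 : r ≠ d + 1 := by omega
      simp [h3, h4]
    · simp [hi]
  · refine ⟨clear ⟨d, by omega⟩, 0, fun x S σ h0 _ => ⟨_, clear_does _ σ, h0, rfl,
      fun r hr => ?_, ?_⟩⟩
    · simp [hr.ne]
    · simp [List.getElem?_eq_none (not_lt.1 hi)]

theorem Compiles.zero : Compiles fun _ _ => 0 := by
  intro ρ d hρ
  refine ⟨d + 1, fun R hR => ⟨clear ⟨d, by omega⟩, 0, fun x S σ h0 _ => ⟨_, clear_does _ σ, h0, rfl,
      fun r hr => ?_, ?_⟩⟩⟩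
  · simp [hr.ne]
  · simp

theorem Compiles.succ {f} (hf : LF f) (h : Compiles f) : Compiles fun x e => f x e + 1 := by
  intro ρ d hρ
  obtain ⟨R₀, hR₀⟩ := h ρ d hρ
  obtain ⟨b, hb⟩ := hf.succ.bounded
  refine ⟨max R₀ (d + 1), fun R hR => ?_⟩
  obtain ⟨F, c, hF⟩ := hR₀ R (by omega)
  refine ⟨F.seq (inc ⟨d, by omega⟩), max b c, fun x S σ h0 hS => ?_⟩
  obtain ⟨τ, h1, h2, h3, h4, h5⟩ := hF x S σ h0 (pow_lt_of_le (by omega) hS (by omega))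
  refine ⟨_, h1.seq (inc_does _ ?_), h2, h3, fun r hr => ?_, ?_⟩
  · simp only [h5]
    exact (hb x _).trans_lt (pow_lt_of_le (by omega) hS (by omega))
  · simp [hr.ne, h4 r hr]
  · simp [h5]

theorem Compiles.len : Compiles fun x _ => x.length := by
  intro ρ d hρ
  refine ⟨d + 1, fun R hR => ⟨readLength ⟨d, by omega⟩, 1, fun x S σ h0 hS =>
    ⟨_, readLength_does _ h0 (by rw [pow_one] at hS; omega), h0, rfl, fun r hr => ?_, ?_⟩⟩⟩
  · simp [hr.ne]
  · simp

theorem Compiles.read {f} (h : Compiles f) : Compiles fun x e => letterCode x[f x e]? := by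
  intro ρ d hρ
  obtain ⟨R₀, hR₀⟩ := h ρ (d + 1) fun r hr => (hρ r hr).trans (by omega)
  refine ⟨max R₀ (d + 2), fun R hR => ?_⟩
  obtain ⟨F, c, hF⟩ := hR₀ R (by omega)
  refine ⟨F.seq (readAt ⟨d + 1, by omega⟩ ⟨d, by omega⟩), max c 3, fun x S σ h0 hS => ?_⟩
  obtain ⟨τ, h1, h2, h3, h4, h5⟩ := hF x S σ h0 (pow_lt_of_le (by omega) hS (by omega))
  refine ⟨_, h1.seq (readAt_does (by simp) h2 ?_), h2, h3, fun r hr => ?_, ?_⟩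
  · have : 2 ^ 3 ≤ (x.length + (ρ.map σ.reg).sum + 2) ^ 3 := Nat.pow_le_pow_left (by omega) 3
    have := pow_lt_of_le (by omega) hS (le_max_right c 3)
    omega
  · have h6 : r ≠ d := by omega
    have h7 : r ≠ d + 1 := by omega
    simp [h6, h7, h4 r (by omega)]
  · simp [h5]

/-- The values are put into consecutive registers from `d` on. A fragment with target `d + 1` keeps
all registers up to `d`, so earlier values and the arguments survive. -/
theorem compiles_list {gs : List (Word → List ℕ → ℕ)} (h : ∀ g ∈ gs, Compiles g) (ρ : List ℕ)
    (d : ℕ) (hρ : ∀ r ∈ ρ, r < d) : ∃ R₀, ∀ R, R₀ ≤ R → ∃ (F : Frag R Unit) (c : ℕ),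
    ∀ x S σ, σ.pos = 0 → (x.length + (ρ.map σ.reg).sum + 2) ^ c < 2 ^ S →
      ∃ τ, F.Does x S σ () τ ∧ τ.pos = 0 ∧ τ.out = σ.out ∧ (∀ r < d, τ.reg r = σ.reg r) ∧
        (List.range' d gs.length).map τ.reg = gs.map fun g => g x (ρ.map σ.reg) := by
  induction gs generalizing d with
  | nil => exact ⟨0, fun R _ => ⟨Frag.pure (), 0, fun x S σ h0 _ =>
      ⟨σ, pure_does _ _, h0, rfl, fun _ _ => rfl, rfl⟩⟩⟩
  | cons g gs ih =>
    obtain ⟨R₀, hR₀⟩ := h g (by simp) ρ d hρ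
    obtain ⟨R₁, hR₁⟩ := ih (fun g hg => h g (by simp [hg])) (d + 1)
      fun r hr => (hρ r hr).trans (by omega)
    refine ⟨max R₀ R₁, fun R hR => ?_⟩
    obtain ⟨F, c, hF⟩ := hR₀ R (by omega)
    obtain ⟨G, c', hG⟩ := hR₁ R (by omega)
    refine ⟨F.seq G, max c c', fun x S σ h0 hS => ?_⟩
    obtain ⟨τ, h1, h2, h3, h4, h5⟩ := hF x S σ h0 (pow_lt_of_le (by omega) hS (by omega))
    have e := map_reg_congr hρ h4
    obtain ⟨υ, k1, k2, k3, k4, k5⟩ := hG x S τ h2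
      (by rw [e]; exact pow_lt_of_le (by omega) hS (by omega))
    refine ⟨υ, h1.seq k1, k2, k3.trans h3, fun r hr => (k4 r (by omega)).trans (h4 r hr), ?_⟩
    simp only [List.length_cons, List.range'_succ, List.map_cons]
    rw [k5, k4 d (by omega), h5, e]

theorem Compiles.comp {f} {gs : List (Word → List ℕ → ℕ)} (hgs : ∀ g ∈ gs, LF g)
    (h : Compiles f) (h' : ∀ g ∈ gs, Compiles g) :
    Compiles fun x e => f x (gs.map fun g => g x e) := by
  intro ρ d hρ
  obtain ⟨R₀, hR₀⟩ := compiles_list h' ρ (d + 1) fun r hr => (hρ r hr).trans (by omega)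
  obtain ⟨R₁, hR₁⟩ := h (List.range' (d + 1) gs.length) (d + 1 + gs.length)
    (by intro r hr; rw [List.mem_range'_1] at hr; omega)
  obtain ⟨b, hb⟩ := list_bounded fun g hg => (hgs g hg).bounded
  refine ⟨max (max R₀ R₁) (d + gs.length + 3), fun R hR => ?_⟩
  obtain ⟨F, c, hF⟩ := hR₀ R (by omega)
  obtain ⟨G, c', hG⟩ := hR₁ R (by omega)
  refine ⟨(F.seq G).seq (copy ⟨d + 1 + gs.length, by omega⟩ ⟨d, by omega⟩
    ⟨d + 2 + gs.length, by omega⟩), max c (b * c'), fun x S σ h0 hS => ?_⟩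
  obtain ⟨τ, h1, h2, h3, h4, h5⟩ := hF x S σ h0 (pow_lt_of_le (by omega) hS (by omega))
  obtain ⟨υ, k1, k2, k3, k4, k5⟩ := hG x S τ h2 (by
    rw [h5]
    refine (Nat.pow_le_pow_left (hb x _) c').trans_lt ?_
    rw [← pow_mul]
    exact pow_lt_of_le (by omega) hS (by omega))
  obtain ⟨φ, l1, l2, l3, l4, l5⟩ := copy_puts (x := x) (S := S)
    (a := (⟨d + 1 + gs.length, by omega⟩ : Fin R)) (b := ⟨d, by omega⟩)
    (c := ⟨d + 2 + gs.length, by omega⟩) (by simp; omega) (by simp; omega) (by simp) k2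
  refine ⟨φ, (h1.seq k1).seq l1, l2, l3.trans (k3.trans h3), fun r hr => ?_, ?_⟩
  · rw [l4 r hr, k4 r (by omega), h4 r (by omega)]
  · rw [l5, k5, h5]

/-- Register `d + 1` counts the remaining rounds, `d + 2` holds the recursion index, `d + 3` the
accumulator, and `d + 4` the freshly computed value, which is copied into `d + 3` with scratch
register `d + 5`. With `k` rounds left the index is `n - k` and the accumulator is the recursion
value there. The result is finally copied to `d`. -/
theorem Compiles.prec {n f g} (hn : LF n) (h₁ : Compiles n) (h₂ : Compiles f)
    (h₃ : Compiles g) (hb : ∃ c : ℕ, ∀ x e, ∀ i ≤ n x e,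
      Nat.rec (f x e) (fun i a => g x (a :: i :: e)) i ≤ (x.length + e.sum + 2) ^ c) :
    Compiles fun x e => Nat.rec (f x e) (fun i a => g x (a :: i :: e)) (n x e) := by
  intro ρ d hρ
  obtain ⟨b, hb⟩ := hb
  obtain ⟨b', hb'⟩ := hn.bounded
  obtain ⟨R₁, hR₁⟩ := h₁ ρ (d + 1) fun r hr => (hρ r hr).trans (by omega)
  obtain ⟨R₂, hR₂⟩ := h₂ ρ (d + 3) fun r hr => (hρ r hr).trans (by omega)
  obtain ⟨R₃, hR₃⟩ := h₃ ((d + 3) :: (d + 2) :: ρ) (d + 4) (by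
    intro r hr
    simp only [List.mem_cons] at hr
    rcases hr with rfl | rfl | hr
    · omega
    · omega
    · have := hρ r hr; omega)
  refine ⟨max (max R₁ R₂) (max R₃ (d + 6)), fun R hR => ?_⟩
  obtain ⟨F₁, c₁, hF₁⟩ := hR₁ R (by omega)
  obtain ⟨F₂, c₂, hF₂⟩ := hR₂ R (by omega)
  obtain ⟨F₃, c₃, hF₃⟩ := hR₃ R (by omega)
  let q1 : Fin R := ⟨d + 1, by omega⟩
  let q2 : Fin R := ⟨d + 2, by omega⟩
  let q3 : Fin R := ⟨d + 3, by omega⟩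
  let q4 : Fin R := ⟨d + 4, by omega⟩
  let q5 : Fin R := ⟨d + 5, by omega⟩
  let q0 : Fin R := ⟨d, by omega⟩
  refine ⟨((F₁.seq (clear q2)).seq F₂).seq ((forReg q1 ((F₃.seq (copy q4 q3 q5)).seq (inc q2))).seq
    (copy q3 q0 q4)), max (max c₁ c₂) ((b + (b' + 1 + 1) + 1) * max c₃ 1), fun x S σ h0 hS => ?_⟩
  generalize hN : x.length + (ρ.map σ.reg).sum + 2 = N at hS
  have hN2 : 2 ≤ N := by omega
  obtain ⟨τ₁, i1, i2, i3, i4, i5⟩ := hF₁ x S σ h0 (by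
    rw [hN]; exact pow_lt_of_le hN2 hS (by omega))
  have e₁ : ρ.map τ₁.reg = ρ.map σ.reg :=
    map_reg_congr (fun r hr => (hρ r hr).trans (Nat.lt_succ_self d)) i4
  have j1 := clear_does (x := x) (S := S) q2 τ₁
  generalize hτ₂ : τ₁.set q2 0 = τ₂ at j1
  have j2 : τ₂.pos = 0 := by rw [← hτ₂]; exact i2
  have j3 : τ₂.out = σ.out := by rw [← hτ₂]; exact i3
  have j4 : ∀ r < d + 2, τ₂.reg r = τ₁.reg r := by
    intro r hr
    have : r ≠ d + 2 := by omega
    rw [← hτ₂]; simp [q2, this]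
  have j5 : τ₂.reg (d + 2) = 0 := by rw [← hτ₂]; simp [q2]
  have e₂ : ρ.map τ₂.reg = ρ.map σ.reg := by
    rw [← e₁]
    exact map_reg_congr (fun r hr => (hρ r hr).trans (by omega : d < d + 2)) j4
  obtain ⟨τ₃, k1, k2, k3, k4, k5⟩ := hF₂ x S τ₂ j2 (by
    rw [e₂, hN]; exact pow_lt_of_le hN2 hS (by omega))
  rw [e₂] at k5
  set v := n x (ρ.map σ.reg) with hv
  set rc : ℕ → ℕ := fun i => Nat.rec (f x (ρ.map σ.reg)) (fun i a => g x (a :: i :: ρ.map σ.reg)) i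
    with hrc
  let P : ℕ → RState → Prop := fun k φ => k ≤ v ∧ φ.reg q1 = k ∧ φ.pos = 0 ∧ φ.out = σ.out ∧
    (∀ r < d, φ.reg r = σ.reg r) ∧ φ.reg (d + 2) = v - k ∧ φ.reg (d + 3) = rc (v - k)
  -- The step function sees the accumulator and the index as additional arguments. Their sum with
  -- `N` is a power of `N`, and raising it to the power `max c₃ 1` covers both the space needed by
  -- `F₃` and the increment of the index.
  have hbound : ∀ i ≤ v, rc i + i + N ≤ N ^ (b + (b' + 1 + 1) + 1) := by
    intro i hi
    refine le_trans ?_ (pow_add_pow_le hN2 _ _)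
    have h1 := pow_add_pow_le hN2 b' 1
    have h2 := hb x (ρ.map σ.reg) i hi
    have h3 := hb' x (ρ.map σ.reg)
    rw [hN] at h2 h3
    change rc i ≤ _ at h2
    rw [pow_one] at h1
    omega
  obtain ⟨τ₄, l1, l2⟩ := forReg_of_invariant (x := x) (S := S) (r := q1)
    (F := (F₃.seq (copy q4 q3 q5)).seq (inc q2)) (P := P) (n := v)
    (fun i φ h => h.2.1) (by
      rintro i hi φ ⟨p1, p2, p3, p4, p5, p6, p7⟩
      have e₃ : ρ.map (φ.set q1 i).reg = ρ.map σ.reg := by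
        refine map_reg_congr hρ fun r hr => ?_
        have : r ≠ d + 1 := by omega
        rw [← p5 r hr]; simp [q1, this]
      have e₄ : ((d + 3) :: (d + 2) :: ρ).map (φ.set q1 i).reg =
          rc (v - (i + 1)) :: (v - (i + 1)) :: ρ.map σ.reg := by
        simp only [List.map_cons, e₃]
        simp [q1, p6, p7]
      have hbd := hbound (v - (i + 1)) (by omega)
      have hlt : N ^ ((b + (b' + 1 + 1) + 1) * max c₃ 1) < 2 ^ S := pow_lt_of_le hN2 hS (by omega)
      obtain ⟨φ₁, s1, s2, s3, s4, s5⟩ := hF₃ x S (φ.set q1 i) p3 (by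
        rw [e₄]
        simp only [List.sum_cons]
        refine lt_of_le_of_lt ?_ hlt
        rw [pow_mul]
        refine (Nat.pow_le_pow_right (by omega) (le_max_left c₃ 1)).trans
          (Nat.pow_le_pow_left ?_ _)
        omega)
      rw [e₄] at s5
      obtain ⟨φ₂, t1, t2, t3, t4, t5⟩ := copy_puts (x := x) (S := S) (a := q4) (b := q3) (c := q5)
        (by simp [q3, q4]) (by simp [q3, q5]) (by simp [q4, q5]) s2
      have hrec : rc (v - i) = g x (rc (v - (i + 1)) :: (v - (i + 1)) :: ρ.map σ.reg) := by
        rw [show v - i = v - (i + 1) + 1 by omega]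
      have u2 : φ₂.reg (d + 2) = v - (i + 1) := by
        rw [t4 (d + 2) (by simp [q3]), s4 (d + 2) (by omega)]
        simp [q1, p6]
      refine ⟨_, (s1.seq t1).seq (inc_does q2 ?_), by omega, ?_, t2, ?_, ?_, ?_, ?_⟩
      · simp only [q2, u2]
        refine lt_of_le_of_lt ?_ hlt
        refine le_trans ?_ (Nat.pow_le_pow_right (by omega)
          (Nat.le_mul_of_pos_right _ (by omega : 0 < max c₃ 1)))
        omega
      · simp only [RState.set_reg, q1, q2, u2]
        rw [Function.update_of_ne (by omega), t4 (d + 1) (by simp [q3]), s4 (d + 1) (by omega)]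
        simp [q1]
      · rw [RState.set_out, t3, s3, RState.set_out, p4]
      · intro r hr
        have h1 : r ≠ d + 1 := by omega
        simp only [RState.set_reg, q2]
        rw [Function.update_of_ne (by omega), t4 r (by simp [q3]; omega), s4 r (by omega)]
        simp [q1, h1, p5 r hr]
      · simp only [RState.set_reg, q2, u2, Function.update_self]
        omega
      · simp only [RState.set_reg, q2]
        rw [Function.update_of_ne (by omega), hrec, ← s5]
        exact t5) (σ := τ₃) (by
      refine ⟨le_rfl, ?_, k2, k3.trans j3, fun r hr => ?_, ?_, ?_⟩
      · simp only [q1]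
        rw [k4 _ (by omega), j4 _ (by omega), i5]
      · rw [k4 _ (by omega), j4 _ (by omega), i4 r (by omega)]
      · rw [k4 _ (by omega), j5, Nat.sub_self]
      · rw [Nat.sub_self]; exact k5)
  obtain ⟨-, -, p3, p4, p5, -, p7⟩ := l2
  obtain ⟨φ, t1, t2, t3, t4, t5⟩ := copy_puts (x := x) (S := S) (a := q3) (b := q0) (c := q4)
    (by simp [q3, q0]) (by simp [q0, q4]) (by simp [q3, q4]) p3
  refine ⟨φ, ((i1.seq j1).seq k1).seq (l1.seq t1), t2, t3.trans p4,
    fun r hr => (t4 r hr).trans (p5 r hr), ?_⟩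
  rw [Nat.sub_zero] at p7
  exact t5.trans p7

theorem LF.compiles {f} (hf : LF f) : Compiles f := by
  induction hf with
  | var i => exact Compiles.var i
  | zero => exact Compiles.zero
  | succ h ih => exact Compiles.succ h ih
  | len => exact Compiles.len
  | read _ ih => exact ih.read
  | comp _ h ih ih' => exact Compiles.comp h ih ih'
  | prec h _ _ hb ih₁ ih₂ ih₃ => exact Compiles.prec h ih₁ ih₂ ih₃ hb

/-- The machine computes the length of the output and then, for each position, computes and prints
one letter. Register `0` counts down, register `1` holds the position, and register `2` receives the
letter. The number of registers is fixed and their contents are polynomial in the input length, so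
they have `O(log n)` bits. -/
theorem logspaceComputable_of_LF {w : Word → Word} {l a : Word → List ℕ → ℕ} (hl : LF l)
    (ha : LF a) (hl' : ∀ x, l x [] = (w x).length)
    (ha' : ∀ x i, a x [i] = letterCode (w x)[i]?) : LogspaceComputable w := by
  obtain ⟨R₀, hR₀⟩ := hl.compiles [] 0 (by simp)
  obtain ⟨R₁, hR₁⟩ := ha.compiles [1] 2 (by simp)
  obtain ⟨b, hb⟩ := hl.bounded
  obtain ⟨F, c, hF⟩ := hR₀ (max (max R₀ R₁) 3) (by omega)
  obtain ⟨G, c', hG⟩ := hR₁ (max (max R₀ R₁) 3) (by omega)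
  let q0 : Fin (max (max R₀ R₁) 3) := ⟨0, by omega⟩
  let q1 : Fin (max (max R₀ R₁) 3) := ⟨1, by omega⟩
  let q2 : Fin (max (max R₀ R₁) 3) := ⟨2, by omega⟩
  let C := max c ((b + 1 + 1) * max c' 1)
  let H := (F.seq (clear q1)).seq (forReg q0 ((G.seq (Frag.print q2)).seq (inc q1)))
  refine ⟨H.machine, 2 * C + 2, fun x => ?_⟩
  -- Large enough for `(x.length + 2) ^ C < 2 ^ S`, and `S + 1` is at most `2 * C + 2` times
  -- `Nat.log 2 x.length + 1`.
  set S := C * (Nat.log 2 x.length + 2) + 1 with hS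
  have hN2 : 2 ≤ x.length + 2 := by omega
  have hlt : (x.length + 2) ^ C < 2 ^ S := by
    have h1 : x.length < 2 ^ (Nat.log 2 x.length + 1) := Nat.lt_pow_succ_log_self (by norm_num) _
    have h2 : x.length + 2 ≤ 2 ^ (Nat.log 2 x.length + 2) := by
      rw [pow_succ] at h1 ⊢
      have : 0 < 2 ^ (Nat.log 2 x.length) := by positivity
      rw [pow_succ]
      omega
    calc (x.length + 2) ^ C ≤ (2 ^ (Nat.log 2 x.length + 2)) ^ C := Nat.pow_le_pow_left h2 C
      _ = 2 ^ (C * (Nat.log 2 x.length + 2)) := by rw [← pow_mul, mul_comm]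
      _ < 2 ^ S := Nat.pow_lt_pow_right (by norm_num) (by omega)
  let m₀ : Mem (max (max R₀ R₁) 3) := ⟨0, fun _ _ => none, fun _ => 0, []⟩
  have hm₀ : Rep S m₀ ⟨0, fun _ => 0, []⟩ :=
    ⟨rfl, rfl, fun _ => rfl, fun i => ⟨[], by simp, rfl, by rw [tapeOf_nil]⟩⟩
  have hdoes : ∃ τ : RState, H.Does x S ⟨0, fun _ => 0, []⟩ () τ ∧ τ.out = w x := by
    obtain ⟨τ₁, i1, i2, i3, -, i5⟩ := hF x S ⟨0, fun _ => 0, []⟩ rfl (by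
      simpa using pow_lt_of_le hN2 hlt (by omega))
    rw [List.map_nil, hl'] at i5
    let P : ℕ → RState → Prop := fun k φ => k ≤ (w x).length ∧ φ.reg q0 = k ∧ φ.pos = 0 ∧
      φ.reg 1 = (w x).length - k ∧ φ.out = (w x).take ((w x).length - k)
    have hwb : x.length + (w x).length + 2 ≤ (x.length + 2) ^ (b + 1 + 1) := by
      have h1 := hb x []
      rw [hl', List.sum_nil, add_zero] at h1
      have h2 := pow_add_pow_le hN2 b 1
      rw [pow_one] at h2
      omega
    have hlt' : (x.length + 2) ^ ((b + 1 + 1) * max c' 1) < 2 ^ S :=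
      pow_lt_of_le hN2 hlt (by omega)
    obtain ⟨τ, l1, l2⟩ := forReg_of_invariant (x := x) (S := S) (r := q0)
      (F := (G.seq (Frag.print q2)).seq (inc q1)) (P := P) (n := (w x).length)
      (fun i φ h => h.2.1) (by
        rintro i hi φ ⟨p1, p2, p3, p4, p5⟩
        have e : [1].map (φ.set q0 i).reg = [(w x).length - (i + 1)] := by
          simp [q0, p4]
        obtain ⟨φ₁, s1, s2, s3, s4, s5⟩ := hG x S (φ.set q0 i) p3 (by
          rw [e]
          refine lt_of_le_of_lt ?_ hlt'
          rw [pow_mul]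
          refine (Nat.pow_le_pow_right (by omega) (le_max_left c' 1)).trans
            (Nat.pow_le_pow_left ?_ _)
          simp only [List.sum_singleton]
          omega)
        rw [e, ha'] at s5
        obtain ⟨φ₂, t1, t2, t3, t4⟩ := print_does (x := x) (S := S) q2 φ₁ s5
        have u1 : φ₂.reg 1 = (w x).length - (i + 1) := by
          rw [t2 1 (by simp [q2]), s4 1 (by omega)]
          simp [q0, p4]
        refine ⟨_, (s1.seq t1).seq (inc_does q1 ?_), by omega, ?_, t3.trans s2, ?_, ?_⟩
        · simp only [q1, u1]
          refine lt_of_le_of_lt ?_ hlt'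
          refine le_trans ?_ (Nat.pow_le_pow_right (by omega)
            (Nat.le_mul_of_pos_right _ (by omega : 0 < max c' 1)))
          omega
        · simp only [RState.set_reg, q0, q1, u1]
          rw [Function.update_of_ne (by omega), t2 0 (by simp [q2]), s4 0 (by omega)]
          simp [q0]
        · simp only [RState.set_reg, q1, u1, Function.update_self]
          omega
        · rw [RState.set_out, t4, s3, RState.set_out, p5,
            show (w x).length - i = (w x).length - (i + 1) + 1 by omega, List.take_add_one]) (σ := τ₁.set q1 0) (by
        refine ⟨le_rfl, ?_, i2, ?_, ?_⟩
        · simp [q0, q1, i5]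
        · simp [q1]
        · simp [i3])
    refine ⟨τ, (i1.seq (clear_does q1 τ₁)).seq l1, ?_⟩
    rw [l2.2.2.2.2, Nat.sub_zero, List.take_length]
  obtain ⟨τ, h1, h2⟩ := hdoes
  obtain ⟨m', h3, h4⟩ := h1 m₀ hm₀
  obtain ⟨h5, h6⟩ := h3.machine h4.inSpace
  refine ⟨⟨_, h5, rfl, ?_⟩, fun d hd i => (h6 d hd i).trans ?_⟩
  · rw [← h2]; exact h4.out
  · rw [hS]
    nlinarith [Nat.zero_le (C * Nat.log 2 x.length), Nat.zero_le (Nat.log 2 x.length)]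

end Logspace

/-! ### Closure properties of logspace functions, predicates and word generators. -/

namespace Logspace

open Finset
open Frag (letterCode)

/-! ## Contexts -/

/-- Types of tuples consisting of a word and a fixed number of natural numbers. -/
class Ctx (γ : Type) where
  ofArgs : Word → List ℕ → γ
  word : γ → Word
  arity : ℕ
  word_ofArgs : ∀ x e, word (ofArgs x e) = x
  ofArgs_map : ∀ x e, ofArgs x ((List.range arity).map fun i => e.getD i 0) = ofArgs x e

instance : Ctx Word where
  ofArgs x _ := x
  word x := x
  arity := 0
  word_ofArgs _ _ := rfl
  ofArgs_map _ _ := rfl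

instance {γ : Type} [Ctx γ] : Ctx (γ × ℕ) where
  ofArgs x e := (Ctx.ofArgs x e.tail, e.getD 0 0)
  word p := Ctx.word p.1
  arity := Ctx.arity γ + 1
  word_ofArgs _ _ := Ctx.word_ofArgs _ _
  ofArgs_map x e := by
    have : ∀ i, e.getD (i + 1) 0 = e.tail.getD i 0 := by cases e <;> simp
    have h := Ctx.ofArgs_map (γ := γ) x e.tail
    simp only [List.range_succ_eq_map, List.map_cons, List.map_map, Function.comp_def, this,
      List.tail_cons, h, Nat.succ_eq_add_one, List.getD_cons_zero]

variable {γ δ : Type} [Ctx γ] [Ctx δ]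

/-- Number-valued functions computable in logarithmic space. -/
def LogFn (f : γ → ℕ) : Prop := LF fun x e => f (Ctx.ofArgs x e)

/-- Maps between contexts that keep the word and whose numbers are logspace functions. -/
def LogMap (h : γ → δ) : Prop :=
  ∃ gs : List (Word → List ℕ → ℕ), (∀ g ∈ gs, LF g) ∧
    ∀ x e, h (Ctx.ofArgs x e) = Ctx.ofArgs x (gs.map fun g => g x e)

def PolyBdd (f : γ → ℕ) : Prop :=
  ∃ k : ℕ, ∀ x e, f (Ctx.ofArgs x e) ≤ (x.length + e.sum + 2) ^ k

theorem LogFn.polyBdd {f : γ → ℕ} (hf : LogFn f) : PolyBdd f := hf.bounded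

theorem PolyBdd.add {f g : γ → ℕ} (hf : PolyBdd f) (hg : PolyBdd g) :
    PolyBdd fun c => f c + g c := by
  obtain ⟨k, hk⟩ := hf
  obtain ⟨l, hl⟩ := hg
  exact ⟨k + l + 1, fun x e => (add_le_add (hk x e) (hl x e)).trans (pow_add_pow_le (by omega) k l)⟩

theorem PolyBdd.sum {n : γ → ℕ} {f : γ → ℕ → ℕ} (hn : PolyBdd n)
    (hf : PolyBdd fun p : γ × ℕ => f p.1 p.2) : PolyBdd fun c => ∑ i ∈ range (n c), f c i := by
  obtain ⟨k, hk⟩ := hn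
  obtain ⟨l, hl⟩ := hf
  refine ⟨k + (k + 1 + 1) * l, fun x e => ?_⟩
  have h1 : ∀ i ∈ range (n (Ctx.ofArgs x e)), f (Ctx.ofArgs x e) i ≤
      (x.length + e.sum + 2) ^ ((k + 1 + 1) * l) := by
    intro i hi
    rw [mem_range] at hi
    refine (hl x (i :: e)).trans ?_
    rw [pow_mul]
    refine Nat.pow_le_pow_left (le_trans ?_ (pow_add_pow_le (by omega) k 1)) l
    have := hk x e
    rw [pow_one, List.sum_cons]
    omega
  refine (Finset.sum_le_card_nsmul _ _ _ h1).trans ?_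
  rw [card_range, smul_eq_mul, pow_add]
  exact Nat.mul_le_mul_right _ (hk x e)

theorem LogFn.comp {f : δ → ℕ} {h : γ → δ} (hf : LogFn f) (hh : LogMap h) :
    LogFn fun c => f (h c) := by
  obtain ⟨gs, h1, h2⟩ := hh
  have := LF.comp hf h1
  simpa only [LogFn, h2] using this

theorem LogMap.pair {h : γ → δ} {f : γ → ℕ} (hh : LogMap h) (hf : LogFn f) :
    LogMap fun c => (h c, f c) := by
  obtain ⟨gs, h1, h2⟩ := hh
  refine ⟨(fun x e => f (Ctx.ofArgs x e)) :: gs, ?_, fun x e => ?_⟩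
  · rintro g (_ | ⟨_, hg⟩)
    exacts [hf, h1 g hg]
  · beta_reduce; rw [h2]; rfl

theorem LogMap.fst : LogMap fun p : γ × ℕ => p.1 := by
  refine ⟨(List.range (Ctx.arity γ)).map fun i _ e => e.getD (i + 1) 0, ?_, fun x e => ?_⟩
  · simp only [List.mem_map]
    rintro g ⟨i, -, rfl⟩
    exact LF.var (i + 1)
  · have : ∀ i, e.getD (i + 1) 0 = e.tail.getD i 0 := by cases e <;> simp
    simp only [List.map_map, Function.comp_def, this]
    rw [Ctx.ofArgs_map]
    rfl

theorem LogMap.comp {ε : Type} [Ctx ε] {h' : δ → ε} {h : γ → δ} (hh' : LogMap h')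
    (hh : LogMap h) : LogMap fun c => h' (h c) := by
  obtain ⟨gs, h1, h2⟩ := hh
  obtain ⟨gs', h3, h4⟩ := hh'
  refine ⟨gs'.map fun g x e => g x (gs.map fun g => g x e), ?_, fun x e => ?_⟩
  · simp only [List.mem_map]
    rintro g ⟨g', hg', rfl⟩
    exact LF.comp (h3 g' hg') h1
  · beta_reduce
    rw [h2, h4, List.map_map]
    rfl

theorem LogMap.word : LogMap fun c : γ => Ctx.word c :=
  ⟨[], by simp, fun x e => Ctx.word_ofArgs x e⟩

namespace LogFn

/-- The projections `v0`, `v1`, … act as de Bruijn indices: `v0` is the number bound last. -/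
theorem v0 : LogFn fun p : γ × ℕ => p.2 := LF.var 0

theorem weak {f : γ → ℕ} (hf : LogFn f) : LogFn fun p : γ × ℕ => f p.1 := hf.comp LogMap.fst

theorem v1 : LogFn fun p : (γ × ℕ) × ℕ => p.1.2 := v0.weak

theorem v2 : LogFn fun p : ((γ × ℕ) × ℕ) × ℕ => p.1.1.2 := v1.weak

theorem v3 : LogFn fun p : (((γ × ℕ) × ℕ) × ℕ) × ℕ => p.1.1.1.2 := v2.weak

theorem of_word₀ {f : Word → ℕ} (hf : LogFn f) : LogFn fun c : γ => f (Ctx.word c) :=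
  hf.comp LogMap.word

theorem of_word₁ {f : Word → ℕ → ℕ} (hf : LogFn fun p : Word × ℕ => f p.1 p.2) {a : γ → ℕ}
    (ha : LogFn a) : LogFn fun c : γ => f (Ctx.word c) (a c) :=
  hf.comp (LogMap.word.pair ha)

theorem const (n : ℕ) : LogFn fun _ : γ => n := by
  induction n with
  | zero => exact LF.zero
  | succ n ih => exact LF.succ ih

theorem succ {f : γ → ℕ} (hf : LogFn f) : LogFn fun c => f c + 1 := LF.succ hf

theorem length : LogFn fun c : γ => (Ctx.word c).length := by
  have : LogFn fun x : Word => x.length := LF.len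
  exact this.of_word₀

theorem letter {f : γ → ℕ} (hf : LogFn f) : LogFn fun c : γ => letterCode (Ctx.word c)[f c]? := by
  have : LogFn fun p : Word × ℕ => letterCode p.1[p.2]? := LF.read (LF.var 0)
  exact of_word₁ (f := fun x i => letterCode x[i]?) this hf

theorem natrec {n f b : γ → ℕ} {g : γ → ℕ → ℕ → ℕ} (hn : LogFn n) (hf : LogFn f)
    (hg : LogFn fun p : (γ × ℕ) × ℕ => g p.1.1 p.1.2 p.2) (hb : PolyBdd b)
    (h : ∀ c, ∀ i ≤ n c, Nat.rec (f c) (fun i a => g c i a) i ≤ b c) :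
    LogFn fun c => Nat.rec (motive := fun _ => ℕ) (f c) (fun i a => g c i a) (n c) := by
  obtain ⟨k, hk⟩ := hb
  exact LF.prec hn hf hg ⟨k, fun x e i hi => (h _ i hi).trans (hk x e)⟩

theorem add {f g : γ → ℕ} (hf : LogFn f) (hg : LogFn g) : LogFn fun c => f c + g c := by
  have e : ∀ c n, Nat.rec (motive := fun _ => ℕ) (f c) (fun _ a => a + 1) n = f c + n := by
    intro c n
    induction n with
    | zero => rfl
    | succ n ih => exact congrArg (· + 1) ih
  have := natrec (g := fun _ _ a => a + 1) hg hf v0.succ (hf.polyBdd.add hg.polyBdd)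
    (by intro c i hi; rw [e]; omega)
  simpa only [e] using this

theorem sum {n : γ → ℕ} {f : γ → ℕ → ℕ} (hn : LogFn n) (hf : LogFn fun p : γ × ℕ => f p.1 p.2) :
    LogFn fun c => ∑ i ∈ range (n c), f c i := by
  have e : ∀ c n, Nat.rec (motive := fun _ => ℕ) 0 (fun i a => a + f c i) n =
      ∑ i ∈ range n, f c i := by
    intro c n
    induction n with
    | zero => rfl
    | succ n ih => rw [sum_range_succ, ← ih]
  have := natrec (g := fun c i a => a + f c i) hn (const 0) (v0.add hf.weak)
    (hn.polyBdd.sum hf.polyBdd) (by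
      intro c i hi
      rw [e]
      exact sum_le_sum_of_subset (range_subset_range.2 hi))
  simpa only [e] using this

theorem mul {f g : γ → ℕ} (hf : LogFn f) (hg : LogFn g) : LogFn fun c => f c * g c := by
  simpa using sum (f := fun c _ => g c) hf hg.weak

theorem pred {f : γ → ℕ} (hf : LogFn f) : LogFn fun c => f c - 1 := by
  have e : ∀ n, Nat.rec (motive := fun _ => ℕ) 0 (fun i _ => i) n = n - 1 := by
    intro n; cases n <;> rfl
  have := natrec (f := fun _ => 0) (g := fun _ i _ => i) hf (const 0) v1 hf.polyBdd
    (by intro c i hi; rw [e]; omega)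
  simpa only [e] using this

theorem sub {f g : γ → ℕ} (hf : LogFn f) (hg : LogFn g) : LogFn fun c => f c - g c := by
  have e : ∀ c n, Nat.rec (motive := fun _ => ℕ) (f c) (fun _ a => a - 1) n = f c - n := by
    intro c n
    induction n with
    | zero => rfl
    | succ n ih => rw [Nat.sub_succ, ← ih]; rfl
  have := natrec (g := fun _ _ a => a - 1) hg hf v0.pred hf.polyBdd
    (by intro c i hi; rw [e]; omega)
  simpa only [e] using this

end LogFn

/-- Predicates decidable in logarithmic space. -/
def LogPred (P : γ → Prop) : Prop := ∃ f : γ → ℕ, LogFn f ∧ ∀ c, P c ↔ f c ≠ 0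

/-- A case distinction is a recursion along the number that decides `P`: the start value is taken at
`0`, and a step that ignores the accumulator gives the other value at every positive number. -/
theorem LogFn.ite {P : γ → Prop} [∀ c, Decidable (P c)] {f g : γ → ℕ} (hP : LogPred P)
    (hf : LogFn f) (hg : LogFn g) : LogFn fun c => if P c then f c else g c := by
  obtain ⟨p, hp, h⟩ := hP
  have e : ∀ c n, Nat.rec (motive := fun _ => ℕ) (g c) (fun _ _ => f c) n =
      if n = 0 then g c else f c := by
    intro c n; cases n <;> rfl
  have := natrec (g := fun c _ _ => f c) hp hg hf.weak.weak (hf.polyBdd.add hg.polyBdd)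
    (by intro c i hi; rw [e]; split_ifs <;> omega)
  simpa only [e, h, ne_eq, ite_not] using this

namespace LogPred

theorem congr {P Q : γ → Prop} (hP : LogPred P) (h : ∀ c, Q c ↔ P c) : LogPred Q := by
  obtain ⟨p, hp, h'⟩ := hP
  exact ⟨p, hp, fun c => (h c).trans (h' c)⟩

theorem weak {P : γ → Prop} (hP : LogPred P) : LogPred fun p : γ × ℕ => P p.1 := by
  obtain ⟨p, hp, h⟩ := hP
  exact ⟨_, hp.weak, fun c => h c.1⟩

theorem le {f g : γ → ℕ} (hf : LogFn f) (hg : LogFn g) : LogPred fun c => f c ≤ g c :=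
  ⟨_, hg.succ.sub hf, fun c => by omega⟩

theorem lt {f g : γ → ℕ} (hf : LogFn f) (hg : LogFn g) : LogPred fun c => f c < g c :=
  ⟨_, hg.sub hf, fun c => by omega⟩

theorem and {P Q : γ → Prop} (hP : LogPred P) (hQ : LogPred Q) : LogPred fun c => P c ∧ Q c := by
  obtain ⟨p, hp, h⟩ := hP
  obtain ⟨q, hq, h'⟩ := hQ
  exact ⟨_, hp.mul hq, fun c => by beta_reduce; rw [h, h', mul_ne_zero_iff]⟩

theorem or {P Q : γ → Prop} (hP : LogPred P) (hQ : LogPred Q) : LogPred fun c => P c ∨ Q c := by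
  obtain ⟨p, hp, h⟩ := hP
  obtain ⟨q, hq, h'⟩ := hQ
  exact ⟨_, hp.add hq, fun c => by beta_reduce; rw [h, h']; omega⟩

theorem not {P : γ → Prop} (hP : LogPred P) : LogPred fun c => ¬ P c := by
  obtain ⟨p, hp, h⟩ := hP
  exact ⟨_, (LogFn.const 1).sub hp, fun c => by beta_reduce; rw [h]; omega⟩

theorem imp {P Q : γ → Prop} (hP : LogPred P) (hQ : LogPred Q) : LogPred fun c => P c → Q c :=
  (hP.not.or hQ).congr fun _ => imp_iff_not_or

theorem eq {f g : γ → ℕ} (hf : LogFn f) (hg : LogFn g) : LogPred fun c => f c = g c :=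
  ((le hf hg).and (le hg hf)).congr fun _ => le_antisymm_iff

theorem ne {f g : γ → ℕ} (hf : LogFn f) (hg : LogFn g) : LogPred fun c => f c ≠ g c :=
  (eq hf hg).not

theorem ex {n : γ → ℕ} {P : γ → ℕ → Prop} (hn : LogFn n)
    (hP : LogPred fun p : γ × ℕ => P p.1 p.2) : LogPred fun c => ∃ i < n c, P c i := by
  obtain ⟨p, hp, h⟩ := hP
  refine ⟨fun c => ∑ i ∈ range (n c), p (c, i), LogFn.sum (f := fun c i => p (c, i)) hn hp,
    fun c => ?_⟩
  simp only [ne_eq, sum_eq_zero_iff, mem_range, not_forall, exists_prop]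
  exact exists_congr fun i => and_congr_right fun _ => h (c, i)

theorem all {n : γ → ℕ} {P : γ → ℕ → Prop} (hn : LogFn n)
    (hP : LogPred fun p : γ × ℕ => P p.1 p.2) : LogPred fun c => ∀ i < n c, P c i :=
  (ex (P := fun c i => ¬ P c i) hn hP.not).not.congr fun c => by push Not; rfl

end LogPred

theorem LogFn.count {n : γ → ℕ} {P : γ → ℕ → Prop} [∀ c, DecidablePred (P c)] (hn : LogFn n)
    (hP : LogPred fun p : γ × ℕ => P p.1 p.2) :
    LogFn fun c => ((range (n c)).filter (P c)).card := by
  simp only [card_filter]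
  exact sum hn (LogFn.ite hP (const 1) (const 0))

namespace LogFn

theorem min {f g : γ → ℕ} (hf : LogFn f) (hg : LogFn g) : LogFn fun c => Min.min (f c) (g c) := by
  simp only [min_def]
  exact ite (LogPred.le hf hg) hf hg

/-- Division is replaced by counting the `i` with `2 * i + 2 ≤ f c`. -/
theorem half {f : γ → ℕ} (hf : LogFn f) : LogFn fun c => f c / 2 := by
  have := count (P := fun c i => 2 * i + 2 ≤ f c) hf
    (LogPred.le (((const 2).mul v0).add (const 2)) hf.weak)
  have e : ∀ n, ((range n).filter fun i => 2 * i + 2 ≤ n).card = n / 2 := by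
    intro n
    have : (range n).filter (fun i => 2 * i + 2 ≤ n) = range (n / 2) := by
      ext i; simp only [mem_filter, mem_range]; omega
    rw [this, card_range]
  simpa only [e] using this

theorem mod_two {f : γ → ℕ} (hf : LogFn f) : LogFn fun c => f c % 2 := by
  have := hf.sub ((const 2).mul hf.half)
  refine (congrArg LogFn (funext fun c => ?_)).mp this
  have := Nat.div_add_mod (f c) 2
  omega

/-- The power `2 ^ g c` need not be polynomially bounded, so it is never computed; iterated halving
keeps all values below `f c`. -/
theorem shiftRight {f g : γ → ℕ} (hf : LogFn f) (hg : LogFn g) :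
    LogFn fun c => f c / 2 ^ g c := by
  have e : ∀ c n, Nat.rec (motive := fun _ => ℕ) (f c) (fun _ a => a / 2) n = f c / 2 ^ n := by
    intro c n
    induction n with
    | zero => simp
    | succ n ih => rw [pow_succ, ← Nat.div_div_eq_div_mul, ← ih]
  have := natrec (g := fun _ _ a => a / 2) hg hf v0.half hf.polyBdd
    (by intro c i _; rw [e]; exact Nat.div_le_self _ _)
  simpa only [e] using this

end LogFn

/-! ## Logspace generation of words -/

/-- Word-valued functions computable in logarithmic space. -/
def LogGen (w : γ → Word) : Prop :=
  LogFn (fun c => (w c).length) ∧ LogFn fun p : γ × ℕ => letterCode (w p.1)[p.2]?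

namespace LogGen

theorem nil : LogGen fun _ : γ => [] := ⟨LogFn.const 0, LogFn.const 0⟩

theorem single (a : Letter) : LogGen fun _ : γ => [a] := by
  refine ⟨LogFn.const 1, ?_⟩
  have := LogFn.ite (LogPred.eq (LogFn.v0 (γ := γ)) (LogFn.const 0))
    (LogFn.const (letterCode (some a))) (LogFn.const 0)
  refine (congrArg LogFn (funext fun p => ?_)).mp this
  dsimp only
  rcases p with ⟨c, _ | i⟩ <;> rfl

theorem ite {P : γ → Prop} [∀ c, Decidable (P c)] {v w : γ → Word} (hP : LogPred P)
    (hv : LogGen v) (hw : LogGen w) : LogGen fun c => if P c then v c else w c := by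
  constructor
  · refine (congrArg LogFn (funext fun c => ?_)).mp (LogFn.ite hP hv.1 hw.1)
    beta_reduce
    split_ifs <;> rfl
  · refine (congrArg LogFn (funext fun c => ?_)).mp
      (LogFn.ite (P := fun p : γ × ℕ => P p.1) hP.weak hv.2 hw.2)
    dsimp only
    split_ifs <;> rfl

/-- Since `0` is the code of a missing letter, concatenation turns into addition of codes. The
condition keeps the truncated difference from pointing at the beginning of `w` too early. -/
theorem letterCode_append (v w : Word) (i : ℕ) : letterCode (v ++ w)[i]? =
    letterCode v[i]? + if v.length ≤ i then letterCode w[i - v.length]? else 0 := by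
  split_ifs with h
  · rw [List.getElem?_append_right h, List.getElem?_eq_none h]
    simp [letterCode]
  · rw [List.getElem?_append_left (not_le.1 h), add_zero]

theorem append {v w : γ → Word} (hv : LogGen v) (hw : LogGen w) : LogGen fun c => v c ++ w c := by
  constructor
  · simpa only [List.length_append] using hv.1.add hw.1
  · simp only [letterCode_append]
    refine hv.2.add (LogFn.ite (LogPred.le hv.1.weak LogFn.v0) ?_ (LogFn.const 0))
    exact LogFn.comp (h := fun p : γ × ℕ => (p.1, p.2 - (v p.1).length)) hw.2
      (LogMap.fst.pair (LogFn.v0.sub hv.1.weak))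

/-- The code at position `i` is the sum over all blocks `j` of the code at `i` minus the total
length of the blocks before `j`. Only the block that contains `i` contributes, because codes beyond
the end of a block are `0`. -/
theorem flatMap {n : γ → ℕ} {w : γ → ℕ → Word} (hn : LogFn n)
    (hw : LogGen fun p : γ × ℕ => w p.1 p.2) :
    LogGen fun c => (List.range (n c)).flatMap (w c) := by
  have e : ∀ c n, ((List.range n).flatMap (w c)).length = ∑ j ∈ range n, (w c j).length := by
    intro c n
    induction n with
    | zero => rfl
    | succ n ih => rw [List.range_succ, List.flatMap_append, List.length_append, ih,
        sum_range_succ]; simp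
  have e' : ∀ c n i, letterCode ((List.range n).flatMap (w c))[i]? = ∑ j ∈ range n,
      if ∑ j' ∈ range j, (w c j').length ≤ i then
        letterCode (w c j)[i - ∑ j' ∈ range j, (w c j').length]? else 0 := by
    intro c n i
    induction n with
    | zero => rfl
    | succ n ih => rw [List.range_succ, List.flatMap_append, letterCode_append, ih, e,
        sum_range_succ]; simp
  constructor
  · simp only [e]
    exact LogFn.sum hn hw.1
  · simp only [e']
    refine LogFn.sum hn.weak ?_
    have hpre : LogFn fun p : (γ × ℕ) × ℕ => ∑ j' ∈ range p.2, (w p.1.1 j').length := by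
      refine LogFn.sum LogFn.v0 ?_
      exact LogFn.comp (h := fun p : ((γ × ℕ) × ℕ) × ℕ => (p.1.1.1, p.2)) hw.1
        ((LogMap.fst.comp (LogMap.fst.comp LogMap.fst)).pair LogFn.v0)
    refine LogFn.ite (LogPred.le hpre LogFn.v1) ?_ (LogFn.const 0)
    exact LogFn.comp (h := fun p : (γ × ℕ) × ℕ => ((p.1.1, p.2),
      p.1.2 - ∑ j' ∈ range p.2, (w p.1.1 j').length)) hw.2
      (((LogMap.fst.comp LogMap.fst).pair LogFn.v0).pair (LogFn.v1.sub hpre))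

theorem logspaceComputable {w : Word → Word} (hw : LogGen w) : LogspaceComputable w :=
  logspaceComputable_of_LF hw.1 hw.2 (fun _ => rfl) fun _ _ => rfl

theorem comp {v w : Word → Word} (hv : LogGen v) (hw : LogGen w) : LogGen fun x => v (w x) := by
  constructor
  · exact LF.subst hw.1 hw.2 (fun _ => rfl) (fun _ _ => rfl) hv.1
  · exact LF.subst hw.1 hw.2 (fun _ => rfl) (fun _ _ => rfl) hv.2

end LogGen

/-- Reducibility by functions that generate their values in logarithmic space. -/
def GenReduces (A B : Language Letter) : Prop :=
  ∃ w : Word → Word, LogGen w ∧ ∀ x, x ∈ A ↔ w x ∈ B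

theorem GenReduces.logspaceReduces {A B : Language Letter} (h : GenReduces A B) :
    LogspaceReduces A B := by
  obtain ⟨w, hw, h⟩ := h
  exact ⟨w, hw.logspaceComputable, h⟩

theorem GenReduces.trans {A B C : Language Letter} (h : GenReduces A B) (h' : GenReduces B C) :
    GenReduces A C := by
  obtain ⟨w, hw, h⟩ := h
  obtain ⟨v, hv, h'⟩ := h'
  exact ⟨_, hv.comp hw, fun x => (h x).trans (h' _)⟩

end Logspace

/-! ### Tables of numbers as words. -/

namespace Logspace

open Finset
open Frag (letterCode bitsVal)
open Computability (encodeNat)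

variable {γ : Type} [Ctx γ]

/-! ## Generating tables -/

theorem encodeNat_zero : encodeNat 0 = [] := rfl

theorem encodeNat_eq_cons {a : ℕ} (ha : a ≠ 0) :
    encodeNat a = decide (a % 2 = 1) :: encodeNat (a / 2) := by
  have h := Num.ofNat'_bit (a.bodd) (a / 2)
  have e : Nat.bit a.bodd (a / 2) = a := by
    rw [← Nat.div2_val]; exact Nat.bit_bodd_div2 a
  rw [e, Num.ofNat'_eq, Num.ofNat'_eq] at h
  unfold encodeNat
  rw [h]
  have hm : a % 2 = a.bodd.toNat := Nat.mod_two_of_bodd a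
  rcases hb : a.bodd with _ | _
  · have h2 : a % 2 = 0 := by rw [hm, hb]; rfl
    have h0 : a / 2 ≠ 0 := by omega
    have h0' : ((a / 2 : ℕ) : Num) ≠ 0 := by
      intro h; apply h0; have := congrArg (fun n : Num => (n : ℕ)) h; simpa using this
    rcases hn : ((a / 2 : ℕ) : Num) with _ | p
    · exact absurd hn h0'
    · simp [h2, Computability.encodeNum, Num.bit0, Computability.encodePosNum]
  · have h2 : a % 2 = 1 := by rw [hm, hb]; rfl
    rcases hn : ((a / 2 : ℕ) : Num) with _ | p
    · simp [h2, Computability.encodeNum, Num.bit1, Computability.encodePosNum]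
    · simp [h2, Computability.encodeNum, Num.bit1, Computability.encodePosNum]

theorem bitsVal_encodeNat (a : ℕ) : bitsVal (encodeNat a) = a := by
  induction a using Nat.strong_induction_on with
  | _ a ih =>
    by_cases ha : a = 0
    · subst ha; rfl
    · rw [encodeNat_eq_cons ha, Frag.bitsVal_cons, ih _ (by omega)]
      rcases Nat.mod_two_eq_zero_or_one a with h | h <;> simp [h] <;> omega

/-- Bits beyond the highest one contribute nothing, so any `n ≥ a` may serve as a bound on their
number. This crude bound is still polynomial and avoids a logarithm. -/
theorem encodeNat_eq_flatMap (a n : ℕ) (h : a ≤ n) :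
    (encodeNat a).map Letter.bit = (List.range n).flatMap fun i =>
      if a / 2 ^ i = 0 then [] else if a / 2 ^ i % 2 = 1 then [Letter.bit true] else [.bit false] := by
  induction n generalizing a with
  | zero =>
    obtain rfl : a = 0 := by omega
    rfl
  | succ n ih =>
    rw [List.range_succ_eq_map, List.flatMap_cons, List.flatMap_map]
    by_cases ha : a = 0
    · subst ha
      simp [encodeNat_zero]
    · rw [encodeNat_eq_cons ha, List.map_cons, ih (a / 2) (by omega)]
      have e : ∀ i, a / 2 ^ i.succ = a / 2 / 2 ^ i := fun i => by
        rw [Nat.div_div_eq_div_mul, pow_succ, mul_comm]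
      simp only [e, pow_zero, Nat.div_one, ha, if_false]
      rcases Nat.mod_two_eq_zero_or_one a with h | h <;> simp [h]

theorem LogGen.encodeNat {f : γ → ℕ} (hf : LogFn f) :
    LogGen fun c => (encodeNat (f c)).map Letter.bit := by
  simp only [fun c => encodeNat_eq_flatMap (f c) (f c) le_rfl]
  have h := hf.weak.shiftRight LogFn.v0
  exact LogGen.flatMap hf (LogGen.ite (LogPred.eq h (LogFn.const 0)) LogGen.nil
    (LogGen.ite (LogPred.eq h.mod_two (LogFn.const 1)) (LogGen.single _) (LogGen.single _)))

def encodeRow (r : List ℕ) : Word :=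
  r.flatMap fun a => (Computability.encodeNat a).map Letter.bit ++ [Letter.comma]

theorem encodeTable_eq (T : List (List ℕ)) :
    encodeTable T = T.flatMap fun r => encodeRow r ++ [Letter.semicolon] := rfl

/-- Lists of numbers that can be generated in logarithmic space. -/
def LogRow (r : γ → List ℕ) : Prop := LogGen fun c => encodeRow (r c)

/-- Tables that can be generated in logarithmic space. -/
def LogTab (T : γ → List (List ℕ)) : Prop := LogGen fun c => encodeTable (T c)

namespace LogRow

theorem nil : LogRow fun _ : γ => [] := LogGen.nil

theorem single {f : γ → ℕ} (hf : LogFn f) : LogRow fun c => [f c] := by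
  simpa [LogRow, encodeRow] using hf |> LogGen.encodeNat |>.append (LogGen.single .comma)

theorem append {r s : γ → List ℕ} (hr : LogRow r) (hs : LogRow s) :
    LogRow fun c => r c ++ s c := by
  simpa [LogRow, encodeRow] using LogGen.append hr hs

theorem cons {f : γ → ℕ} {r : γ → List ℕ} (hf : LogFn f) (hr : LogRow r) :
    LogRow fun c => f c :: r c := (single hf).append hr

theorem flatMap {n : γ → ℕ} {r : γ → ℕ → List ℕ} (hn : LogFn n)
    (hr : LogRow fun p : γ × ℕ => r p.1 p.2) :
    LogRow fun c => (List.range (n c)).flatMap fun i => r c i := by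
  simpa [LogRow, encodeRow, List.flatMap_assoc] using
    LogGen.flatMap (w := fun c i => encodeRow (r c i)) hn hr

theorem map {n : γ → ℕ} {f : γ → ℕ → ℕ} (hn : LogFn n) (hf : LogFn fun p : γ × ℕ => f p.1 p.2) :
    LogRow fun c => (List.range (n c)).map fun i => f c i := by
  simpa only [List.map_eq_flatMap] using flatMap hn (single hf)

end LogRow

namespace LogTab

theorem nil : LogTab fun _ : γ => [] := LogGen.nil

theorem single {r : γ → List ℕ} (hr : LogRow r) : LogTab fun c => [r c] := by
  simpa [LogTab, encodeTable_eq] using LogGen.append hr (LogGen.single .semicolon)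

theorem append {r s : γ → List (List ℕ)} (hr : LogTab r) (hs : LogTab s) :
    LogTab fun c => r c ++ s c := by
  simpa [LogTab, encodeTable_eq] using LogGen.append hr hs

theorem cons {f : γ → List ℕ} {r : γ → List (List ℕ)} (hf : LogRow f) (hr : LogTab r) :
    LogTab fun c => f c :: r c := (single hf).append hr

theorem ite {P : γ → Prop} [∀ c, Decidable (P c)] {r s : γ → List (List ℕ)} (hP : LogPred P)
    (hr : LogTab r) (hs : LogTab s) : LogTab fun c => if P c then r c else s c := by
  have := LogGen.ite hP hr hs
  refine (congrArg LogGen (funext fun c => ?_)).mp this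
  beta_reduce
  split_ifs <;> rfl

theorem flatMap {n : γ → ℕ} {r : γ → ℕ → List (List ℕ)} (hn : LogFn n)
    (hr : LogTab fun p : γ × ℕ => r p.1 p.2) :
    LogTab fun c => (List.range (n c)).flatMap fun i => r c i := by
  simpa [LogTab, encodeTable_eq, List.flatMap_assoc] using
    LogGen.flatMap (w := fun c i => encodeTable (r c i)) hn hr

theorem map {n : γ → ℕ} {f : γ → ℕ → List ℕ} (hn : LogFn n)
    (hf : LogRow fun p : γ × ℕ => f p.1 p.2) :
    LogTab fun c => (List.range (n c)).map fun i => f c i := by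
  simpa only [List.map_eq_flatMap] using flatMap hn (single hf)

end LogTab

/-! ## Reading tables -/

def letterAt (x : Word) (q : ℕ) : ℕ := letterCode x[q]?

theorem LogFn.letterAt {f : γ → ℕ} (hf : LogFn f) :
    LogFn fun c : γ => letterAt (Ctx.word c) (f c) := hf.letter

/-- The number of the row to which a position belongs. -/
def rowOf (x : Word) (q : ℕ) : ℕ := ((range q).filter fun i => letterAt x i = 4).card

/-- The number of the column to which a position belongs. -/
def colOf (x : Word) : ℕ → ℕ
  | 0 => 0
  | q + 1 => if letterAt x q = 4 then 0 else if letterAt x q = 3 then colOf x q + 1 else colOf x q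

theorem colOf_le (x : Word) (q : ℕ) : colOf x q ≤ q := by
  induction q with
  | zero => rfl
  | succ q ih => simp only [colOf]; split_ifs <;> omega

theorem LogFn.rowOf {f : γ → ℕ} (hf : LogFn f) : LogFn fun c : γ => rowOf (Ctx.word c) (f c) :=
  LogFn.count hf (LogPred.eq LogFn.v0.letterAt (LogFn.const 4))

theorem LogFn.colOf {f : γ → ℕ} (hf : LogFn f) : LogFn fun c : γ => colOf (Ctx.word c) (f c) := by
  have e : ∀ x n, Nat.rec (motive := fun _ => ℕ) 0 (fun i a => if Logspace.letterAt x i = 4 then 0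
      else if Logspace.letterAt x i = 3 then a + 1 else a) n = Logspace.colOf x n := by
    intro x n
    induction n with
    | zero => rfl
    | succ n ih => simp only [Logspace.colOf, ← ih]
  have := LogFn.natrec (f := fun _ => 0) (g := fun c i a => if Logspace.letterAt (Ctx.word c) i = 4
    then 0 else if Logspace.letterAt (Ctx.word c) i = 3 then a + 1 else a) hf (LogFn.const 0)
    (LogFn.ite (LogPred.eq LogFn.v1.letterAt (LogFn.const 4)) (LogFn.const 0)
      (LogFn.ite (LogPred.eq LogFn.v1.letterAt (LogFn.const 3)) LogFn.v0.succ LogFn.v0))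
    hf.polyBdd (by intro c i hi; rw [e]; exact (colOf_le _ _).trans hi)
  simpa only [e] using this

def numRows (x : Word) : ℕ := ((range x.length).filter fun q => letterAt x q = 4).card

def rowLen (x : Word) (i : ℕ) : ℕ :=
  ((range x.length).filter fun q => letterAt x q = 3 ∧ rowOf x q = i).card

/-- A number larger than any relevant number in a word. -/
def cap (x : Word) : ℕ := x.length + 3

/-- The entry of a table, cut off at `cap x`. -/
def entry (x : Word) (i j : ℕ) : ℕ :=
  Nat.rec (motive := fun _ => ℕ) 0 (fun t a =>
    if (letterAt x (x.length - 1 - t) = 1 ∨ letterAt x (x.length - 1 - t) = 2) ∧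
      rowOf x (x.length - 1 - t) = i ∧ colOf x (x.length - 1 - t) = j
    then min (2 * a + (letterAt x (x.length - 1 - t) - 1)) (cap x) else a) x.length

theorem numRows_le (x : Word) : numRows x ≤ x.length :=
  (card_filter_le _ _).trans (card_range _).le

theorem rowLen_le (x : Word) (i : ℕ) : rowLen x i ≤ x.length :=
  (card_filter_le _ _).trans (card_range _).le

theorem LogFn.numRows : LogFn fun c : γ => numRows (Ctx.word c) :=
  LogFn.count LogFn.length (LogPred.eq LogFn.v0.letterAt (LogFn.const 4))

theorem LogFn.rowLen {f : γ → ℕ} (hf : LogFn f) : LogFn fun c : γ => rowLen (Ctx.word c) (f c) :=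
  LogFn.count LogFn.length
    ((LogPred.eq LogFn.v0.letterAt (LogFn.const 3)).and (LogPred.eq LogFn.v0.rowOf hf.weak))

/-- Numbers are written with the least significant bit first, so Horner's scheme runs over the word
from right to left. The cutoff at `cap` keeps the accumulator polynomially bounded although the
number itself may be exponential. -/
theorem LogFn.entry {f g : γ → ℕ} (hf : LogFn f) (hg : LogFn g) :
    LogFn fun c : γ => entry (Ctx.word c) (f c) (g c) := by
  have hq : LogFn fun p : (γ × ℕ) × ℕ => (Ctx.word p).length - 1 - p.1.2 :=
    (LogFn.length.sub (LogFn.const 1)).sub LogFn.v1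
  refine LogFn.natrec (b := fun c => Logspace.cap (Ctx.word c)) LogFn.length (LogFn.const 0)
    (g := fun c t a =>
    if (Logspace.letterAt (Ctx.word c) ((Ctx.word c).length - 1 - t) = 1 ∨
      Logspace.letterAt (Ctx.word c) ((Ctx.word c).length - 1 - t) = 2) ∧
      Logspace.rowOf (Ctx.word c) ((Ctx.word c).length - 1 - t) = f c ∧
      Logspace.colOf (Ctx.word c) ((Ctx.word c).length - 1 - t) = g c
    then Min.min (2 * a + (Logspace.letterAt (Ctx.word c) ((Ctx.word c).length - 1 - t) - 1))
      (Logspace.cap (Ctx.word c)) else a)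
    (LogFn.ite (((LogPred.eq hq.letterAt (LogFn.const 1)).or
      (LogPred.eq hq.letterAt (LogFn.const 2))).and ((LogPred.eq hq.rowOf hf.weak.weak).and
        (LogPred.eq hq.colOf hg.weak.weak)))
      ((((LogFn.const 2).mul LogFn.v0).add (hq.letterAt.sub (LogFn.const 1))).min
        (LogFn.length.add (LogFn.const 3))) LogFn.v0)
    (LogFn.length.add (LogFn.const 3)).polyBdd ?_
  intro c i _
  induction i with
  | zero => exact Nat.zero_le _
  | succ i ih =>
    dsimp only at ih ⊢
    split_ifs
    · exact min_le_right _ _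
    · exact ih (by omega)

/-! ## Correctness of reading -/

/-- The value of the field `(i, j)` in a word that starts at the field `p`. -/
def fieldVal (s i j : ℕ) : Word → ℕ × ℕ → ℕ
  | [], _ => 0
  | .bit b :: w, p =>
    if p = (i, j) then min (2 * fieldVal s i j w p + b.toNat) s else fieldVal s i j w p
  | .comma :: w, p => fieldVal s i j w (p.1, p.2 + 1)
  | .semicolon :: w, p => fieldVal s i j w (p.1 + 1, 0)

theorem letterAt_of_drop {x w : Word} {a : Letter} {q : ℕ} (h : x.drop q = a :: w) :
    letterAt x q = letterCode (some a) := by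
  have : x[q]? = some a := by
    have := congrArg (·[0]?) h
    simpa using this
  rw [letterAt, this]

theorem rowOf_succ (x : Word) (q : ℕ) :
    rowOf x (q + 1) = rowOf x q + if letterAt x q = 4 then 1 else 0 := by
  unfold rowOf
  rw [range_add_one, filter_insert]
  split_ifs
  · rw [card_insert_of_notMem (by simp)]
  · rfl

/-- After `t` steps the recursion has dealt with the last `t` letters, and `fieldVal` does the same
on this suffix if it is told the row and column where the suffix begins. This exchanges positions
for structural recursion on words. -/
theorem entry_eq_fieldVal (x : Word) (i j : ℕ) : entry x i j = fieldVal (cap x) i j x (0, 0) := by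
  have key : ∀ t ≤ x.length, Nat.rec (motive := fun _ => ℕ) 0 (fun t a =>
      if (letterAt x (x.length - 1 - t) = 1 ∨ letterAt x (x.length - 1 - t) = 2) ∧
        rowOf x (x.length - 1 - t) = i ∧ colOf x (x.length - 1 - t) = j
      then min (2 * a + (letterAt x (x.length - 1 - t) - 1)) (cap x) else a) t =
      fieldVal (cap x) i j (x.drop (x.length - t))
        (rowOf x (x.length - t), colOf x (x.length - t)) := by
    intro t ht
    induction t with
    | zero => simp [fieldVal]
    | succ t ih =>
      have h1 := ih (by omega)
      have e : x.length - t = x.length - 1 - t + 1 := by omega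
      rw [show x.length - (t + 1) = x.length - 1 - t by omega]
      rw [e] at h1
      generalize hq : x.length - 1 - t = q at *
      have hq' : q < x.length := by omega
      have hd : x.drop q = x[q] :: x.drop (q + 1) := List.drop_eq_getElem_cons hq'
      have hl := letterAt_of_drop hd
      rw [hd]
      simp only [hq, h1, rowOf_succ, colOf]
      rw [hl]
      rcases x[q] with (_ | _) | _ | _ <;> simp [letterCode, fieldVal]
  have := key x.length le_rfl
  rw [Nat.sub_self] at this
  exact this

theorem fieldVal_eq_zero {s i j : ℕ} (w : Word) (p : ℕ × ℕ)
    (h : i < p.1 ∨ (i = p.1 ∧ j < p.2)) : fieldVal s i j w p = 0 := by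
  induction w generalizing p with
  | nil => rfl
  | cons a w ih =>
    rcases a with b | _ | _
    · have : p ≠ (i, j) := by rintro rfl; simp at h
      simpa [fieldVal, this] using ih p h
    · exact ih _ (by dsimp only; omega)
    · exact ih _ (by dsimp only; omega)

/-- Truncating at `s` in every step of Horner's scheme has the same effect as truncating once at the
end, since doubling does not bring a value back below `s`. -/
theorem fieldVal_bits {s i j : ℕ} (l : List Bool) (w : Word) (p : ℕ × ℕ) :
    fieldVal s i j (l.map Letter.bit ++ Letter.comma :: w) p =
      if p = (i, j) then min (bitsVal l) s else fieldVal s i j w (p.1, p.2 + 1) := by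
  induction l with
  | nil =>
    split_ifs with h
    · subst h
      simpa [fieldVal] using fieldVal_eq_zero w (p := (i, j + 1)) (Or.inr ⟨rfl, Nat.lt_succ_self j⟩)
    · rfl
  | cons b l ih =>
    simp only [List.map_cons, List.cons_append, fieldVal, ih, Frag.bitsVal_cons]
    split_ifs with h
    · omega
    · rfl

theorem fieldVal_row {s i j : ℕ} (r : List ℕ) (w : Word) (i₀ j₀ : ℕ) :
    fieldVal s i j (encodeRow r ++ Letter.semicolon :: w) (i₀, j₀) =
      if i₀ = i ∧ j₀ ≤ j then min (r.getD (j - j₀) 0) s else fieldVal s i j w (i₀ + 1, 0) := by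
  induction r generalizing j₀ with
  | nil =>
    split_ifs with h
    · simpa [encodeRow, fieldVal] using fieldVal_eq_zero w _ (Or.inl (by dsimp only; omega))
    · rfl
  | cons a r ih =>
    have e : encodeRow (a :: r) ++ Letter.semicolon :: w =
      (encodeNat a).map Letter.bit ++ Letter.comma :: (encodeRow r ++ Letter.semicolon :: w) := by
      simp [encodeRow]
    rw [e, fieldVal_bits, bitsVal_encodeNat, ih]
    by_cases h : i₀ = i
    · subst h
      rcases lt_trichotomy j j₀ with h | h | h
      · have h1 : ¬ j₀ + 1 ≤ j := by omega
        have h2 : ¬ j₀ ≤ j := by omega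
        simp [h1, h2, h.ne']
      · subst h; simp
      · have h1 : j₀ + 1 ≤ j := h
        have h2 : j₀ ≤ j := by omega
        obtain ⟨k, hk⟩ : ∃ k, j - j₀ = k + 1 := ⟨j - j₀ - 1, by omega⟩
        simp [h1, h2, h.ne, hk, show j - (j₀ + 1) = k by omega]
    · simp [h]

/-- The entries of a table, `0` outside. -/
def tableAt (T : List (List ℕ)) (i j : ℕ) : ℕ := (T.getD i []).getD j 0

theorem encodeTable_cons (r : List ℕ) (T : List (List ℕ)) :
    encodeTable (r :: T) = encodeRow r ++ Letter.semicolon :: encodeTable T := by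
  simp [encodeTable_eq]

theorem fieldVal_table {s i j : ℕ} (T : List (List ℕ)) (i₀ : ℕ) :
    fieldVal s i j (encodeTable T) (i₀, 0) =
      if i₀ ≤ i then min (tableAt T (i - i₀) j) s else 0 := by
  induction T generalizing i₀ with
  | nil => simp [encodeTable_eq, fieldVal, tableAt]
  | cons r T ih =>
    rw [encodeTable_cons, fieldVal_row, ih]
    rcases lt_trichotomy i i₀ with h | h | h
    · have h1 : ¬ i₀ + 1 ≤ i := by omega
      have h2 : ¬ i₀ ≤ i := by omega
      simp [h1, h2, h.ne']
    · subst h; simp [tableAt]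
    · have h1 : i₀ + 1 ≤ i := h
      have h2 : i₀ ≤ i := by omega
      obtain ⟨k, hk⟩ : ∃ k, i - i₀ = k + 1 := ⟨i - i₀ - 1, by omega⟩
      simp [h1, h2, h.ne, hk, show i - (i₀ + 1) = k by omega, tableAt]

theorem entry_encodeTable (T : List (List ℕ)) (i j : ℕ) :
    entry (encodeTable T) i j = min (tableAt T i j) (cap (encodeTable T)) := by
  rw [entry_eq_fieldVal, fieldVal_table]; simp

theorem letterAt_cons_succ (a : Letter) (w : Word) (q : ℕ) :
    letterAt (a :: w) (q + 1) = letterAt w q := by simp [letterAt]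

theorem card_letterAt (w : Word) (a : Letter) :
    ((range w.length).filter fun q => letterAt w q = letterCode (some a)).card = w.count a := by
  induction w with
  | nil => rfl
  | cons b w ih =>
    rw [card_filter] at ih ⊢
    rw [List.length_cons, sum_range_succ']
    simp only [letterAt_cons_succ, ih]
    have : letterAt (b :: w) 0 = letterCode (some b) := by simp [letterAt]
    rw [this, List.count_cons]
    congr 1
    by_cases h : b = a
    · simp [h]
    · rw [if_neg fun h' => h (Option.some_injective _ (Frag.letterCode_injective h'))]
      simp [h]

theorem count_encodeRow (r : List ℕ) : (encodeRow r).count .semicolon = 0 ∧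
    (encodeRow r).count .comma = r.length := by
  have h : ∀ l : List Bool, (l.map Letter.bit).count .semicolon = 0 ∧
      (l.map Letter.bit).count .comma = 0 := by
    intro l
    constructor <;> (rw [List.count_eq_zero]; simp)
  induction r with
  | nil => exact ⟨rfl, rfl⟩
  | cons a r ih =>
    have e : encodeRow (a :: r) = (encodeNat a).map Letter.bit ++ Letter.comma :: encodeRow r := by
      simp [encodeRow]
    rw [e]
    simp [h, ih]

theorem numRows_encodeTable (T : List (List ℕ)) : numRows (encodeTable T) = T.length := by
  refine (card_letterAt _ .semicolon).trans ?_
  induction T with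
  | nil => rfl
  | cons r T ih =>
    rw [encodeTable_cons, List.count_append, (count_encodeRow r).1, List.count_cons, ih]
    simp

theorem rowOf_cons_succ (a : Letter) (w : Word) (q : ℕ) :
    rowOf (a :: w) (q + 1) = rowOf w q + if a = .semicolon then 1 else 0 := by
  unfold rowOf
  rw [card_filter, card_filter, sum_range_succ']
  simp only [letterAt_cons_succ]
  congr 1
  have : letterAt (a :: w) 0 = letterCode (some a) := by simp [letterAt]
  rw [this]
  rcases a with (_ | _) | _ | _ <;> simp [letterCode]

/-- The number of commas in the row `i` of a word that starts in row `i₀`. -/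
def rowLenFrom (i : ℕ) (w : Word) (i₀ : ℕ) : ℕ :=
  ((range w.length).filter fun q => letterAt w q = 3 ∧ i₀ + rowOf w q = i).card

theorem rowLenFrom_cons (i : ℕ) (a : Letter) (w : Word) (i₀ : ℕ) :
    rowLenFrom i (a :: w) i₀ = (if a = .comma ∧ i₀ = i then 1 else 0) +
      rowLenFrom i w (i₀ + if a = .semicolon then 1 else 0) := by
  unfold rowLenFrom
  rw [card_filter, card_filter, List.length_cons, sum_range_succ', add_comm]
  simp only [letterAt_cons_succ, rowOf_cons_succ]
  congr 1
  · have : letterAt (a :: w) 0 = letterCode (some a) := by simp [letterAt]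
    rw [this]
    have h0 : rowOf (a :: w) 0 = 0 := rfl
    rcases a with (_ | _) | _ | _ <;> simp [letterCode, h0]
  · refine sum_congr rfl fun q _ => ?_
    rw [add_assoc, add_comm (rowOf w q)]

theorem rowLenFrom_row (i : ℕ) (u w : Word) (i₀ : ℕ) (h : u.count .semicolon = 0) :
    rowLenFrom i (u ++ Letter.semicolon :: w) i₀ = (if i₀ = i then u.count .comma else 0) +
      rowLenFrom i w (i₀ + 1) := by
  induction u with
  | nil => simp [rowLenFrom_cons]
  | cons a u ih =>
    rw [List.count_cons] at h
    have h1 : a ≠ .semicolon := by rintro rfl; simp at h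
    rw [List.cons_append, rowLenFrom_cons]
    simp only [h1, if_false, add_zero]
    rw [ih (by omega), List.count_cons]
    by_cases h2 : a = .comma <;> by_cases h3 : i₀ = i <;> simp [h2, h3] <;> omega

theorem rowLenFrom_table (i : ℕ) (T : List (List ℕ)) (i₀ : ℕ) :
    rowLenFrom i (encodeTable T) i₀ = if i₀ ≤ i then (T.getD (i - i₀) []).length else 0 := by
  induction T generalizing i₀ with
  | nil => simp [encodeTable_eq, rowLenFrom]
  | cons r T ih =>
    rw [encodeTable_cons, rowLenFrom_row _ _ _ _ (count_encodeRow r).1, ih, (count_encodeRow r).2]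
    rcases lt_trichotomy i i₀ with h | h | h
    · have h1 : ¬ i₀ + 1 ≤ i := by omega
      have h2 : ¬ i₀ ≤ i := by omega
      simp [h1, h2, h.ne']
    · subst h; simp
    · have h1 : i₀ + 1 ≤ i := h
      have h2 : i₀ ≤ i := by omega
      obtain ⟨k, hk⟩ : ∃ k, i - i₀ = k + 1 := ⟨i - i₀ - 1, by omega⟩
      simp [h1, h2, h.ne, hk, show i - (i₀ + 1) = k by omega]

theorem rowLen_encodeTable (T : List (List ℕ)) (i : ℕ) :
    rowLen (encodeTable T) i = (T.getD i []).length := by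
  have := rowLenFrom_table i T 0
  simpa [rowLenFrom, rowLen] using this

theorem list_eq_of_getD {l l' : List ℕ} (h : l.length = l'.length)
    (h' : ∀ j, l.getD j 0 = l'.getD j 0) : l = l' := by
  refine List.ext_getElem h fun j h1 h2 => ?_
  have := h' j
  rwa [List.getD_eq_getElem _ _ h1, List.getD_eq_getElem _ _ h2] at this

theorem encodeTable_injective : Function.Injective encodeTable := by
  intro T T' h
  have h1 : T.length = T'.length := by
    rw [← numRows_encodeTable, h, numRows_encodeTable]
  refine List.ext_getElem h1 fun i hi hi' => ?_
  have e : T.getD i [] = T[i] := List.getD_eq_getElem _ _ hi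
  have e' : T'.getD i [] = T'[i] := List.getD_eq_getElem _ _ hi'
  rw [← e, ← e']
  refine list_eq_of_getD ?_ fun j => ?_
  · rw [← rowLen_encodeTable, h, rowLen_encodeTable]
  -- The cutoff is chosen above both entries, so that neither of them is truncated.
  · have h2 := fieldVal_table (s := tableAt T i j + tableAt T' i j) (i := i) (j := j) T 0
    rw [h, fieldVal_table] at h2
    simp only [Nat.zero_le, if_true, Nat.sub_zero] at h2
    change tableAt T i j = tableAt T' i j
    omega

/-- The condition on consecutive letters that characterizes encodings of tables. -/
def localGood (a b : ℕ) : Prop :=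
  (a = 1 → b = 1 ∨ b = 2) ∧ (a = 2 → b = 1 ∨ b = 2 ∨ b = 3) ∧ (a = 3 → b ≠ 0)

/-- The highest bit of a number, which comes last, must be `1`; bits must be closed by a comma and
rows by a semicolon. Beyond the end `letterAt` is `0`, so the condition at the last position forces
a nonempty word to end with a semicolon. -/
def IsTable (x : Word) : Prop := ∀ q < x.length, localGood (letterAt x q) (letterAt x (q + 1))

theorem LogPred.isTable : LogPred fun c : γ => IsTable (Ctx.word c) := by
  have h0 : LogFn fun p : γ × ℕ => letterAt (Ctx.word p) p.2 := LogFn.v0.letterAt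
  have h1 : LogFn fun p : γ × ℕ => letterAt (Ctx.word p) (p.2 + 1) := LogFn.v0.succ.letterAt
  have e : ∀ {f : γ × ℕ → ℕ}, LogFn f → ∀ n, LogPred fun p => f p = n :=
    fun hf n => LogPred.eq hf (LogFn.const n)
  exact LogPred.all LogFn.length (((e h0 1).imp ((e h1 1).or (e h1 2))).and
    (((e h0 2).imp ((e h1 1).or ((e h1 2).or (e h1 3)))).and ((e h0 3).imp (e h1 0).not)))

theorem isTable_cons (a : Letter) (w : Word) :
    IsTable (a :: w) ↔ localGood (letterCode (some a)) (letterAt w 0) ∧ IsTable w := by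
  constructor
  · intro h
    refine ⟨?_, fun q hq => ?_⟩
    · have := h 0 (by simp)
      simpa [letterAt] using this
    · have := h (q + 1) (by simpa using hq)
      simpa [letterAt_cons_succ] using this
  · rintro ⟨h1, h2⟩ (_ | q) hq
    · simpa [letterAt] using h1
    · have := h2 q (by simpa using hq)
      simpa [letterAt_cons_succ] using this

theorem letterAt_zero_cons (a : Letter) (w : Word) :
    letterAt (a :: w) 0 = letterCode (some a) := by simp [letterAt]

theorem isTable_encodeTable (T : List (List ℕ)) : IsTable (encodeTable T) := by
  induction T with
  | nil => intro q hq; simp [encodeTable_eq] at hq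
  | cons r T ih =>
    rw [encodeTable_cons]
    have h0 : IsTable (Letter.semicolon :: encodeTable T) := by
      rw [isTable_cons]; exact ⟨by simp [localGood, letterCode], ih⟩
    induction r with
    | nil => exact h0
    | cons a r ihr =>
      have e : encodeRow (a :: r) ++ Letter.semicolon :: encodeTable T =
        (encodeNat a).map Letter.bit ++ Letter.comma ::
          (encodeRow r ++ Letter.semicolon :: encodeTable T) := by simp [encodeRow]
      rw [e]
      have h1 : IsTable (Letter.comma :: (encodeRow r ++ Letter.semicolon :: encodeTable T)) := by
        rw [isTable_cons]
        refine ⟨?_, ihr⟩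
        have : encodeRow r ++ Letter.semicolon :: encodeTable T ≠ [] := by simp
        obtain ⟨b, w, hw⟩ := List.exists_cons_of_ne_nil this
        rw [hw, letterAt_zero_cons]
        rcases b with (_ | _) | _ | _ <;> simp [localGood, letterCode]
      generalize encodeRow r ++ Letter.semicolon :: encodeTable T = w at h1
      clear e ihr h0 ih
      induction a using Nat.strong_induction_on with
      | _ a iha =>
        by_cases ha : a = 0
        · subst ha; exact h1
        · rw [encodeNat_eq_cons ha, List.map_cons, List.cons_append, isTable_cons]
          refine ⟨?_, iha _ (by omega)⟩
          by_cases h2 : a / 2 = 0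
          · have h3 : a % 2 = 1 := by omega
            simp [h2, h3, encodeNat_zero, letterAt_zero_cons, localGood, letterCode]
          · rw [encodeNat_eq_cons h2, List.map_cons, List.cons_append, letterAt_zero_cons]
            by_cases h4 : a % 2 = 1 <;> by_cases h5 : a / 2 % 2 = 1 <;>
              simp [h4, h5, localGood, letterCode]

/-- By induction from the right, every letter prefixed to a table has a meaning: a semicolon adds an
empty row, a comma adds an entry `0` in front of the first row, and a bit `b` turns the first entry
`c` into `2 * c + b`. The local condition excludes just the case `c = 0`, `b = 0` and the cases
without a first entry. -/
theorem IsTable.exists_eq {x : Word} (h : IsTable x) : ∃ T, encodeTable T = x := by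
  suffices ∀ x : Word, IsTable x → x = [] ∨ ∃ r T, x = encodeRow r ++ Letter.semicolon ::
      encodeTable T by
    rcases this x h with rfl | ⟨r, T, rfl⟩
    · exact ⟨[], rfl⟩
    · exact ⟨r :: T, encodeTable_cons r T⟩
  clear h x
  intro x h
  induction x with
  | nil => exact Or.inl rfl
  | cons a w ih =>
    rw [isTable_cons] at h
    obtain ⟨h1, h2⟩ := h
    right
    rcases a with b | _ | _
    · rcases ih h2 with rfl | ⟨r, T, rfl⟩
      · rcases b <;> simp [localGood, letterCode, letterAt] at h1
      · rcases r with _ | ⟨c, r⟩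
        · rcases b <;> simp [localGood, letterCode, letterAt, encodeRow] at h1
        · have hne : 2 * c + b.toNat ≠ 0 := by
            intro h0
            have hc : c = 0 := by omega
            have hb : b = false := by rcases b <;> simp_all
            subst hc hb
            simp [localGood, letterCode, letterAt, encodeRow, encodeNat_zero] at h1
          refine ⟨(2 * c + b.toNat) :: r, T, ?_⟩
          simp only [encodeRow, List.flatMap_cons]
          rw [encodeNat_eq_cons hne, show (2 * c + b.toNat) / 2 = c by rcases b <;> simp <;> omega]
          rcases b
          · simp
          · simp [Nat.add_mod]
    · rcases ih h2 with rfl | ⟨r, T, rfl⟩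
      · simp [localGood, letterCode, letterAt] at h1
      · exact ⟨0 :: r, T, by simp [encodeRow, encodeNat_zero]⟩
    · rcases ih h2 with rfl | ⟨r, T, rfl⟩
      · exact ⟨[], [], rfl⟩
      · exact ⟨[], r :: T, by rw [encodeTable_cons]; rfl⟩

end Logspace

/-! ### The four problems on instances indexed by labels. -/

namespace Logspace

open Finset

/-! ## Indexing by lists of labels -/

section Labels

variable {α : Type}

def listEmb {L : List α} (hL : L.Nodup) : Fin L.length ↪ α := ⟨L.get, List.nodup_iff_injective_get.1 hL⟩

theorem listEmb_apply {L : List α} (hL : L.Nodup) (i : Fin L.length) : listEmb hL i = L.get i := rfl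

theorem map_listEmb_univ [DecidableEq α] {L : List α} (hL : L.Nodup) : univ.map (listEmb hL) = L.toFinset := by
  ext a
  simp [listEmb_apply, List.mem_iff_get]

/-- Instances live on `Fin n`, while the reductions produce vertices and edges with structured
names. This transfers existence of a set of indices to existence of a set of labels. -/
theorem exists_finset_get [DecidableEq α] {L : List α} (hL : L.Nodup) {Q : Finset α → Prop} :
    (∃ S : Finset (Fin L.length), Q (S.map (listEmb hL))) ↔ ∃ T ⊆ L.toFinset, Q T := by
  constructor
  · rintro ⟨S, hS⟩
    refine ⟨_, ?_, hS⟩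
    rw [← map_listEmb_univ hL]
    exact map_subset_map.2 (subset_univ S)
  · rintro ⟨T, hT, hQ⟩
    rw [← map_listEmb_univ hL] at hT
    obtain ⟨S, -, rfl⟩ := subset_map_iff.1 hT
    exact ⟨S, hQ⟩

theorem card_filter_map_listEmb {L : List α} (hL : L.Nodup) (S : Finset (Fin L.length))
    (P : α → Prop) [DecidablePred P] :
    ((S.map (listEmb hL)).filter P).card = (S.filter fun i => P (L.get i)).card := by
  rw [filter_map, card_map]; rfl

theorem ofFn_eq_map {β : Type} (L : List α) (f : Fin L.length → β) (g : α → β) :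
    List.ofFn f = L.map g ↔ ∀ i, f i = g (L.get i) := by
  have : L.map g = List.ofFn fun i : Fin L.length => g (L.get i) := by
    conv_lhs => rw [← List.ofFn_get L]
    rw [List.map_ofFn]
    rfl
  rw [this, List.ofFn_inj, funext_iff]

theorem ofFn_eq_map_range {β : Type} {n : ℕ} (f : Fin n → β) (g : ℕ → β) :
    List.ofFn f = (List.range n).map g ↔ ∀ i : Fin n, f i = g i := by
  have : (List.range n).map g = List.ofFn fun i : Fin n => g i := by
    rw [List.ofFn_eq_map, ← List.map_coe_finRange_eq_range, List.map_map]; rfl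
  rw [this, List.ofFn_inj, funext_iff]

/-- Each fiber over an unordered pair consists of the two orientations, which are distinct since
there are no loops. -/
theorem card_eq_two_mul_card_image {V : Type} [DecidableEq V] (P : Finset (V × V))
    (h₁ : ∀ p ∈ P, p.1 ≠ p.2) (h₂ : ∀ p ∈ P, p.swap ∈ P) :
    P.card = 2 * (P.image fun p => s(p.1, p.2)).card := by
  rw [card_eq_sum_card_image (fun p => s(p.1, p.2)) P, mul_comm]
  refine sum_const_nat fun b hb => ?_
  obtain ⟨⟨u, v⟩, hp, rfl⟩ := mem_image.1 hb
  have : (P.filter fun a => s(a.1, a.2) = s(u, v)) = {(u, v), (v, u)} := by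
    ext ⟨a, b⟩
    simp only [mem_filter, Sym2.eq_iff, mem_insert, mem_singleton, Prod.mk.injEq]
    constructor
    · exact fun h => h.2
    · rintro (⟨rfl, rfl⟩ | ⟨rfl, rfl⟩)
      · exact ⟨hp, Or.inl ⟨rfl, rfl⟩⟩
      · exact ⟨h₂ _ hp, Or.inr ⟨rfl, rfl⟩⟩
  rw [this, card_pair]
  intro h
  exact h₁ _ hp (congrArg Prod.fst h)

end Labels

/-! ## Exact perfect matching -/

theorem entry_eq_two {I : MatchingInstance} {u v : Fin I.n} : I.entry u v = 2 ↔ s(u, v) ∈ I.R := by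
  unfold MatchingInstance.entry; split_ifs <;> simp_all

theorem entry_ne_zero {I : MatchingInstance} {u v : Fin I.n} : I.entry u v ≠ 0 ↔ I.G.Adj u v := by
  unfold MatchingInstance.entry
  split_ifs with h1 h2
  · simpa using I.red_subset h1
  · simpa using h2
  · simpa using h2

theorem card_red_matching {I : MatchingInstance} {M : I.G.Subgraph} {g : Fin I.n → Fin I.n}
    (hM : ∀ u v, M.Adj u v ↔ g u = v) :
    (univ.filter fun v => I.entry v (g v) = 2).card = 2 * (M.edgeSet ∩ I.R).ncard := by
  classical
  have hg : ∀ v, g (g v) = v := fun v => (hM _ _).1 (((hM v _).2 rfl).symm)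
  have e : M.edgeSet ∩ I.R = ((((univ.filter fun v => I.entry v (g v) = 2).image
      fun v => (v, g v)).image fun p => s(p.1, p.2) : Finset (Sym2 (Fin I.n))) :
      Set (Sym2 (Fin I.n))) := by
    ext s
    induction s using Sym2.ind with
    | _ u v =>
      simp only [Set.mem_inter_iff, SimpleGraph.Subgraph.mem_edgeSet, coe_image, Set.mem_image,
        coe_filter, mem_univ, true_and, Set.mem_ofPred_eq, entry_eq_two, hM]
      constructor
      · rintro ⟨rfl, h⟩
        exact ⟨_, ⟨u, h, rfl⟩, rfl⟩
      · rintro ⟨_, ⟨w, h, rfl⟩, h'⟩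
        dsimp only at h'
        refine ⟨?_, h' ▸ h⟩
        rcases Sym2.eq_iff.1 h' with ⟨rfl, rfl⟩ | ⟨rfl, rfl⟩
        · rfl
        · exact hg _
  rw [e, Set.ncard_coe_finset, ← card_eq_two_mul_card_image, card_image_of_injective]
  · intro u v h; exact congrArg Prod.fst h
  · simp only [mem_image]
    rintro p ⟨v, -, rfl⟩ h
    exact M.loopless.irrefl v ((hM v v).2 h.symm)
  · simp only [mem_image, mem_filter, mem_univ, true_and]
    rintro p ⟨v, h, rfl⟩
    refine ⟨g v, ?_, by rw [hg]; rfl⟩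
    rw [hg]
    rw [entry_eq_two] at h ⊢
    rwa [Sym2.eq_swap]

/-- A perfect matching is the involution that sends each vertex to its partner; it has no fixed
points because diagonal entries vanish. Vertices on red edges are counted, so each red edge counts
twice. -/
theorem matching_yes_iff (I : MatchingInstance) : I.Yes ↔ ∃ g : Fin I.n → Fin I.n,
    (∀ v, g (g v) = v ∧ I.entry v (g v) ≠ 0) ∧
      (univ.filter fun v => I.entry v (g v) = 2).card = 2 * I.k := by
  constructor
  · rintro ⟨M, h1, h2⟩
    rw [SimpleGraph.Subgraph.isPerfectMatching_iff] at h1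
    choose g hg hg' using h1
    have hM : ∀ u v, M.Adj u v ↔ g u = v :=
      fun u v => ⟨fun h => (hg' u v h).symm, fun h => h ▸ hg u⟩
    refine ⟨g, fun v => ⟨(hM _ _).1 ((hg v).symm), entry_ne_zero.2 (M.adj_sub (hg v))⟩, ?_⟩
    rw [card_red_matching hM, h2]
  · rintro ⟨g, h1, h2⟩
    let M : I.G.Subgraph :=
      { verts := Set.univ
        Adj := fun u v => g u = v
        adj_sub := fun {u v} h => by subst h; exact entry_ne_zero.1 (h1 u).2
        edge_vert := fun _ => Set.mem_univ _
        symm := ⟨fun u v h => by subst h; exact (h1 u).1⟩ }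
    have hM : ∀ u v, M.Adj u v ↔ g u = v := fun u v => Iff.rfl
    refine ⟨M, ?_, ?_⟩
    · rw [SimpleGraph.Subgraph.isPerfectMatching_iff]
      exact fun v => ⟨g v, rfl, fun w h => Eq.symm h⟩
    · have := card_red_matching hM
      omega

theorem card_red (I : MatchingInstance) :
    (univ.filter fun p : Fin I.n × Fin I.n => I.entry p.1 p.2 = 2).card = 2 * I.R.ncard := by
  classical
  rw [card_eq_two_mul_card_image]
  · rw [← Set.ncard_coe_finset]
    congr 2
    ext s
    induction s using Sym2.ind with
    | _ u v =>
      simp only [entry_eq_two, coe_image, coe_filter, mem_univ, true_and, Set.mem_image,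
        Set.mem_ofPred_eq, Prod.exists]
      exact ⟨fun ⟨a, b, h, h'⟩ => h' ▸ h, fun h => ⟨u, v, h, rfl⟩⟩
  · intro p hp
    simp only [mem_filter, mem_univ, true_and, entry_eq_two] at hp
    exact (I.G.mem_edgeSet.1 (I.red_subset hp)).ne
  · intro p hp
    simp only [mem_filter, mem_univ, true_and, entry_eq_two] at hp ⊢
    rwa [Sym2.eq_swap]

section

variable {α : Type}

/-- The encoding of a graph whose vertices are labels. -/
def matrixTable (L : List α) (ent : α → α → ℕ) (k : ℕ) : List (List ℕ) :=
  [k] :: L.map fun a => L.map fun b => ent a b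

/-- `ent` is a symmetric matrix with entries `0`, `1` and `2` and zeros on the diagonal. -/
def IsColoring (L : List α) (ent : α → α → ℕ) : Prop :=
  ∀ a ∈ L, ent a a = 0 ∧ ∀ b ∈ L, ent a b ≤ 2 ∧ ent a b = ent b a

/-- There is a perfect matching with `k` edges of color `2`. -/
def HasMatching [DecidableEq α] (L : List α) (ent : α → α → ℕ) (k : ℕ) : Prop :=
  ∃ f : α → α, (∀ a ∈ L, f a ∈ L ∧ f (f a) = a ∧ ent a (f a) ≠ 0) ∧
    (L.toFinset.filter fun a => ent a (f a) = 2).card = 2 * k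

theorem hasMatching_iff [DecidableEq α] {I : MatchingInstance} {L : List α} (hL : L.Nodup) {ent : α → α → ℕ}
    (e : Fin L.length ≃ Fin I.n) (h : ∀ u v, I.entry (e u) (e v) = ent (L.get u) (L.get v)) :
    I.Yes ↔ HasMatching L ent I.k := by
  rw [matching_yes_iff]
  have hinj : Function.Injective L.get := List.nodup_iff_injective_get.1 hL
  have hcard : ∀ (g : Fin I.n → Fin I.n) (f : α → α),
      (∀ u, f (L.get u) = L.get (e.symm (g (e u)))) →
      (univ.filter fun v => I.entry v (g v) = 2).card =
        (L.toFinset.filter fun a => ent a (f a) = 2).card := by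
    intro g f hf
    rw [← map_listEmb_univ hL, card_filter_map_listEmb, ← card_map e.toEmbedding]
    congr 1
    ext v
    simp only [mem_filter, mem_univ, true_and, mem_map_equiv, hf, ← h, Equiv.apply_symm_apply]
  constructor
  · rintro ⟨g, h1, h2⟩
    have hf : ∀ u, Function.extend L.get (fun u => L.get (e.symm (g (e u)))) id (L.get u) =
        L.get (e.symm (g (e u))) := fun u => hinj.extend_apply _ _ _
    refine ⟨Function.extend L.get (fun u => L.get (e.symm (g (e u)))) id, ?_, ?_⟩
    · intro a ha
      obtain ⟨u, rfl⟩ := List.mem_iff_get.1 ha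
      rw [hf, hf, ← h]
      refine ⟨List.get_mem _ _, ?_, ?_⟩
      · simp [(h1 _).1]
      · simpa using (h1 (e u)).2
    · rw [← hcard g _ hf, h2]
  · rintro ⟨f, h1, h2⟩
    have : ∀ v : Fin I.n, ∃ w : Fin I.n, L.get (e.symm w) = f (L.get (e.symm v)) := by
      intro v
      obtain ⟨u, hu⟩ := List.mem_iff_get.1 (h1 _ (List.get_mem L (e.symm v))).1
      exact ⟨e u, by simpa using hu⟩
    choose g hg using this
    refine ⟨g, fun v => ⟨?_, ?_⟩, ?_⟩
    · apply e.symm.injective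
      apply hinj
      rw [hg, hg]
      exact (h1 _ (List.get_mem _ _)).2.1
    · have := (h1 _ (List.get_mem L (e.symm v))).2.2
      rw [← hg, ← h] at this
      simpa using this
    · rw [← h2]
      exact hcard g f fun u => by rw [hg]; simp

theorem card_red_labels [DecidableEq α] {I : MatchingInstance} {L : List α} (hL : L.Nodup) {ent : α → α → ℕ}
    (e : Fin L.length ≃ Fin I.n) (h : ∀ u v, I.entry (e u) (e v) = ent (L.get u) (L.get v)) :
    2 * I.R.ncard = ((L.toFinset ×ˢ L.toFinset).filter fun p => ent p.1 p.2 = 2).card := by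
  rw [← card_red]
  have hinj : Function.Injective L.get := List.nodup_iff_injective_get.1 hL
  refine card_bij (fun p _ => (L.get (e.symm p.1), L.get (e.symm p.2))) ?_ ?_ ?_
  · rintro ⟨u, v⟩ hp
    simp only [mem_filter, mem_univ, true_and] at hp
    simp only [mem_filter, mem_product, List.mem_toFinset, List.get_mem, true_and]
    rw [← h]
    simpa using hp
  · rintro ⟨u, v⟩ - ⟨u', v'⟩ - hp
    simpa [hL.getElem_inj_iff, Fin.val_inj] using hp
  · rintro ⟨a, b⟩ hp
    simp only [mem_filter, mem_product, List.mem_toFinset] at hp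
    obtain ⟨⟨ha, hb⟩, hp⟩ := hp
    obtain ⟨u, rfl⟩ := List.mem_iff_get.1 ha
    obtain ⟨v, rfl⟩ := List.mem_iff_get.1 hb
    exact ⟨(e u, e v), by simpa [h] using hp, by simp⟩

/-- Tables are recovered from words by `encodeTable_injective`, and the number of rows fixes the
number of vertices; so any instance with this encoding is the labelled matrix itself. -/
theorem encode_eq_matrixTable {I : MatchingInstance} {L : List α} {ent : α → α → ℕ} {k : ℕ}
    (h : I.encode = encodeTable (matrixTable L ent k)) : I.k = k ∧
    ∃ e : Fin L.length ≃ Fin I.n, ∀ u v, I.entry (e u) (e v) = ent (L.get u) (L.get v) := by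
  have h := encodeTable_injective h
  simp only [matrixTable, List.cons.injEq, and_true] at h
  obtain ⟨h1, h2⟩ := h
  refine ⟨h1, ?_⟩
  obtain ⟨n, G, R, hR, k'⟩ := I
  have h3 : n = L.length := by simpa using congrArg List.length h2
  subst h3
  rw [ofFn_eq_map] at h2
  refine ⟨Equiv.refl _, fun u v => ?_⟩
  have := h2 u
  rw [ofFn_eq_map] at this
  exact this v

theorem exists_encode_eq {L : List α} {ent : α → α → ℕ} (k : ℕ)
    (h : IsColoring L ent) : ∃ I : MatchingInstance, I.encode = encodeTable (matrixTable L ent k) := by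
  let G : SimpleGraph (Fin L.length) :=
    { Adj := fun u v => ent (L.get u) (L.get v) ≠ 0
      symm := ⟨fun u v huv => by
        rwa [← ((h _ (List.get_mem L u)).2 _ (List.get_mem L v)).2]⟩
      loopless := ⟨fun u hu => hu (h _ (List.get_mem L u)).1⟩ }
  let I : MatchingInstance :=
    { n := L.length
      G := G
      R := {s | ∃ u v, s = s(u, v) ∧ ent (L.get u) (L.get v) = 2}
      red_subset := by
        rintro s ⟨u, v, rfl, h⟩
        change ent (L.get u) (L.get v) ≠ 0
        omega
      k := k }
  refine ⟨I, congrArg encodeTable ?_⟩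
  simp only [matrixTable, List.cons.injEq, and_true]
  refine ⟨rfl, (ofFn_eq_map _ _ _).2 fun u => (ofFn_eq_map _ _ _).2 fun v => ?_⟩
  have hs := (h _ (List.get_mem L u)).2 _ (List.get_mem L v)
  have h2 : s(u, v) ∈ I.R ↔ ent (L.get u) (L.get v) = 2 := by
    constructor
    · rintro ⟨a, b, h1, h2⟩
      rcases Sym2.eq_iff.1 h1 with ⟨rfl, rfl⟩ | ⟨rfl, rfl⟩
      · exact h2
      · rw [hs.2]; exact h2
    · intro h; exact ⟨u, v, rfl, h⟩
  have h3 : I.G.Adj u v ↔ ent (L.get u) (L.get v) ≠ 0 := Iff.rfl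
  unfold MatchingInstance.entry
  rw [h2, h3]
  split_ifs <;> omega

theorem entry_symm (I : MatchingInstance) (u v : Fin I.n) : I.entry u v = I.entry v u := by
  unfold MatchingInstance.entry
  rw [Sym2.eq_swap, I.G.adj_comm]

theorem entry_self (I : MatchingInstance) (u : Fin I.n) : I.entry u u = 0 := by
  by_contra h
  exact I.G.loopless.irrefl u (entry_ne_zero.1 h)

theorem entry_le_two (I : MatchingInstance) (u v : Fin I.n) : I.entry u v ≤ 2 := by
  unfold MatchingInstance.entry
  split_ifs <;> omega

theorem isColoring_of_entry {I : MatchingInstance} {L : List α} {ent : α → α → ℕ}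
    {e : Fin L.length ≃ Fin I.n} (h : ∀ u v, I.entry (e u) (e v) = ent (L.get u) (L.get v)) :
    IsColoring L ent := by
  intro a ha
  obtain ⟨u, rfl⟩ := List.mem_iff_get.1 ha
  refine ⟨by rw [← h, entry_self], fun b hb => ?_⟩
  obtain ⟨v, rfl⟩ := List.mem_iff_get.1 hb
  rw [← h, ← h]
  exact ⟨entry_le_two _ _ _, entry_symm _ _ _⟩

/-- Both uses of this are needed later: for labels `List.range n` it analyses input words, and for
gadget labels it analyses the words produced by a reduction. -/
theorem mem_exactPerfectMatching [DecidableEq α] {L : List α} (hL : L.Nodup) {ent : α → α → ℕ} {k : ℕ} :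
    encodeTable (matrixTable L ent k) ∈ exactPerfectMatching ↔
      IsColoring L ent ∧ HasMatching L ent k := by
  constructor
  · rintro ⟨I, h1, h2⟩
    obtain ⟨rfl, e, he⟩ := encode_eq_matrixTable h2
    exact ⟨isColoring_of_entry he, (hasMatching_iff hL e he).1 h1⟩
  · rintro ⟨h1, h2⟩
    obtain ⟨I, hI⟩ := exists_encode_eq k h1
    obtain ⟨rfl, e, he⟩ := encode_eq_matrixTable hI
    exact ⟨I, (hasMatching_iff hL e he).2 h2, hI⟩

theorem mem_restrictedExactPerfectMatching [DecidableEq α] {L : List α} (hL : L.Nodup) {ent : α → α → ℕ} {k : ℕ} :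
    encodeTable (matrixTable L ent k) ∈ restrictedExactPerfectMatching ↔
      (IsColoring L ent ∧ HasMatching L ent k) ∧
        ((L.toFinset ×ˢ L.toFinset).filter fun p => ent p.1 p.2 = 2).card = L.length := by
  constructor
  · rintro ⟨I, h0, h1, h2⟩
    obtain ⟨rfl, e, he⟩ := encode_eq_matrixTable h2
    refine ⟨⟨isColoring_of_entry he, (hasMatching_iff hL e he).1 h1⟩, ?_⟩
    rw [← card_red_labels hL e he, h0]
    simpa using (Fintype.card_congr e).symm
  · rintro ⟨⟨h1, h2⟩, h3⟩
    obtain ⟨I, hI⟩ := exists_encode_eq k h1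
    obtain ⟨rfl, e, he⟩ := encode_eq_matrixTable hI
    refine ⟨I, ?_, (hasMatching_iff hL e he).2 h2, hI⟩
    rw [card_red_labels hL e he, h3]
    simpa using Fintype.card_congr e

end

end Logspace

namespace Logspace

open Finset

/-! ## Exact red-blue perfect `b`-matching -/

section RedBlue

variable {ε : Type} [DecidableEq ε]

/-- There is a set of edges from `L` that meets all the requirements. -/
def HasBMatching (n : ℕ) (L : List ε) (b : ℕ → ℕ) (u v c : ε → ℕ) (k l : ℕ) : Prop :=
  ∃ S ⊆ L.toFinset, (S.filter fun e => c e = 1).card = k ∧ (S.filter fun e => c e = 2).card = l ∧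
    ∀ w < n, (S.filter fun e => u e = w ∨ v e = w).card = b w

def redBlueTable (n : ℕ) (L : List ε) (b : ℕ → ℕ) (u v c : ε → ℕ) (k l : ℕ) : List (List ℕ) :=
  [k, l] :: (List.range n).map b :: L.map fun e => [u e, v e, c e]

theorem redBlue_yes_iff {n : ℕ} {L : List ε} (hL : L.Nodup) {b : ℕ → ℕ} {u v c : ε → ℕ} {k l : ℕ}
    {ends : Fin L.length → Fin n × Fin n} (h₀ : ∀ e, (ends e).1 ≠ (ends e).2) {b' : Fin n → ℕ}
    {R B : Finset (Fin L.length)} (hRB : Disjoint R B) (h₁ : ∀ i, ((ends i).1 : ℕ) = u (L.get i))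
    (h₂ : ∀ i, ((ends i).2 : ℕ) = v (L.get i))
    (h₃ : ∀ i, (if i ∈ R then 1 else if i ∈ B then 2 else 0) = c (L.get i))
    (h₄ : ∀ w : Fin n, b' w = b w) :
    (RedBlueInstance.mk n L.length ends h₀ b' R B hRB k l).Yes ↔
      HasBMatching n L b u v c k l := by
  unfold HasBMatching
  rw [← exists_finset_get hL (Q := fun S => (S.filter fun e => c e = 1).card = k ∧
    (S.filter fun e => c e = 2).card = l ∧
    ∀ w < n, (S.filter fun e => u e = w ∨ v e = w).card = b w)]
  refine exists_congr fun E => ?_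
  dsimp only
  simp only [card_filter_map_listEmb hL]
  have e1 : E ∩ R = E.filter fun i => c (L.get i) = 1 := by
    ext i
    rw [mem_inter, mem_filter, ← h₃]
    split_ifs <;> simp_all
  have e2 : E ∩ B = E.filter fun i => c (L.get i) = 2 := by
    ext i
    rw [mem_inter, mem_filter, ← h₃]
    have : i ∈ R → i ∉ B := fun h h' => disjoint_left.1 hRB h h'
    split_ifs <;> simp_all
  rw [e1, e2]
  refine and_congr Iff.rfl (and_congr Iff.rfl ?_)
  constructor
  · intro h w hw
    rw [← h₄ ⟨w, hw⟩, ← h ⟨w, hw⟩]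
    congr 1
    ext i
    rw [mem_filter, mem_filter, ← h₁, ← h₂, Fin.ext_iff, Fin.ext_iff]
  · intro h w
    rw [h₄ w, ← h w w.2]
    congr 1
    ext i
    rw [mem_filter, mem_filter, ← h₁, ← h₂, Fin.ext_iff, Fin.ext_iff]

theorem mem_exactRedBluePerfectBMatching {n : ℕ} {L : List ε} (hL : L.Nodup) {b : ℕ → ℕ}
    {u v c : ε → ℕ} {k l : ℕ} :
    encodeTable (redBlueTable n L b u v c k l) ∈ exactRedBluePerfectBMatching ↔
      (∀ e ∈ L, u e < n ∧ v e < n ∧ u e ≠ v e ∧ c e ≤ 2) ∧ HasBMatching n L b u v c k l := by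
  constructor
  · rintro ⟨⟨n', m, ends, h₀, b', R, B, hRB, k', l'⟩, h1, h2⟩
    have t := encodeTable_injective h2
    simp only [redBlueTable, List.cons.injEq, and_true] at t
    obtain ⟨⟨rfl, rfl⟩, t, h3⟩ := t
    have hn : n' = n := by simpa using congrArg List.length t
    subst hn
    have hm : m = L.length := by simpa using congrArg List.length h3
    subst hm
    rw [ofFn_eq_map_range] at t
    rw [ofFn_eq_map] at h3
    simp only [List.cons.injEq, and_true] at h3
    refine ⟨fun e he => ?_, (redBlue_yes_iff hL h₀ hRB (fun i => (h3 i).1) (fun i => (h3 i).2.1)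
      (fun i => (h3 i).2.2) t).1 h1⟩
    obtain ⟨i, rfl⟩ := List.mem_iff_get.1 he
    obtain ⟨e1, e2, e3⟩ := h3 i
    rw [← e1, ← e2, ← e3]
    refine ⟨Fin.is_lt _, Fin.is_lt _, fun h => h₀ i (Fin.ext h), by split_ifs <;> omega⟩
  · rintro ⟨h1, h2⟩
    let ends : Fin L.length → Fin n × Fin n := fun i =>
      (⟨u (L.get i), (h1 _ (List.get_mem L i)).1⟩, ⟨v (L.get i), (h1 _ (List.get_mem L i)).2.1⟩)
    have h₀ : ∀ e, (ends e).1 ≠ (ends e).2 := fun i h =>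
      (h1 _ (List.get_mem L i)).2.2.1 (congrArg Fin.val h)
    have hRB : Disjoint (univ.filter fun i => c (L.get i) = 1)
        (univ.filter fun i => c (L.get i) = 2) := by
      rw [disjoint_filter]; intro i _ h; omega
    have h₃ : ∀ i, (if i ∈ (univ.filter fun i => c (L.get i) = 1) then 1 else
        if i ∈ (univ.filter fun i => c (L.get i) = 2) then 2 else 0) = c (L.get i) := by
      intro i
      have := (h1 _ (List.get_mem L i)).2.2.2
      simp only [mem_filter, mem_univ, true_and]
      split_ifs <;> omega
    refine ⟨⟨n, L.length, ends, h₀, fun w => b w, _, _, hRB, k, l⟩,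
      (redBlue_yes_iff hL h₀ hRB (fun i => rfl) (fun i => rfl) h₃ fun w => rfl).2 h2, ?_⟩
    refine congrArg encodeTable ?_
    simp only [redBlueTable, List.cons.injEq, true_and]
    refine ⟨(ofFn_eq_map_range _ _).2 fun w => rfl, (ofFn_eq_map _ _ _).2 fun i => ?_⟩
    simp only [List.cons.injEq, and_true]
    exact ⟨rfl, rfl, h₃ i⟩

end RedBlue

/-! ## Control by replacing voters for 2-Approval -/

section Control

def IsRanking (m : ℕ) (w : ℕ → ℕ) : Prop :=
  ∀ j < m, w j < m ∧ ∀ j' < m, w j = w j' → j = j'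

/-- The candidate `c` is among the first two. -/
def Approves (m : ℕ) (w : ℕ → ℕ) (c : ℕ) : Prop := w 0 = c ∨ (1 < m ∧ w 1 = c)

instance (m : ℕ) (w : ℕ → ℕ) (c : ℕ) : Decidable (Approves m w c) := by
  unfold Approves; infer_instance

variable {α β : Type} [DecidableEq α] [DecidableEq β]

/-- The voters in `A` are kept and those in `B` are added such that `p` wins. -/
def HasControl (m : ℕ) (p k : ℕ) (L : List α) (L' : List β) (w : α → ℕ → ℕ) (w' : β → ℕ → ℕ) :
    Prop :=
  ∃ A ⊆ L.toFinset, ∃ B ⊆ L'.toFinset, A.card + k = L.length ∧ B.card = k ∧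
    ∀ c < m, (A.filter fun e => Approves m (w e) c).card +
      (B.filter fun e => Approves m (w' e) c).card ≤
      (A.filter fun e => Approves m (w e) p).card + (B.filter fun e => Approves m (w' e) p).card

def controlTable (m : ℕ) (p k : ℕ) (L : List α) (L' : List β) (w : α → ℕ → ℕ) (w' : β → ℕ → ℕ) :
    List (List ℕ) :=
  [p, k] :: List.range m :: ((L.map fun e => 0 :: (List.range m).map (w e)) ++
    L'.map fun e => 1 :: (List.range m).map (w' e))

theorem twoApproval_symm {m : ℕ} (σ : Vote m) {w : ℕ → ℕ} (h : ∀ j : Fin m, (σ j : ℕ) = w j)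
    (c : Fin m) : twoApproval m (σ.symm c) = if Approves m w c then 1 else 0 := by
  have hm : 0 < m := c.pos
  have : ((σ.symm c : Fin m) : ℕ) < 2 ↔ Approves m w c := by
    constructor
    · intro h2
      have hc := h (σ.symm c)
      rw [Equiv.apply_symm_apply] at hc
      rcases Nat.lt_succ_iff_lt_or_eq.1 h2 with h3 | h3
      · left; rw [hc]; congr 1; omega
      · right; exact ⟨h3 ▸ (σ.symm c).2, by rw [hc, h3]⟩
    · rintro (h1 | ⟨h0, h1⟩)
      · have : σ ⟨0, hm⟩ = c := Fin.ext ((h _).trans h1)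
        rw [← this]; simp
      · have : σ ⟨1, h0⟩ = c := Fin.ext ((h _).trans h1)
        rw [← this]; simp
  unfold twoApproval
  simp only [this]

theorem control_yes_iff {m p' k : ℕ} {L : List α} {L' : List β} (hL : L.Nodup) (hL' : L'.Nodup)
    {w : α → ℕ → ℕ} {w' : β → ℕ → ℕ} {V : Fin L.length → Vote m} {W : Fin L'.length → Vote m}
    {p : Fin m} (hp : (p : ℕ) = p') (hV : ∀ i (j : Fin m), (V i j : ℕ) = w (L.get i) j)
    (hW : ∀ i (j : Fin m), (W i j : ℕ) = w' (L'.get i) j) :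
    (ReplacingInstance.mk m L.length L'.length V W p k).YesExact twoApproval ↔
      HasControl m p' k L L' w w' := by
  have hscore : ∀ (A : Finset (Fin L.length)) (B : Finset (Fin L'.length)) (c : Fin m),
      score twoApproval (Sum.elim V W) (A.disjSum B) c =
        (((A.map (listEmb hL)).filter fun e => Approves m (w e) c).card +
          ((B.map (listEmb hL')).filter fun e => Approves m (w' e) c).card : ℕ) := by
    intro A B c
    unfold score
    rw [sum_disjSum]
    simp only [Sum.elim_inl, Sum.elim_inr, twoApproval_symm _ (hV _), twoApproval_symm _ (hW _)]
    rw [card_filter_map_listEmb, card_filter_map_listEmb, card_filter, card_filter]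
    push_cast
    rfl
  subst hp
  constructor
  · rintro ⟨V₀, W₀, h1, h2, h3⟩
    dsimp only at h1 h2 h3
    refine ⟨(univ \ V₀).map (listEmb hL), ?_, W₀.map (listEmb hL'), ?_, ?_, ?_, ?_⟩
    · rw [← map_listEmb_univ hL]; exact map_subset_map.2 (subset_univ _)
    · rw [← map_listEmb_univ hL']; exact map_subset_map.2 (subset_univ _)
    · rw [card_map, card_sdiff_of_subset (subset_univ _), h1, card_univ, Fintype.card_fin]
      have : V₀.card ≤ L.length := by simpa using card_le_univ V₀
      change L.length - k + k = L.length
      omega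
    · rw [card_map, h2]
    · intro c hc
      have := h3 ⟨c, hc⟩
      rw [hscore, hscore] at this
      exact_mod_cast this
  · rintro ⟨A, hA, B, hB, h1, h2, h3⟩
    rw [← map_listEmb_univ hL] at hA
    rw [← map_listEmb_univ hL'] at hB
    obtain ⟨A, -, rfl⟩ := subset_map_iff.1 hA
    obtain ⟨B, -, rfl⟩ := subset_map_iff.1 hB
    rw [card_map] at h1 h2
    refine ⟨univ \ A, B, ?_, h2, fun c => ?_⟩
    · rw [card_sdiff_of_subset (subset_univ _), card_univ, Fintype.card_fin]
      change L.length - A.card = k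
      omega
    · dsimp only at c ⊢
      rw [Finset.sdiff_sdiff_eq_self (subset_univ A), hscore, hscore]
      exact_mod_cast h3 c c.2

/-- Serves to separate the rows of registered voters from those of unregistered voters, which differ
in their leading number. -/
theorem append_eq_append_of_forall {δ : Type} (P : δ → Bool) {a b c d : List δ}
    (h : a ++ b = c ++ d) (ha : ∀ x ∈ a, P x) (hb : ∀ x ∈ b, ¬ P x) (hc : ∀ x ∈ c, P x)
    (hd : ∀ x ∈ d, ¬ P x) : a = c ∧ b = d := by
  have h1 := congrArg (List.filter P) h
  rw [List.filter_append, List.filter_append, List.filter_eq_self.2 ha, List.filter_eq_self.2 hc,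
    List.filter_eq_nil_iff.2 hb, List.filter_eq_nil_iff.2 hd, List.append_nil,
    List.append_nil] at h1
  subst h1
  exact ⟨rfl, List.append_cancel_left h⟩

theorem mem_ccrvExact {m p k : ℕ} {L : List α} {L' : List β} (hL : L.Nodup) (hL' : L'.Nodup)
    {w : α → ℕ → ℕ} {w' : β → ℕ → ℕ} :
    encodeTable (controlTable m p k L L' w w') ∈ ccrvExact twoApproval ↔
      (p < m ∧ (∀ e ∈ L, IsRanking m (w e)) ∧ ∀ e ∈ L', IsRanking m (w' e)) ∧
        HasControl m p k L L' w w' := by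
  constructor
  · rintro ⟨⟨m', r, s, V, W, p', k'⟩, h1, h2⟩
    have t := encodeTable_injective h2
    simp only [controlTable, List.cons.injEq, and_true] at t
    obtain ⟨⟨hp, rfl⟩, t, h3⟩ := t
    have hm : m' = m := by simpa using congrArg List.length t
    subst hm
    obtain ⟨h4, h5⟩ := append_eq_append_of_forall (fun l => decide (l.head? = some 0)) h3
      (by simp) (by simp) (by simp) (by simp)
    have hr : r = L.length := by simpa using congrArg List.length h4
    have hs : s = L'.length := by simpa using congrArg List.length h5
    subst hr hs
    rw [ofFn_eq_map] at h4 h5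
    simp only [List.cons.injEq, true_and, ofFn_eq_map_range] at h4 h5
    refine ⟨⟨hp ▸ p'.2, ?_, ?_⟩, (control_yes_iff hL hL' hp h4 h5).1 h1⟩
    · intro e he
      obtain ⟨i, rfl⟩ := List.mem_iff_get.1 he
      intro j hj
      have := h4 i ⟨j, hj⟩
      dsimp only at this
      rw [← this]
      refine ⟨Fin.is_lt _, fun j' hj' h => ?_⟩
      rw [← h4 i ⟨j', hj'⟩] at h
      simpa using (V i).injective (Fin.ext h)
    · intro e he
      obtain ⟨i, rfl⟩ := List.mem_iff_get.1 he
      intro j hj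
      have := h5 i ⟨j, hj⟩
      dsimp only at this
      rw [← this]
      refine ⟨Fin.is_lt _, fun j' hj' h => ?_⟩
      rw [← h5 i ⟨j', hj'⟩] at h
      simpa using (W i).injective (Fin.ext h)
  · rintro ⟨⟨hp, h1, h2⟩, h3⟩
    have key : ∀ w : ℕ → ℕ, IsRanking m w → ∃ σ : Vote m, ∀ j : Fin m, (σ j : ℕ) = w j := by
      intro w hw
      refine ⟨Equiv.ofBijective (fun j => ⟨w j, (hw j j.2).1⟩)
        (Finite.injective_iff_bijective.1 fun i j h => ?_), fun j => rfl⟩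
      exact Fin.ext ((hw i i.2).2 j j.2 (congrArg Fin.val h))
    choose V hV using fun i : Fin L.length => key _ (h1 _ (List.get_mem L i))
    choose W hW using fun i : Fin L'.length => key _ (h2 _ (List.get_mem L' i))
    refine ⟨⟨m, L.length, L'.length, V, W, ⟨p, hp⟩, k⟩,
      (control_yes_iff hL hL' rfl hV hW).2 h3, congrArg encodeTable ?_⟩
    simp only [controlTable, List.cons.injEq, true_and]
    congr 1
    · simpa [ofFn_eq_map, ofFn_eq_map_range] using hV
    · simpa [ofFn_eq_map, ofFn_eq_map_range] using hW

end Control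

end Logspace

/-! ### The four problems as conditions on words. -/

namespace Logspace

open Finset

/-! ## Instances as words -/

section

variable {γ : Type} [Ctx γ]

theorem table_ext {T T' : List (List ℕ)} (h : T.length = T'.length)
    (h₁ : ∀ i < T.length, (T.getD i []).length = (T'.getD i []).length)
    (h₂ : ∀ i < T.length, ∀ j < (T.getD i []).length, tableAt T i j = tableAt T' i j) :
    T = T' := by
  refine List.ext_getElem h fun i hi hi' => ?_
  have e1 := h₁ i hi
  have e2 := h₂ i hi
  simp only [tableAt, List.getD_eq_getElem _ _ hi, List.getD_eq_getElem _ _ hi'] at e1 e2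
  refine list_eq_of_getD e1 fun j => ?_
  by_cases hj : j < T[i].length
  · exact e2 j hj
  · rw [List.getD_eq_default _ _ (by omega), List.getD_eq_default _ _ (by omega)]

theorem getD_map_range {β : Type} {n i : ℕ} (f : ℕ → β) (d : β) (h : i < n) :
    ((List.range n).map f).getD i d = f i := by
  rw [List.getD_eq_getElem _ _ (by simpa using h)]; simp

theorem entry_eq_of_lt {T : List (List ℕ)} {i j : ℕ}
    (h : entry (encodeTable T) i j < cap (encodeTable T)) :
    entry (encodeTable T) i j = tableAt T i j := by
  rw [entry_encodeTable] at h ⊢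
  omega

theorem length_lt_cap (x : Word) : x.length < cap x := by unfold cap; omega

theorem two_lt_cap (x : Word) : 2 < cap x := by unfold cap; omega

/-! ### Matchings -/

def colorAt (x : Word) (u v : ℕ) : ℕ := entry x (u + 1) v

theorem LogFn.colorAt {f g : γ → ℕ} (hf : LogFn f) (hg : LogFn g) :
    LogFn fun c : γ => colorAt (Ctx.word c) (f c) (g c) := LogFn.entry hf.succ hg

def order (x : Word) : ℕ := numRows x - 1

theorem LogFn.order : LogFn fun c : γ => order (Ctx.word c) := LogFn.numRows.pred

/-- The word encodes a graph with red edges and a number. -/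
def IsMatchingWord (x : Word) : Prop :=
  (IsTable x ∧ numRows x ≠ 0 ∧ rowLen x 0 = 1 ∧ ∀ i < order x, rowLen x (i + 1) = order x) ∧
    ∀ i < order x, colorAt x i i = 0 ∧
      ∀ j < order x, colorAt x i j ≤ 2 ∧ colorAt x i j = colorAt x j i

theorem LogPred.isMatchingWord : LogPred fun c : γ => IsMatchingWord (Ctx.word c) := by
  refine (LogPred.isTable.and ((LogPred.ne LogFn.numRows (LogFn.const 0)).and
    ((LogPred.eq (LogFn.const 0).rowLen (LogFn.const 1)).and ?_))).and ?_
  · exact LogPred.all LogFn.order (LogPred.eq LogFn.v0.succ.rowLen LogFn.order)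
  · exact LogPred.all LogFn.order ((LogPred.eq (LogFn.v0.colorAt LogFn.v0) (LogFn.const 0)).and
      (LogPred.all LogFn.order ((LogPred.le (LogFn.v1.colorAt LogFn.v0) (LogFn.const 2)).and
        (LogPred.eq (LogFn.v1.colorAt LogFn.v0) (LogFn.v0.colorAt LogFn.v1)))))

theorem IsMatchingWord.isColoring {x : Word} (h : IsMatchingWord x) :
    IsColoring (List.range (order x)) (colorAt x) := by
  simpa only [IsColoring, List.mem_range] using h.2

/-- Matrix entries are at most `2`, which is below the cutoff, so they are read exactly. Only the
number of red edges asked for may be truncated, hence the existential quantifier over `k`. -/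
theorem IsMatchingWord.exists_eq {x : Word} (h : IsMatchingWord x) :
    ∃ k, min k (cap x) = entry x 0 0 ∧
      encodeTable (matrixTable (List.range (order x)) (colorAt x) k) = x := by
  obtain ⟨⟨h0, h1, h2, h3⟩, h4⟩ := h
  obtain ⟨T, rfl⟩ := h0.exists_eq
  refine ⟨tableAt T 0 0, (entry_encodeTable T 0 0).symm, congrArg encodeTable ?_⟩
  rw [rowLen_encodeTable] at h2
  simp only [rowLen_encodeTable] at h3
  have hT : order (encodeTable T) + 1 = T.length := by
    unfold order
    rw [numRows_encodeTable] at h1 ⊢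
    omega
  refine (table_ext ?_ ?_ ?_).symm
  · simp [matrixTable, hT]
  · rintro (_ | i) hi
    · simpa [matrixTable] using h2
    · rw [h3 i (by omega), matrixTable, List.getD_cons_succ, getD_map_range _ _ (by omega)]
      simp
  · rintro (_ | i) hi j hj
    · rw [h2] at hj
      obtain rfl : j = 0 := by omega
      simp [tableAt, matrixTable]
    · rw [h3 i (by omega)] at hj
      rw [tableAt, tableAt, matrixTable, List.getD_cons_succ, getD_map_range _ _ (by omega),
        getD_map_range _ _ hj, colorAt, entry_eq_of_lt]
      · rfl
      · exact (((h4 i (by omega)).2 j hj).1).trans_lt (two_lt_cap _)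

theorem HasMatching.two_mul_le {α : Type} [DecidableEq α] {L : List α} {ent : α → α → ℕ} {k : ℕ}
    (h : HasMatching L ent k) : 2 * k ≤ L.length := by
  obtain ⟨f, -, h⟩ := h
  rw [← h]
  exact (card_filter_le _ _).trans (List.toFinset_card_le _)

theorem order_le (x : Word) : order x ≤ x.length := (Nat.sub_le _ _).trans (numRows_le x)

/-- A matching forces `2 * k ≤ order x`, which is below the cutoff. So truncation either leaves `k`
unchanged or replaces one impossible value by another. -/
theorem IsMatchingWord.hasMatching_iff {x : Word} {k : ℕ} (h : min k (cap x) = entry x 0 0) :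
    HasMatching (List.range (order x)) (colorAt x) k ↔
      HasMatching (List.range (order x)) (colorAt x) (entry x 0 0) := by
  have h1 := length_lt_cap x
  have h2 := order_le x
  constructor <;> intro h3
  · have := h3.two_mul_le
    rw [List.length_range] at this
    rwa [← h, min_eq_left (by omega)]
  · have := h3.two_mul_le
    rw [List.length_range] at this
    rwa [show k = entry x 0 0 by omega]

theorem isMatchingWord_encode (I : MatchingInstance) : IsMatchingWord I.encode := by
  have h0 : order I.encode = I.n := by
    simp [order, MatchingInstance.encode, numRows_encodeTable]
  have h1 : ∀ u v : Fin I.n, colorAt I.encode u v = I.entry u v := by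
    intro u v
    have h2 := entry_le_two I u v
    have h3 := two_lt_cap I.encode
    unfold colorAt MatchingInstance.encode at *
    rw [entry_encodeTable]
    have : tableAt ([I.k] :: List.ofFn fun u => List.ofFn fun v => I.entry u v) (u + 1) v =
        I.entry u v := by simp [tableAt]
    rw [this]
    omega
  refine ⟨⟨isTable_encodeTable _, ?_, ?_, ?_⟩, ?_⟩
  · simp [MatchingInstance.encode, numRows_encodeTable]
  · simp [MatchingInstance.encode, rowLen_encodeTable]
  · intro i hi
    rw [h0] at hi ⊢
    simp [MatchingInstance.encode, rowLen_encodeTable, hi]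
  · intro i hi
    rw [h0] at hi ⊢
    refine ⟨(h1 ⟨i, hi⟩ ⟨i, hi⟩).trans (entry_self I _), fun j hj => ?_⟩
    rw [h1 ⟨i, hi⟩ ⟨j, hj⟩, h1 ⟨j, hj⟩ ⟨i, hi⟩]
    exact ⟨entry_le_two I _ _, entry_symm I _ _⟩

theorem mem_exactPerfectMatching_iff {x : Word} : x ∈ exactPerfectMatching ↔
    IsMatchingWord x ∧ HasMatching (List.range (order x)) (colorAt x) (entry x 0 0) := by
  have key : IsMatchingWord x → (x ∈ exactPerfectMatching ↔
      HasMatching (List.range (order x)) (colorAt x) (entry x 0 0)) := by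
    intro h
    obtain ⟨k, hk, e⟩ := h.exists_eq
    conv_lhs => rw [← e]
    rw [mem_exactPerfectMatching List.nodup_range, IsMatchingWord.hasMatching_iff hk]
    exact and_iff_right h.isColoring
  constructor
  · intro h
    have hx : IsMatchingWord x := by
      obtain ⟨I, -, rfl⟩ := h
      exact isMatchingWord_encode I
    exact ⟨hx, (key hx).1 h⟩
  · rintro ⟨hx, h⟩
    exact (key hx).2 h

theorem mem_restrictedExactPerfectMatching_iff {x : Word} : x ∈ restrictedExactPerfectMatching ↔
    IsMatchingWord x ∧ HasMatching (List.range (order x)) (colorAt x) (entry x 0 0) ∧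
      ((range (order x) ×ˢ range (order x)).filter fun p => colorAt x p.1 p.2 = 2).card =
        order x := by
  have key : IsMatchingWord x → (x ∈ restrictedExactPerfectMatching ↔
      HasMatching (List.range (order x)) (colorAt x) (entry x 0 0) ∧
      ((range (order x) ×ˢ range (order x)).filter fun p => colorAt x p.1 p.2 = 2).card =
        order x) := by
    intro h
    obtain ⟨k, hk, e⟩ := h.exists_eq
    conv_lhs => rw [← e]
    rw [mem_restrictedExactPerfectMatching List.nodup_range, IsMatchingWord.hasMatching_iff hk,
      and_iff_right h.isColoring, List.toFinset_range, List.length_range]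
  constructor
  · intro h
    have hx : IsMatchingWord x := by
      obtain ⟨I, -, -, rfl⟩ := h
      exact isMatchingWord_encode I
    exact ⟨hx, (key hx).1 h⟩
  · rintro ⟨hx, h⟩
    exact (key hx).2 h

/-! ### Red-blue `b`-matchings -/

def edgeAt (x : Word) (j e : ℕ) : ℕ := entry x (e + 2) j

theorem LogFn.edgeAt (j : ℕ) {f : γ → ℕ} (hf : LogFn f) :
    LogFn fun c : γ => edgeAt (Ctx.word c) j (f c) := LogFn.entry hf.succ.succ (LogFn.const j)

def size (x : Word) : ℕ := numRows x - 2

theorem LogFn.size : LogFn fun c : γ => size (Ctx.word c) := LogFn.numRows.sub (LogFn.const 2)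

def width (x : Word) : ℕ := rowLen x 1

theorem LogFn.width : LogFn fun c : γ => width (Ctx.word c) := (LogFn.const 1).rowLen

/-- The word encodes a multigraph with red and blue edges, capacities and two numbers. -/
def IsRedBlueWord (x : Word) : Prop :=
  (IsTable x ∧ 2 ≤ numRows x ∧ rowLen x 0 = 2 ∧ ∀ e < size x, rowLen x (e + 2) = 3) ∧
    ∀ e < size x, edgeAt x 0 e < width x ∧ edgeAt x 1 e < width x ∧ edgeAt x 0 e ≠ edgeAt x 1 e ∧
      edgeAt x 2 e ≤ 2

theorem LogPred.isRedBlueWord : LogPred fun c : γ => IsRedBlueWord (Ctx.word c) := by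
  refine (LogPred.isTable.and ((LogPred.le (LogFn.const 2) LogFn.numRows).and
    ((LogPred.eq (LogFn.const 0).rowLen (LogFn.const 2)).and ?_))).and ?_
  · exact LogPred.all LogFn.size (LogPred.eq LogFn.v0.succ.succ.rowLen (LogFn.const 3))
  · exact LogPred.all LogFn.size ((LogPred.lt (LogFn.edgeAt 0 LogFn.v0) LogFn.width).and
      ((LogPred.lt (LogFn.edgeAt 1 LogFn.v0) LogFn.width).and
      ((LogPred.ne (LogFn.edgeAt 0 LogFn.v0) (LogFn.edgeAt 1 LogFn.v0)).and
      (LogPred.le (LogFn.edgeAt 2 LogFn.v0) (LogFn.const 2)))))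

theorem IsRedBlueWord.exists_eq {x : Word} (h : IsRedBlueWord x) :
    ∃ (b : ℕ → ℕ) (k l : ℕ), (∀ v, min (b v) (cap x) = entry x 1 v) ∧
      min k (cap x) = entry x 0 0 ∧ min l (cap x) = entry x 0 1 ∧
      encodeTable (redBlueTable (width x) (List.range (size x)) b (edgeAt x 0) (edgeAt x 1)
        (edgeAt x 2) k l) = x := by
  obtain ⟨⟨h0, h1, h2, h3⟩, h4⟩ := h
  obtain ⟨T, rfl⟩ := h0.exists_eq
  refine ⟨tableAt T 1, tableAt T 0 0, tableAt T 0 1, fun v => (entry_encodeTable T 1 v).symm,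
    (entry_encodeTable T 0 0).symm, (entry_encodeTable T 0 1).symm, congrArg encodeTable ?_⟩
  rw [rowLen_encodeTable] at h2
  simp only [rowLen_encodeTable] at h3
  have hw : width (encodeTable T) = (T.getD 1 []).length := rowLen_encodeTable T 1
  have hT : size (encodeTable T) + 2 = T.length := by
    unfold size
    rw [numRows_encodeTable] at h1 ⊢
    omega
  have hlt := (rowLen_le (encodeTable T) 1).trans_lt (length_lt_cap _)
  refine (table_ext ?_ ?_ ?_).symm
  · simp [redBlueTable, hT]
  · rintro (_ | _ | i) hi
    · simpa [redBlueTable] using h2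
    · simp [redBlueTable, hw]
    · rw [h3 i (by omega), redBlueTable, List.getD_cons_succ, List.getD_cons_succ,
        getD_map_range _ _ (by omega)]
      simp
  · rintro (_ | _ | i) hi j hj
    · rw [h2] at hj
      rcases j with _ | _ | j
      · simp [tableAt, redBlueTable]
      · simp [tableAt, redBlueTable]
      · omega
    · rw [zero_add] at hj
      simp only [redBlueTable]
      rw [hw, zero_add]
      conv_rhs => rw [tableAt, List.getD_cons_succ, List.getD_cons_zero, getD_map_range _ _ hj]
    · rw [h3 i (by omega)] at hj
      obtain ⟨e1, e2, -, e3⟩ := h4 i (by omega)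
      have e4 := two_lt_cap (encodeTable T)
      have key : ∀ j, edgeAt (encodeTable T) j i < cap (encodeTable T) →
          edgeAt (encodeTable T) j i = tableAt T (i + 2) j := fun j h => entry_eq_of_lt h
      conv_rhs => rw [tableAt, redBlueTable, List.getD_cons_succ, List.getD_cons_succ,
        getD_map_range _ _ (by omega)]
      rcases j with _ | _ | _ | j
      · exact (key 0 (e1.trans hlt)).symm
      · exact (key 1 (e2.trans hlt)).symm
      · exact (key 2 (by omega)).symm
      · omega

theorem isRedBlueWord_encode (I : RedBlueInstance) : IsRedBlueWord I.encode := by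
  have h0 : size I.encode = I.m := by
    simp [size, RedBlueInstance.encode, numRows_encodeTable]
  have hw : width I.encode = I.n := by
    simp [width, RedBlueInstance.encode, rowLen_encodeTable]
  have hlt := (rowLen_le I.encode 1).trans_lt (length_lt_cap _)
  change width _ < _ at hlt
  rw [hw] at hlt
  have e0 := two_lt_cap I.encode
  have key : ∀ (e : Fin I.m) (j : ℕ), edgeAt I.encode j e = min ([((I.ends e).1 : ℕ),
      ((I.ends e).2 : ℕ), if e ∈ I.R then 1 else if e ∈ I.B then 2 else 0].getD j 0)
      (cap I.encode) := by
    intro e j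
    conv_lhs => rw [edgeAt, RedBlueInstance.encode, entry_encodeTable, tableAt]
    rw [List.getD_cons_succ, List.getD_cons_succ, List.getD_eq_getElem _ [] (by simp)]
    simp only [List.getElem_ofFn]
    rfl
  refine ⟨⟨isTable_encodeTable _, ?_, ?_, ?_⟩, ?_⟩
  · simp [RedBlueInstance.encode, numRows_encodeTable]
  · simp [RedBlueInstance.encode, rowLen_encodeTable]
  · intro i hi
    rw [h0] at hi
    simp [RedBlueInstance.encode, rowLen_encodeTable, hi]
  · intro i hi
    rw [h0] at hi
    rw [hw]
    have k0 := key ⟨i, hi⟩ 0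
    have k1 := key ⟨i, hi⟩ 1
    have k2 := key ⟨i, hi⟩ 2
    simp only [List.getD_cons_zero, List.getD_cons_succ] at k0 k1 k2
    have a1 := (I.ends ⟨i, hi⟩).1.2
    have a2 := (I.ends ⟨i, hi⟩).2.2
    have a3 := I.loopless ⟨i, hi⟩
    rw [Ne, Fin.ext_iff] at a3
    rw [min_eq_left (by omega)] at k0 k1
    rw [min_eq_left (by split_ifs <;> omega)] at k2
    rw [k0, k1, k2]
    refine ⟨a1, a2, a3, by split_ifs <;> omega⟩

/-- All numbers compared with `b`, `k` and `l` count edges, of which there are fewer than `cap x`;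
truncated and full values are therefore met by the same sets of edges. -/
theorem HasBMatching.cap_iff {x : Word} {n : ℕ} {b b' u v c : ℕ → ℕ} {k l k' l' : ℕ}
    (hb : ∀ w, min (b w) (cap x) = b' w) (hk : min k (cap x) = k') (hl : min l (cap x) = l') :
    HasBMatching n (List.range (size x)) b u v c k l ↔
      HasBMatching n (List.range (size x)) b' u v c k' l' := by
  have h0 : size x < cap x :=
    ((Nat.sub_le _ _).trans (numRows_le x)).trans_lt (length_lt_cap x)
  unfold HasBMatching
  refine exists_congr fun S => and_congr_right fun hS => ?_
  have hS : ∀ P : ℕ → Prop, ∀ [DecidablePred P], (S.filter P).card < cap x := by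
    intro P _
    refine ((card_filter_le _ _).trans (card_le_card hS)).trans_lt ?_
    rwa [List.toFinset_range, card_range]
  have key : ∀ {P : ℕ → Prop} [DecidablePred P] {a a' : ℕ}, min a (cap x) = a' →
      ((S.filter P).card = a ↔ (S.filter P).card = a') := by
    intro P _ a a' h
    have := hS P
    omega
  rw [key hk, key hl]
  refine and_congr Iff.rfl (and_congr Iff.rfl (forall_congr' fun w => ?_))
  rw [key (hb w)]

theorem mem_exactRedBluePerfectBMatching_iff {x : Word} : x ∈ exactRedBluePerfectBMatching ↔
    IsRedBlueWord x ∧ HasBMatching (width x) (List.range (size x)) (entry x 1) (edgeAt x 0)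
      (edgeAt x 1) (edgeAt x 2) (entry x 0 0) (entry x 0 1) := by
  have key : IsRedBlueWord x → (x ∈ exactRedBluePerfectBMatching ↔
      HasBMatching (width x) (List.range (size x)) (entry x 1) (edgeAt x 0)
      (edgeAt x 1) (edgeAt x 2) (entry x 0 0) (entry x 0 1)) := by
    intro h
    obtain ⟨b, k, l, hb, hk, hl, e⟩ := h.exists_eq
    conv_lhs => rw [← e]
    rw [mem_exactRedBluePerfectBMatching List.nodup_range, HasBMatching.cap_iff hb hk hl]
    exact and_iff_right fun e he => h.2 e (List.mem_range.1 he)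
  constructor
  · intro h
    have hx : IsRedBlueWord x := by
      obtain ⟨I, -, rfl⟩ := h
      exact isRedBlueWord_encode I
    exact ⟨hx, (key hx).1 h⟩
  · rintro ⟨hx, h⟩
    exact (key hx).2 h

/-! ### Control instances -/

/-- Voters start in row `2`, and column `0` of each of these rows tells registered from unregistered
voters. -/
def voteAt (x : Word) (i j : ℕ) : ℕ := entry x (i + 2) (j + 1)

theorem LogFn.voteAt {f g : γ → ℕ} (hf : LogFn f) (hg : LogFn g) :
    LogFn fun c : γ => voteAt (Ctx.word c) (f c) (g c) := LogFn.entry hf.succ.succ hg.succ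

/-- The number of registered voters. -/
def numReg (x : Word) : ℕ := ((range (size x)).filter fun i => entry x (i + 2) 0 = 0).card

theorem LogFn.numReg : LogFn fun c : γ => numReg (Ctx.word c) :=
  LogFn.count LogFn.size
    (LogPred.eq (LogFn.entry LogFn.v0.succ.succ (LogFn.const 0)) (LogFn.const 0))

/-- The number of unregistered voters. -/
def numUnreg (x : Word) : ℕ := size x - numReg x

theorem LogFn.numUnreg : LogFn fun c : γ => numUnreg (Ctx.word c) := LogFn.size.sub LogFn.numReg

theorem numReg_add_numUnreg (x : Word) : numReg x + numUnreg x = size x := by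
  have : numReg x ≤ size x := (card_filter_le _ _).trans (card_range _).le
  unfold numUnreg
  omega

/-- The word encodes an election with unregistered voters and a number. -/
def IsControlWord (x : Word) : Prop :=
  (IsTable x ∧ 2 ≤ numRows x ∧ rowLen x 0 = 2 ∧ ∀ i < size x, rowLen x (i + 2) = width x + 1) ∧
    entry x 0 0 < width x ∧ (∀ j < width x, entry x 1 j = j) ∧
    (∀ i < size x, entry x (i + 2) 0 = if i < numReg x then 0 else 1) ∧
    ∀ i < size x, IsRanking (width x) (voteAt x i)

theorem LogPred.isControlWord : LogPred fun c : γ => IsControlWord (Ctx.word c) := by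
  refine (LogPred.isTable.and ((LogPred.le (LogFn.const 2) LogFn.numRows).and
    ((LogPred.eq (LogFn.const 0).rowLen (LogFn.const 2)).and ?_))).and
    ((LogPred.lt (LogFn.entry (LogFn.const 0) (LogFn.const 0)) LogFn.width).and (LogPred.and ?_
    (LogPred.and ?_ ?_)))
  · exact LogPred.all LogFn.size (LogPred.eq LogFn.v0.succ.succ.rowLen LogFn.width.succ)
  · exact LogPred.all LogFn.width (LogPred.eq (LogFn.entry (LogFn.const 1) LogFn.v0) LogFn.v0)
  · exact LogPred.all LogFn.size (LogPred.eq (LogFn.entry LogFn.v0.succ.succ (LogFn.const 0))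
      (LogFn.ite (LogPred.lt LogFn.v0 LogFn.numReg) (LogFn.const 0) (LogFn.const 1)))
  · exact LogPred.all LogFn.size (LogPred.all LogFn.width
      ((LogPred.lt (LogFn.v1.voteAt LogFn.v0) LogFn.width).and (LogPred.all LogFn.width
        ((LogPred.eq (LogFn.v2.voteAt LogFn.v1) (LogFn.v2.voteAt LogFn.v0)).imp
          (LogPred.eq LogFn.v1 LogFn.v0)))))

theorem controlTable_range {m p k r s : ℕ} {w w' : ℕ → ℕ → ℕ} :
    controlTable m p k (List.range r) (List.range s) w w' = [p, k] :: List.range m ::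
      (List.range (r + s)).map fun i => (if i < r then 0 else 1) ::
        (List.range m).map (if i < r then w i else w' (i - r)) := by
  unfold controlTable
  congr 2
  rw [List.range_add, List.map_append, List.map_map]
  congr 1
  · refine List.map_congr_left fun i hi => ?_
    rw [List.mem_range] at hi
    simp [hi]
  · refine List.map_congr_left fun i hi => ?_
    simp

theorem IsControlWord.exists_eq {x : Word} (h : IsControlWord x) :
    ∃ k : ℕ, min k (cap x) = entry x 0 1 ∧
      encodeTable (controlTable (width x) (entry x 0 0) k (List.range (numReg x))
        (List.range (numUnreg x)) (voteAt x) fun i => voteAt x (numReg x + i)) = x := by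
  obtain ⟨⟨h0, h1, h2, h3⟩, h4, h5, h6, h7⟩ := h
  obtain ⟨T, rfl⟩ := h0.exists_eq
  refine ⟨tableAt T 0 1, (entry_encodeTable T 0 1).symm, congrArg encodeTable ?_⟩
  rw [controlTable_range, numReg_add_numUnreg]
  rw [rowLen_encodeTable] at h2
  simp only [rowLen_encodeTable] at h3
  have hw : width (encodeTable T) = (T.getD 1 []).length := rowLen_encodeTable T 1
  have hT : size (encodeTable T) + 2 = T.length := by
    unfold size
    rw [numRows_encodeTable] at h1 ⊢
    omega
  have hlt : width (encodeTable T) < cap (encodeTable T) :=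
    (rowLen_le (encodeTable T) 1).trans_lt (length_lt_cap _)
  refine (table_ext ?_ ?_ ?_).symm
  · simp [hT]
  · rintro (_ | _ | i) hi
    · simpa using h2
    · simp [hw]
    · rw [h3 i (by omega), List.getD_cons_succ, List.getD_cons_succ,
        getD_map_range _ _ (by omega)]
      simp
  · rintro (_ | _ | i) hi j hj
    · rw [h2] at hj
      rcases j with _ | _ | j
      · rw [← entry_eq_of_lt (h4.trans hlt)]
        simp [tableAt]
      · simp [tableAt]
      · omega
    · rw [zero_add, ← hw] at hj
      have := h5 j hj
      rw [zero_add, ← entry_eq_of_lt (by rw [this]; exact hj.trans hlt), this]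
      rw [tableAt, List.getD_cons_succ, List.getD_cons_zero, List.getD_eq_getElem _ _ (by simpa)]
      simp
    · rw [h3 i (by omega)] at hj
      have hi : i < size (encodeTable T) := by omega
      conv_rhs => rw [tableAt, List.getD_cons_succ, List.getD_cons_succ,
        getD_map_range _ _ (by omega)]
      have e1 := two_lt_cap (encodeTable T)
      rcases j with _ | j
      · have := h6 i hi
        rw [← entry_eq_of_lt (by rw [this]; split_ifs <;> omega), this, List.getD_cons_zero]
      · have hj : j < width (encodeTable T) := by omega
        have := h7 i hi j hj
        rw [List.getD_cons_succ, getD_map_range _ _ hj,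
          ← entry_eq_of_lt (i := i + 2) (this.1.trans hlt)]
        split_ifs with h8
        · rfl
        · rw [Nat.add_sub_of_le (by omega)]; rfl

theorem exists_vote_eq {m r : ℕ} (V : Fin r → Vote m) : ∃ w : ℕ → ℕ → ℕ,
    (∀ i < r, IsRanking m (w i)) ∧ (List.ofFn fun i => List.ofFn fun j => (V i j : ℕ)) =
      (List.range r).map fun i => (List.range m).map (w i) := by
  refine ⟨fun i j => if h : i < r ∧ j < m then V ⟨i, h.1⟩ ⟨j, h.2⟩ else 0, fun i hi j hj => ?_, ?_⟩
  · beta_reduce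
    rw [dif_pos ⟨hi, hj⟩]
    refine ⟨Fin.is_lt _, fun j' hj' h => ?_⟩
    rw [dif_pos ⟨hi, hj'⟩] at h
    simpa using (V ⟨i, hi⟩).injective (Fin.ext h)
  · refine (ofFn_eq_map_range _ _).2 fun i => (ofFn_eq_map_range _ _).2 fun j => ?_
    beta_reduce
    rw [dif_pos ⟨i.2, j.2⟩]

theorem encode_eq_controlTable (I : ReplacingInstance) : ∃ w : ℕ → ℕ → ℕ,
    (∀ i < I.r + I.s, IsRanking I.m (w i)) ∧ I.encode =
      encodeTable ([(I.p : ℕ), I.k] :: List.range I.m ::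
        (List.range (I.r + I.s)).map fun i => (if i < I.r then 0 else 1) ::
          (List.range I.m).map (w i)) := by
  obtain ⟨v, h1, h2⟩ := exists_vote_eq I.V
  obtain ⟨v', h3, h4⟩ := exists_vote_eq I.W
  refine ⟨fun i => if i < I.r then v i else v' (i - I.r), fun i hi => ?_, ?_⟩
  · beta_reduce
    split_ifs with h
    · exact h1 i h
    · exact h3 _ (by omega)
  · rw [← controlTable_range]
    refine congrArg encodeTable ?_
    have key : ∀ {r : ℕ} (a : ℕ) (f : Fin r → List ℕ),
        List.ofFn (fun i => a :: f i) = (List.ofFn f).map (a :: ·) := by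
      intro r a f
      rw [List.map_ofFn]; rfl
    rw [controlTable, key, key, h2, h4, List.map_map, List.map_map]
    rfl

theorem isControlWord_encode (I : ReplacingInstance) : IsControlWord I.encode := by
  obtain ⟨w, h1, e⟩ := encode_eq_controlTable I
  rw [e]
  clear e
  have hp := I.p.2
  generalize (I.p : ℕ) = p at *
  generalize I.m = m at *
  generalize I.r = r at *
  generalize I.s = s at *
  generalize I.k = k at *
  clear I
  generalize hT : [p, k] :: List.range m :: (List.range (r + s)).map (fun i =>
    (if i < r then 0 else 1) :: (List.range m).map (w i)) = T
  have h0 : size (encodeTable T) = r + s := by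
    simp [size, numRows_encodeTable, ← hT]
  have hw : width (encodeTable T) = m := by
    simp [width, rowLen_encodeTable, ← hT]
  have hlt : m < cap (encodeTable T) := by
    rw [← hw]
    exact (rowLen_le (encodeTable T) 1).trans_lt (length_lt_cap _)
  have e0 := two_lt_cap (encodeTable T)
  have key : ∀ i < r + s, ∀ j, entry (encodeTable T) (i + 2) j =
      min (((if i < r then 0 else 1) :: (List.range m).map (w i)).getD j 0)
        (cap (encodeTable T)) := by
    intro i hi j
    rw [entry_encodeTable, tableAt, ← hT, List.getD_cons_succ, List.getD_cons_succ,
      getD_map_range _ _ hi]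
  have key0 : ∀ i < r + s, entry (encodeTable T) (i + 2) 0 = if i < r then 0 else 1 := by
    intro i hi
    rw [key i hi, List.getD_cons_zero]
    split_ifs <;> omega
  have hr : numReg (encodeTable T) = r := by
    rw [numReg, h0]
    have : ((range (r + s)).filter fun i => entry (encodeTable T) (i + 2) 0 = 0) = range r := by
      ext i
      rw [mem_filter, mem_range, mem_range]
      constructor
      · rintro ⟨hi, h⟩
        rw [key0 i hi] at h
        by_contra h'
        simp [h'] at h
      · intro hi
        refine ⟨by omega, ?_⟩
        rw [key0 i (by omega), if_pos hi]
    rw [this, card_range]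
  refine ⟨⟨isTable_encodeTable _, ?_, ?_, ?_⟩, ?_, ?_, ?_, ?_⟩
  · simp [numRows_encodeTable, ← hT]
  · simp [rowLen_encodeTable, ← hT]
  · intro i hi
    rw [h0] at hi
    rw [hw, rowLen_encodeTable, ← hT, List.getD_cons_succ, List.getD_cons_succ,
      getD_map_range _ _ hi]
    simp
  · rw [hw, entry_encodeTable, tableAt]
    refine (min_le_left _ _).trans_lt ?_
    simpa [← hT] using hp
  · intro j hj
    rw [hw] at hj
    have : tableAt T 1 j = j := by simp [tableAt, ← hT, hj]
    rw [entry_encodeTable, this]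
    omega
  · intro i hi
    rw [h0] at hi
    rw [key0 i hi, hr]
  · intro i hi
    rw [h0] at hi
    rw [hw]
    have e1 : ∀ j < m, voteAt (encodeTable T) i j = w i j := by
      intro j hj
      rw [voteAt, key i hi, List.getD_cons_succ, getD_map_range _ _ hj]
      exact min_eq_left ((h1 i hi j hj).1.trans hlt).le
    intro j hj
    rw [e1 j hj]
    refine ⟨(h1 i hi j hj).1, fun j' hj' h => (h1 i hi j hj).2 j' hj' ?_⟩
    rwa [← e1 j' hj']

/-- There are fewer than `cap x` voters, and exactly `k` of them are added; so a `k` that is changed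
by truncation is impossible before and after. -/
theorem HasControl.cap_iff {x : Word} {m p : ℕ} {w w' : ℕ → ℕ → ℕ} {k k' : ℕ}
    (hk : min k (cap x) = k') :
    HasControl m p k (List.range (numReg x)) (List.range (numUnreg x)) w w' ↔
      HasControl m p k' (List.range (numReg x)) (List.range (numUnreg x)) w w' := by
  have h0 : size x < cap x :=
    ((Nat.sub_le _ _).trans (numRows_le x)).trans_lt (length_lt_cap x)
  have h1 := numReg_add_numUnreg x
  unfold HasControl
  refine exists_congr fun A => and_congr_right fun hA => exists_congr fun B =>
    and_congr_right fun hB => ?_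
  rw [List.length_range, ← and_assoc, ← and_assoc]
  refine and_congr_left fun _ => ?_
  have := card_le_card hB
  rw [List.toFinset_range, card_range] at this
  omega

theorem mem_ccrvExact_iff {x : Word} : x ∈ ccrvExact twoApproval ↔
    IsControlWord x ∧ HasControl (width x) (entry x 0 0) (entry x 0 1) (List.range (numReg x))
      (List.range (numUnreg x)) (voteAt x) fun i => voteAt x (numReg x + i) := by
  have key : IsControlWord x → (x ∈ ccrvExact twoApproval ↔
      HasControl (width x) (entry x 0 0) (entry x 0 1) (List.range (numReg x))
      (List.range (numUnreg x)) (voteAt x) fun i => voteAt x (numReg x + i)) := by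
    intro h
    obtain ⟨k, hk, e⟩ := h.exists_eq
    conv_lhs => rw [← e]
    rw [mem_ccrvExact List.nodup_range List.nodup_range, HasControl.cap_iff hk]
    have := numReg_add_numUnreg x
    refine and_iff_right ⟨h.2.1, fun i hi => h.2.2.2.2 i ?_, fun i hi => h.2.2.2.2 _ ?_⟩ <;>
      rw [List.mem_range] at hi <;> omega
  constructor
  · intro h
    have hx : IsControlWord x := by
      obtain ⟨I, -, rfl⟩ := h
      exact isControlWord_encode I
    exact ⟨hx, (key hx).1 h⟩
  · rintro ⟨hx, h⟩
    exact (key hx).2 h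

end

end Logspace

/-! ### The four combinatorial reductions. -/

namespace Logspace

open Finset

/-! ## Graphs on two families of pairs -/

section PairLabels

def pairList (A : ℕ) (B : ℕ → ℕ) : List (ℕ × ℕ) :=
  (List.range A).flatMap fun i => (List.range (B i)).map fun j => (i, j)

theorem mem_pairList {A : ℕ} {B : ℕ → ℕ} {p : ℕ × ℕ} : p ∈ pairList A B ↔ p.1 < A ∧ p.2 < B p.1 := by
  obtain ⟨i, j⟩ := p
  simp only [pairList, List.mem_flatMap, List.mem_range, List.mem_map, Prod.mk.injEq]
  constructor
  · rintro ⟨i, h1, j, h2, rfl, rfl⟩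
    exact ⟨h1, h2⟩
  · rintro ⟨h1, h2⟩
    exact ⟨i, h1, j, h2, rfl, rfl⟩

theorem nodup_pairList (A : ℕ) (B : ℕ → ℕ) : (pairList A B).Nodup := by
  rw [pairList, List.nodup_flatMap]
  refine ⟨fun i _ => List.nodup_range.map fun j j' h => by simpa using h, ?_⟩
  refine List.nodup_range.imp fun {i i'} h => ?_
  rw [Function.onFun, List.disjoint_left]
  simp only [List.mem_map, not_exists, not_and]
  rintro _ ⟨j, -, rfl⟩ j' - h'
  exact h (Prod.ext_iff.1 h').1.symm

abbrev PairLabel := (ℕ × ℕ) ⊕ (ℕ × ℕ)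

def labels (A : ℕ) (B : ℕ → ℕ) (C : ℕ) (D : ℕ → ℕ) : List PairLabel :=
  (pairList A B).map Sum.inl ++ (pairList C D).map Sum.inr

variable {A C : ℕ} {B D : ℕ → ℕ}

theorem inl_mem_labels {i j : ℕ} : Sum.inl (i, j) ∈ labels A B C D ↔ i < A ∧ j < B i := by
  simp [labels, mem_pairList]

theorem inr_mem_labels {i j : ℕ} : Sum.inr (i, j) ∈ labels A B C D ↔ i < C ∧ j < D i := by
  simp [labels, mem_pairList]

theorem nodup_labels : (labels A B C D).Nodup := by
  refine List.nodup_append'.2 ⟨(nodup_pairList A B).map Sum.inl_injective,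
    (nodup_pairList C D).map Sum.inr_injective, ?_⟩
  rw [List.disjoint_left]
  simp

theorem sum_map_range (n : ℕ) (f : ℕ → ℕ) : ((List.range n).map f).sum = ∑ i ∈ range n, f i := by
  induction n with
  | zero => rfl
  | succ n ih => rw [List.range_succ, List.map_append, List.sum_append, ih, sum_range_succ]; simp

theorem sum_pairList (f : ℕ × ℕ → ℕ) : ((pairList A B).map f).sum =
    ∑ i ∈ range A, ∑ j ∈ range (B i), f (i, j) := by
  rw [← sum_map_range, pairList, List.map_flatMap, List.flatMap, List.sum_flatten, List.map_map]
  refine congrArg List.sum (List.map_congr_left fun i _ => ?_)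
  rw [Function.comp_apply, List.map_map, ← sum_map_range]
  rfl

theorem sum_labels (f : PairLabel → ℕ) : ∑ a ∈ (labels A B C D).toFinset, f a =
    (∑ i ∈ range A, ∑ j ∈ range (B i), f (.inl (i, j))) +
      ∑ i ∈ range C, ∑ j ∈ range (D i), f (.inr (i, j)) := by
  rw [List.sum_toFinset _ nodup_labels, labels, List.map_append, List.sum_append, List.map_map,
    List.map_map, sum_pairList, sum_pairList]
  rfl

/-- The color of an edge on pair labels, by the kinds of its ends. -/
def pairColor (e₁ e₁₂ e₂ : ℕ → ℕ → ℕ → ℕ → ℕ) : PairLabel → PairLabel → ℕ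
  | .inl p, .inl q => e₁ p.1 p.2 q.1 q.2
  | .inl p, .inr q => e₁₂ p.1 p.2 q.1 q.2
  | .inr q, .inl p => e₁₂ p.1 p.2 q.1 q.2
  | .inr p, .inr q => e₂ p.1 p.2 q.1 q.2

variable {γ : Type} [Ctx γ]

theorem LogTab.map_pairList {A : γ → ℕ} {B : γ → ℕ → ℕ} {f : γ → ℕ × ℕ → List ℕ} (hA : LogFn A)
    (hB : LogFn fun p : γ × ℕ => B p.1 p.2)
    (hf : LogRow fun p : (γ × ℕ) × ℕ => f p.1.1 (p.1.2, p.2)) :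
    LogTab fun c => (pairList (A c) (B c)).map (f c) := by
  simp only [pairList, List.map_flatMap, List.map_map]
  exact LogTab.flatMap hA (LogTab.map hB hf)

theorem LogRow.map_pairList {A : γ → ℕ} {B : γ → ℕ → ℕ} {f : γ → ℕ × ℕ → ℕ} (hA : LogFn A)
    (hB : LogFn fun p : γ × ℕ => B p.1 p.2)
    (hf : LogFn fun p : (γ × ℕ) × ℕ => f p.1.1 (p.1.2, p.2)) :
    LogRow fun c => (pairList (A c) (B c)).map (f c) := by
  simp only [pairList, List.map_flatMap, List.map_map]
  exact LogRow.flatMap hA (LogRow.map hB hf)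

theorem LogTab.matrix_labels {A C k : γ → ℕ} {B D : γ → ℕ → ℕ}
    {e₁ e₁₂ e₂ : γ → ℕ → ℕ → ℕ → ℕ → ℕ} (hk : LogFn k) (hA : LogFn A) (hC : LogFn C)
    (hB : LogFn fun p : γ × ℕ => B p.1 p.2) (hD : LogFn fun p : γ × ℕ => D p.1 p.2)
    (h₁ : LogFn fun p : (((γ × ℕ) × ℕ) × ℕ) × ℕ => e₁ p.1.1.1.1 p.1.1.1.2 p.1.1.2 p.1.2 p.2)
    (h₁₂ : LogFn fun p : (((γ × ℕ) × ℕ) × ℕ) × ℕ => e₁₂ p.1.1.1.1 p.1.1.1.2 p.1.1.2 p.1.2 p.2)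
    (h₂ : LogFn fun p : (((γ × ℕ) × ℕ) × ℕ) × ℕ => e₂ p.1.1.1.1 p.1.1.1.2 p.1.1.2 p.1.2 p.2) :
    LogTab fun c => matrixTable (labels (A c) (B c) (C c) (D c))
      (pairColor (e₁ c) (e₁₂ c) (e₂ c)) (k c) := by
  -- The block below the diagonal is the transpose of the mixed block, so its entries are those of
  -- `e₁₂` with the two pairs interchanged.
  have hs : LogMap fun p : (((γ × ℕ) × ℕ) × ℕ) × ℕ =>
      ((((p.1.1.1.1, p.1.2), p.2), p.1.1.1.2), p.1.1.2) :=
    ((((LogMap.fst.comp (LogMap.fst.comp (LogMap.fst.comp LogMap.fst))).pair LogFn.v1).pair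
      LogFn.v0).pair LogFn.v3).pair LogFn.v2
  have h₂₁ := h₁₂.comp hs
  have hB' : LogFn fun p : ((γ × ℕ) × ℕ) × ℕ => B p.1.1.1 p.2 :=
    hB.comp ((LogMap.fst.comp (LogMap.fst.comp LogMap.fst)).pair LogFn.v0)
  have hD' : LogFn fun p : ((γ × ℕ) × ℕ) × ℕ => D p.1.1.1 p.2 :=
    hD.comp ((LogMap.fst.comp (LogMap.fst.comp LogMap.fst)).pair LogFn.v0)
  refine LogTab.cons (LogRow.single hk) ?_
  simp only [labels, List.map_append, List.map_map, Function.comp_def]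
  refine LogTab.append ?_ ?_
  · refine LogTab.map_pairList (f := fun c p => (pairList (A c) (B c)).map
      (fun q => pairColor (e₁ c) (e₁₂ c) (e₂ c) (.inl p) (.inl q)) ++ (pairList (C c) (D c)).map
      (fun q => pairColor (e₁ c) (e₁₂ c) (e₂ c) (.inl p) (.inr q))) hA hB (LogRow.append ?_ ?_)
    · exact LogRow.map_pairList (γ := (γ × ℕ) × ℕ) (B := fun p => B p.1.1)
        (f := fun p q => e₁ p.1.1 p.1.2 p.2 q.1 q.2) hA.weak.weak hB' h₁
    · exact LogRow.map_pairList (γ := (γ × ℕ) × ℕ) (B := fun p => D p.1.1)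
        (f := fun p q => e₁₂ p.1.1 p.1.2 p.2 q.1 q.2) hC.weak.weak hD' h₁₂
  · refine LogTab.map_pairList (f := fun c p => (pairList (A c) (B c)).map
      (fun q => pairColor (e₁ c) (e₁₂ c) (e₂ c) (.inr p) (.inl q)) ++ (pairList (C c) (D c)).map
      (fun q => pairColor (e₁ c) (e₁₂ c) (e₂ c) (.inr p) (.inr q))) hC hD (LogRow.append ?_ ?_)
    · exact LogRow.map_pairList (γ := (γ × ℕ) × ℕ) (B := fun p => B p.1.1)
        (f := fun p q => e₁₂ p.1.1 q.1 q.2 p.1.2 p.2) hA.weak.weak hB' h₂₁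
    · exact LogRow.map_pairList (γ := (γ × ℕ) × ℕ) (B := fun p => D p.1.1)
        (f := fun p q => e₂ p.1.1 p.1.2 p.2 q.1 q.2) hC.weak.weak hD' h₂

theorem isColoring_labels {e₁ e₁₂ e₂ : ℕ → ℕ → ℕ → ℕ → ℕ}
    (h₁ : IsColoring (pairList A B) fun p q => e₁ p.1 p.2 q.1 q.2)
    (h₁₂ : ∀ i j i' j', e₁₂ i j i' j' ≤ 2)
    (h₂ : IsColoring (pairList C D) fun p q => e₂ p.1 p.2 q.1 q.2) :
    IsColoring (labels A B C D) (pairColor e₁ e₁₂ e₂) := by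
  rintro (⟨i, j⟩ | ⟨i, j⟩) hp
  · rw [inl_mem_labels] at hp
    have h := h₁ (i, j) (mem_pairList.2 hp)
    refine ⟨h.1, ?_⟩
    rintro (⟨i', j'⟩ | ⟨i', j'⟩) hq
    · exact h.2 _ (mem_pairList.2 (inl_mem_labels.1 hq))
    · exact ⟨h₁₂ _ _ _ _, rfl⟩
  · rw [inr_mem_labels] at hp
    have h := h₂ (i, j) (mem_pairList.2 hp)
    refine ⟨h.1, ?_⟩
    rintro (⟨i', j'⟩ | ⟨i', j'⟩) hq
    · exact ⟨h₁₂ _ _ _ _, rfl⟩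
    · exact h.2 _ (mem_pairList.2 (inr_mem_labels.1 hq))

end PairLabels

/-! ## From Exact Perfect Matching to its restriction -/

section Restriction

/-- The color of the edge between an old vertex and a new one. -/
def linkColor (n v i j : ℕ) : ℕ := if i = 0 ∧ j = 0 ∧ v < n / 2 then 2 else 0

/-- The color of the edge between two new vertices. -/
def pendantColor (i j i' j' : ℕ) : ℕ := if i = i' ∧ j ≠ j' then (if i = 0 then 2 else 1) else 0

/-- A graph with `ρ + 1` pendant edges added. -/
def pendantTable (n ρ k : ℕ) (col : ℕ → ℕ → ℕ) : List (List ℕ) :=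
  matrixTable (labels n (fun _ => 1) (ρ + 1) fun _ => 2)
    (pairColor (fun u _ v _ => col u v) (fun v _ i j => linkColor n v i j) pendantColor) (k + 1)

theorem even_of_hasMatching {α : Type} [DecidableEq α] {L : List α} (hL : L.Nodup)
    {ent : α → α → ℕ} {k : ℕ} (h : HasMatching L ent k) (h0 : ∀ a ∈ L, ent a a = 0) :
    Even L.length := by
  obtain ⟨f, h1, -⟩ := h
  have h2 := card_eq_two_mul_card_image (L.toFinset.image fun a => (a, f a)) ?_ ?_
  · rw [card_image_of_injective _ fun a b h => (Prod.ext_iff.1 h).1,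
      List.toFinset_card_of_nodup hL] at h2
    exact ⟨_, h2.trans (two_mul _)⟩
  · intro p hp
    obtain ⟨a, ha, rfl⟩ := mem_image.1 hp
    rw [List.mem_toFinset] at ha
    intro h
    have h3 := (h1 a ha).2.2
    have h : a = f a := h
    rw [← h] at h3
    exact h3 (h0 a ha)
  · intro p hp
    obtain ⟨a, ha, rfl⟩ := mem_image.1 hp
    rw [List.mem_toFinset] at ha
    exact mem_image.2 ⟨f a, List.mem_toFinset.2 (h1 a ha).1, by simp [(h1 a ha).2.1]⟩

/-- The leaf `(i, 1)` has `(i, 0)` as its only neighbor, so the new vertices are matched among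
themselves and the links to old vertices are never used. Of the forced edges only the one with `i =
0` is red, which accounts for `k + 1`. -/
theorem hasMatching_pendant {n ρ k : ℕ} {col : ℕ → ℕ → ℕ} :
    HasMatching (labels n (fun _ => 1) (ρ + 1) fun _ => 2)
      (pairColor (fun u _ v _ => col u v) (fun v _ i j => linkColor n v i j) pendantColor) (k + 1) ↔
      HasMatching (List.range n) col k := by
  have hcount : ∀ (f : PairLabel → PairLabel) (g : ℕ → ℕ),
      (∀ v < n, f (.inl (v, 0)) = .inl (g v, 0)) →
      (∀ i < ρ + 1, ∀ j < 2, f (.inr (i, j)) = .inr (i, 1 - j)) →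
      ((labels n (fun _ => 1) (ρ + 1) fun _ => 2).toFinset.filter fun a =>
        pairColor (fun u _ v _ => col u v) (fun v _ i j => linkColor n v i j) pendantColor
          a (f a) = 2).card = ((List.range n).toFinset.filter fun v => col v (g v) = 2).card + 2 := by
    intro f g h1 h2
    rw [card_filter, card_filter, sum_labels, List.toFinset_range]
    congr 1
    · refine sum_congr rfl fun v hv => ?_
      rw [sum_range_one, h1 v (mem_range.1 hv)]
      rfl
    · rw [sum_range_succ', sum_eq_zero, zero_add]
      · rw [sum_range_succ, sum_range_one, h2 0 (by omega) 0 (by omega),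
          h2 0 (by omega) 1 (by omega)]
        simp [pairColor, pendantColor]
      · intro i hi
        rw [mem_range] at hi
        refine sum_eq_zero fun j hj => ?_
        rw [h2 _ (by omega) j (mem_range.1 hj)]
        simp only [pairColor, pendantColor]
        split_ifs <;> simp_all
  constructor
  · rintro ⟨f, h1, h2⟩
    have hleaf : ∀ i < ρ + 1, f (.inr (i, 1)) = .inr (i, 0) := by
      intro i hi
      obtain ⟨h3, h4, h5⟩ := h1 (.inr (i, 1)) (inr_mem_labels.2 ⟨hi, by omega⟩)
      rcases h6 : f (.inr (i, 1)) with ⟨v, j⟩ | ⟨i', j⟩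
      · rw [h6] at h5
        simp [pairColor, linkColor] at h5
      · rw [h6, inr_mem_labels] at h3
        rw [h6] at h5
        have h7 : i = i' ∧ 1 ≠ j := by
          by_contra h7
          exact h5 (if_neg h7)
        obtain ⟨rfl, h7⟩ := h7
        obtain rfl : j = 0 := by omega
        rfl
    have hinner : ∀ i < ρ + 1, f (.inr (i, 0)) = .inr (i, 1) := by
      intro i hi
      rw [← hleaf i hi]
      exact (h1 (.inr (i, 1)) (inr_mem_labels.2 ⟨hi, by omega⟩)).2.1
    have hnew : ∀ i < ρ + 1, ∀ j < 2, f (.inr (i, j)) = .inr (i, 1 - j) := by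
      intro i hi j hj
      obtain rfl | rfl : j = 0 ∨ j = 1 := by omega
      · exact hinner i hi
      · exact hleaf i hi
    have hold : ∀ v < n, ∃ w < n, f (.inl (v, 0)) = .inl (w, 0) := by
      intro v hv
      obtain ⟨h3, h4, h5⟩ := h1 (.inl (v, 0)) (inl_mem_labels.2 ⟨hv, by omega⟩)
      rcases h6 : f (.inl (v, 0)) with ⟨w, j⟩ | ⟨i, j⟩
      · rw [h6, inl_mem_labels] at h3
        obtain rfl : j = 0 := by omega
        exact ⟨w, h3.1, rfl⟩
      · rw [h6, inr_mem_labels] at h3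
        rw [h6, hnew i h3.1 j h3.2] at h4
        simp at h4
    choose! g hg1 hg2 using hold
    refine ⟨g, fun v hv => ?_, ?_⟩
    · rw [List.mem_range] at hv ⊢
      obtain ⟨h3, h4, h5⟩ := h1 (.inl (v, 0)) (inl_mem_labels.2 ⟨hv, by omega⟩)
      rw [hg2 v hv, hg2 _ (hg1 v hv)] at h4
      rw [hg2 v hv] at h5
      refine ⟨hg1 v hv, by simpa using h4, h5⟩
    · have := hcount f g hg2 hnew
      omega
  · rintro ⟨g, h1, h2⟩
    let f : PairLabel → PairLabel := Sum.elim (fun p => .inl (g p.1, 0)) fun p => .inr (p.1, 1 - p.2)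
    refine ⟨f, ?_, ?_⟩
    · rintro (⟨v, j⟩ | ⟨i, j⟩) ha
      · rw [inl_mem_labels] at ha
        obtain rfl : j = 0 := by omega
        obtain ⟨h3, h4, h5⟩ := h1 v (List.mem_range.2 ha.1)
        rw [List.mem_range] at h3
        refine ⟨inl_mem_labels.2 ⟨h3, by omega⟩, ?_, h5⟩
        simp [f, h4]
      · rw [inr_mem_labels] at ha
        refine ⟨inr_mem_labels.2 ⟨ha.1, by omega⟩, ?_, ?_⟩
        · simp only [f, Sum.elim_inr]
          rw [Nat.sub_sub_self (by omega)]
        · simp only [f, Sum.elim_inr, pairColor, pendantColor]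
          rw [if_pos ⟨trivial, by omega⟩]
          split_ifs <;> omega
    · rw [hcount f g (fun v _ => rfl) fun i _ j _ => rfl]
      omega

def isTwo (a : ℕ) : ℕ := if a = 2 then 1 else 0

theorem card_filter_eq_two {α : Type} (S : Finset α) (f : α → ℕ) :
    (S.filter fun a => f a = 2).card = ∑ a ∈ S, isTwo (f a) := card_filter _ _

/-- Ordered pairs are counted: besides the old ones there are both orientations of the `n / 2` links
and of the one red pendant edge. -/
theorem card_two_pendant {n ρ : ℕ} {col : ℕ → ℕ → ℕ} :
    (((labels n (fun _ => 1) (ρ + 1) fun _ => 2).toFinset ×ˢ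
      (labels n (fun _ => 1) (ρ + 1) fun _ => 2).toFinset).filter fun p =>
        pairColor (fun u _ v _ => col u v) (fun v _ i j => linkColor n v i j) pendantColor
          p.1 p.2 = 2).card =
      ((range n ×ˢ range n).filter fun p => col p.1 p.2 = 2).card + 2 * (n / 2) + 2 := by
  have hlink : ∑ v ∈ range n, ∑ i ∈ range (ρ + 1), ∑ j ∈ range 2,
      isTwo (linkColor n v i j) = n / 2 := by
    have h0 : ∀ v i j, isTwo (linkColor n v i j) =
        if i = 0 then if j = 0 then if v < n / 2 then 1 else 0 else 0 else 0 := by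
      intro v i j
      unfold isTwo linkColor
      split_ifs <;> simp_all
    have e : (range n).filter (fun v => v < n / 2) = range (n / 2) := by
      ext v; simp only [mem_filter, mem_range]; omega
    simp only [h0, sum_ite_irrel, sum_const_zero, sum_ite_eq', mem_range, if_true,
      Nat.zero_lt_succ]
    simp [e]
  have hpend : ∑ i ∈ range (ρ + 1), ∑ j ∈ range 2, ∑ i' ∈ range (ρ + 1), ∑ j' ∈ range 2,
      isTwo (pendantColor i j i' j') = 2 := by
    have h0 : ∀ i j i' j', isTwo (pendantColor i j i' j') =
        if i = 0 then if i' = 0 then if j = j' then 0 else 1 else 0 else 0 := by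
      intro i j i' j'
      unfold isTwo pendantColor
      split_ifs <;> simp_all
    simp only [h0, sum_ite_irrel, sum_const_zero, sum_ite_eq', mem_range, Nat.succ_pos, if_true]
    rfl
  have hlink' : ∑ i ∈ range (ρ + 1), ∑ j ∈ range 2, ∑ v ∈ range n,
      isTwo (linkColor n v i j) = n / 2 := by
    rw [← hlink]
    exact (sum_congr rfl fun i _ => sum_comm).trans sum_comm
  rw [card_filter_eq_two, card_filter_eq_two, sum_product, sum_labels, sum_product]
  simp only [sum_labels, sum_range_one, pairColor, sum_add_distrib]
  rw [hlink, hlink', hpend]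
  ring

theorem length_labels {A C : ℕ} {B D : ℕ → ℕ} : (labels A B C D).length =
    ∑ i ∈ range A, B i + ∑ i ∈ range C, D i := by
  rw [← List.toFinset_card_of_nodup nodup_labels, card_eq_sum_ones, sum_labels]
  simp

theorem isColoring_pendant {n ρ : ℕ} {col : ℕ → ℕ → ℕ} (h : IsColoring (List.range n) col) :
    IsColoring (labels n (fun _ => 1) (ρ + 1) fun _ => 2)
      (pairColor (fun u _ v _ => col u v) (fun v _ i j => linkColor n v i j) pendantColor) := by
  refine isColoring_labels ?_ ?_ ?_
  · rintro ⟨u, i⟩ hu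
    have := h u (List.mem_range.2 (mem_pairList.1 hu).1)
    exact ⟨this.1, fun ⟨v, j⟩ hv => this.2 v (List.mem_range.2 (mem_pairList.1 hv).1)⟩
  · intro i j i' j'
    unfold linkColor
    split_ifs <;> omega
  · rintro ⟨i, j⟩ -
    refine ⟨by simp [pendantColor], ?_⟩
    rintro ⟨i', j'⟩ -
    dsimp only [pendantColor]
    constructor <;> split_ifs <;> omega

/-- The empty table is the common no-instance to which the reductions send words that encode nothing
or are hopeless for trivial reasons. -/
theorem notMem_of_nil : encodeTable [] ∉ exactPerfectMatching ∧
    encodeTable [] ∉ restrictedExactPerfectMatching ∧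
    encodeTable [] ∉ exactRedBluePerfectBMatching ∧ encodeTable [] ∉ ccrvExact twoApproval := by
  have h : numRows (encodeTable []) = 0 := numRows_encodeTable []
  refine ⟨fun h' => ?_, fun h' => ?_, fun h' => ?_, fun h' => ?_⟩
  · exact (mem_exactPerfectMatching_iff.1 h').1.1.2.1 h
  · exact (mem_restrictedExactPerfectMatching_iff.1 h').1.1.2.1 h
  · have := (mem_exactRedBluePerfectBMatching_iff.1 h').1.1.2.1
    omega
  · have := (mem_ccrvExact_iff.1 h').1.1.2.1
    omega

def redPairs (x : Word) : ℕ :=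
  ∑ u ∈ range (order x), ((range (order x)).filter fun v => colorAt x u v = 2).card

theorem redPairs_eq (x : Word) : redPairs x =
    ((range (order x) ×ˢ range (order x)).filter fun p => colorAt x p.1 p.2 = 2).card := by
  rw [card_filter, sum_product]
  simp only [redPairs, card_filter]

theorem LogFn.redPairs {γ : Type} [Ctx γ] : LogFn fun c : γ => redPairs (Ctx.word c) :=
  LogFn.sum (f := fun c u => ((range (Logspace.order (Ctx.word c))).filter
    fun v => Logspace.colorAt (Ctx.word c) u v = 2).card) LogFn.order
    (LogFn.count (P := fun (p : γ × ℕ) v => Logspace.colorAt (Ctx.word p.1) p.2 v = 2) LogFn.order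
      (LogPred.eq (LogFn.v1.colorAt LogFn.v0) (LogFn.const 2)))

theorem even_redPairs {x : Word} (h : IsMatchingWord x) : Even (redPairs x) := by
  rw [redPairs_eq, card_eq_two_mul_card_image]
  · exact even_two_mul _
  · rintro ⟨u, v⟩ hp (rfl : u = v)
    simp only [mem_filter, mem_product, mem_range] at hp
    have := (h.2 _ hp.1.1).1
    omega
  · rintro ⟨u, v⟩ hp
    simp only [mem_filter, mem_product, mem_range, Prod.swap_prod_mk] at hp ⊢
    have := ((h.2 _ hp.1.1).2 _ hp.1.2).2
    exact ⟨hp.1.symm, by omega⟩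

open Classical in
-- With `ρ = redPairs x / 2` red edges and `n` vertices at the start, there are `ρ + n / 2 + 1` red
-- edges and `n + 2 * (ρ + 1)` vertices in the end. These are in the ratio `1 : 2` if `n` is even.
theorem genReduces_exactPerfectMatching_restricted :
    GenReduces exactPerfectMatching restrictedExactPerfectMatching := by
  refine ⟨fun x => encodeTable (if IsMatchingWord x then
    pendantTable (order x) (redPairs x / 2) (entry x 0 0) (colorAt x) else []), ?_, fun x => ?_⟩
  · refine LogTab.ite LogPred.isMatchingWord ?_ LogTab.nil
    refine LogTab.matrix_labels (γ := Word) (A := order) (C := fun x => redPairs x / 2 + 1)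
      (B := fun _ _ => 1) (D := fun _ _ => 2) (e₁ := fun x u _ v _ => colorAt x u v)
      (e₁₂ := fun x v _ i j => linkColor (order x) v i j) (e₂ := fun _ => pendantColor)
      (LogFn.entry (LogFn.const 0) (LogFn.const 0)).succ LogFn.order LogFn.redPairs.half.succ
      (LogFn.const 1) (LogFn.const 2) (LogFn.v3.colorAt LogFn.v1) ?_ ?_
    · exact LogFn.ite ((LogPred.eq LogFn.v1 (LogFn.const 0)).and
        ((LogPred.eq LogFn.v0 (LogFn.const 0)).and (LogPred.lt LogFn.v3 LogFn.order.half)))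
        (LogFn.const 2) (LogFn.const 0)
    · exact LogFn.ite ((LogPred.eq LogFn.v3 LogFn.v1).and (LogPred.ne LogFn.v2 LogFn.v0))
        (LogFn.ite (LogPred.eq LogFn.v3 (LogFn.const 0)) (LogFn.const 2) (LogFn.const 1))
        (LogFn.const 0)
  · beta_reduce
    rw [mem_exactPerfectMatching_iff]
    split_ifs with h
    · rw [pendantTable, mem_restrictedExactPerfectMatching nodup_labels, hasMatching_pendant,
        card_two_pendant, ← redPairs_eq, length_labels, and_iff_right h,
        and_iff_right (isColoring_pendant h.isColoring)]
      -- For odd `n` the count is off by one, but then there is no perfect matching in the first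
      -- place; so the count may be checked in the presence of a matching.
      refine (and_iff_left_of_imp fun h' => ?_).symm
      have h1 := even_of_hasMatching List.nodup_range h' fun a ha => (h.2 a (List.mem_range.1 ha)).1
      obtain ⟨a, ha⟩ := even_redPairs h
      rw [List.length_range] at h1
      obtain ⟨b, hb⟩ := h1
      simp only [sum_const, card_range, smul_eq_mul]
      omega
    · simp [h, notMem_of_nil.2.1]

end Restriction

end Logspace

namespace Logspace

open Finset

/-! ## From `b`-matchings to matchings -/

section Gadgets

variable {n m M : ℕ} {b u v c : ℕ → ℕ}

/-- The number of red edges that a used edge of a multigraph contributes. -/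
def edgeWeight (M a : ℕ) : ℕ := if a = 1 then 1 else if a = 2 then M else 0

/-- Only the two end vertices of a path meet slots, and they meet all slots of the respective
endpoint alike. -/
def slotColor (M : ℕ) (u v : ℕ → ℕ) (w _i e j : ℕ) : ℕ :=
  if (j = 0 ∧ u e = w) ∨ (j = 2 * M + 1 ∧ v e = w) then 1 else 0

/-- A used edge pairs `j` with `j + 1` for odd `j`, an unused one for even `j`. Red are the first
`edgeWeight M (c e)` path edges that start at an odd `j`, so an unused edge contributes nothing. -/
def pathColor (M : ℕ) (c : ℕ → ℕ) (e j e' j' : ℕ) : ℕ :=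
  if e = e' ∧ (j' = j + 1 ∨ j = j' + 1) then
    if min j j' % 2 = 1 ∧ min j j' < 2 * edgeWeight M (c e) then 2 else 1
  else 0

abbrev gadgetLabels (n m M : ℕ) (b : ℕ → ℕ) : List PairLabel := labels n b m fun _ => 2 * M + 2

/-- Every vertex is replaced by as many slots as its capacity, and every edge by a path. -/
abbrev gadgetColor (M : ℕ) (u v c : ℕ → ℕ) : PairLabel → PairLabel → ℕ :=
  pairColor (fun _ _ _ _ => 0) (slotColor M u v) (pathColor M c)

theorem pathColor_eq_two {e j e' j' : ℕ} : pathColor M c e j e' j' = 2 ↔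
    e = e' ∧ (j' = j + 1 ∨ j = j' + 1) ∧ min j j' % 2 = 1 ∧
      min j j' < 2 * edgeWeight M (c e) := by
  unfold pathColor
  split_ifs <;> grind

/-- The pairing of a path that starts at even positions covers all its vertices, the one that starts
at odd positions leaves out both ends. Both partner maps are involutions. -/
theorem even_partner (j : ℕ) : (if (if j % 2 = 0 then j + 1 else j - 1) % 2 = 0 then
    (if j % 2 = 0 then j + 1 else j - 1) + 1 else (if j % 2 = 0 then j + 1 else j - 1) - 1) = j := by
  rcases Nat.mod_two_eq_zero_or_one j with h | h
  · rw [if_pos h, if_neg (by omega)]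
    omega
  · rw [if_neg (show ¬ j % 2 = 0 by omega), if_pos (by omega)]
    omega

theorem odd_partner {j : ℕ} (hj : 1 ≤ j) : (if (if j % 2 = 1 then j + 1 else j - 1) % 2 = 1 then
    (if j % 2 = 1 then j + 1 else j - 1) + 1 else (if j % 2 = 1 then j + 1 else j - 1) - 1) = j := by
  rcases Nat.mod_two_eq_zero_or_one j with h | h
  · rw [if_neg (show ¬ j % 2 = 1 by omega), if_pos (by omega)]
    omega
  · rw [if_pos h, if_neg (by omega)]
    omega

theorem isColoring_gadget : IsColoring (gadgetLabels n m M b) (gadgetColor M u v c) := by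
  refine isColoring_labels (fun _ _ => ⟨rfl, fun _ _ => ⟨by simp, rfl⟩⟩) ?_ ?_
  · intro i j i' j'
    unfold slotColor
    split_ifs <;> omega
  · rintro ⟨e, j⟩ -
    refine ⟨by simp [pathColor], ?_⟩
    rintro ⟨e', j'⟩ -
    dsimp only [pathColor]
    rw [min_comm j' j]
    constructor
    · split_ifs <;> omega
    · by_cases h : e = e'
      · subst h
        simp only [true_and, or_comm]
      · rw [if_neg fun h' => h h'.1, if_neg fun h' => h h'.1.symm]

/-- The matching `f` uses exactly the edges in `S`. -/
structure FollowsEdges (n m M : ℕ) (b : ℕ → ℕ) (S : Finset ℕ) (f : PairLabel → PairLabel) :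
    Prop where
  unused : ∀ e < m, e ∉ S → ∀ j < 2 * M + 2,
    f (.inr (e, j)) = .inr (e, if j % 2 = 0 then j + 1 else j - 1)
  used : ∀ e ∈ S, ∀ j, 1 ≤ j → j ≤ 2 * M →
    f (.inr (e, j)) = .inr (e, if j % 2 = 1 then j + 1 else j - 1)
  first : ∀ e ∈ S, ∃ p, f (.inr (e, 0)) = .inl p
  last : ∀ e ∈ S, ∃ p, f (.inr (e, 2 * M + 1)) = .inl p
  slot : ∀ w < n, ∀ i < b w, ∃ p, f (.inl (w, i)) = .inr p

theorem isTwo_slotColor (w i e j : ℕ) : isTwo (slotColor M u v w i e j) = 0 := by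
  unfold isTwo slotColor
  split_ifs <;> simp_all

theorem edgeWeight_le (hM : 0 < M) (a : ℕ) : edgeWeight M a ≤ M := by
  unfold edgeWeight
  split_ifs <;> omega

/-- The vertices on red edges of a used path are those at positions `1` to `2 * edgeWeight M (c e)`,
and slots or unused paths have none. -/
theorem FollowsEdges.card_two {S : Finset ℕ} {f : PairLabel → PairLabel} (hM : 0 < M)
    (hS : S ⊆ range m) (h : FollowsEdges n m M b S f) :
    ((gadgetLabels n m M b).toFinset.filter fun a => gadgetColor M u v c a (f a) = 2).card =
      2 * ∑ e ∈ S, edgeWeight M (c e) := by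
  rw [card_filter_eq_two, sum_labels, sum_eq_zero, zero_add, mul_sum, ← sum_subset hS]
  · refine sum_congr rfl fun e he => ?_
    have hw := edgeWeight_le hM (c e)
    have key : ∀ j ∈ range (2 * M + 2), isTwo (gadgetColor M u v c (.inr (e, j)) (f (.inr (e, j)))) =
        if 1 ≤ j ∧ j ≤ 2 * edgeWeight M (c e) then 1 else 0 := by
      intro j hj
      rw [mem_range] at hj
      rcases (by omega : j = 0 ∨ j = 2 * M + 1 ∨ (1 ≤ j ∧ j ≤ 2 * M)) with rfl | rfl | ⟨h1, h2⟩
      · obtain ⟨p, hp⟩ := h.first e he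
        rw [hp]
        exact isTwo_slotColor p.1 p.2 _ _
      · obtain ⟨p, hp⟩ := h.last e he
        rw [hp, if_neg (by omega)]
        exact isTwo_slotColor p.1 p.2 _ _
      · rw [h.used e he j h1 h2]
        rcases Nat.mod_two_eq_zero_or_one j with h3 | h3
        · rw [if_neg (by omega)]
          change isTwo (pathColor M c e j e (j - 1)) = _
          exact if_congr (pathColor_eq_two.trans (by omega)) rfl rfl
        · rw [if_pos h3]
          change isTwo (pathColor M c e j e (j + 1)) = _
          exact if_congr (pathColor_eq_two.trans (by omega)) rfl rfl
    rw [sum_congr rfl key, ← card_filter]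
    have : (range (2 * M + 2)).filter (fun j => 1 ≤ j ∧ j ≤ 2 * edgeWeight M (c e)) =
        Finset.Icc 1 (2 * edgeWeight M (c e)) := by
      ext j
      simp only [mem_filter, mem_range, Finset.mem_Icc]
      omega
    rw [this, Nat.card_Icc]
    omega
  · intro e he he'
    refine sum_eq_zero fun j hj => ?_
    rw [mem_range] at hj he
    rw [h.unused e he he' j hj]
    simp only [pairColor, pathColor, isTwo]
    split_ifs <;> omega
  · intro w hw
    refine sum_eq_zero fun i hi => ?_
    obtain ⟨p, hp⟩ := h.slot w (mem_range.1 hw) i (mem_range.1 hi)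
    rw [hp]
    exact isTwo_slotColor w i _ _

theorem sum_edgeWeight (S : Finset ℕ) : ∑ e ∈ S, edgeWeight M (c e) =
    (S.filter fun e => c e = 1).card + M * (S.filter fun e => c e = 2).card := by
  rw [card_filter, card_filter, mul_sum, ← sum_add_distrib]
  refine sum_congr rfl fun e _ => ?_
  unfold edgeWeight
  split_ifs <;> omega

/-- The number of red edges in `S` and `k` are both at most `m < M`, so they are lowest digits in
base `M` and can be compared modulo `M`; the numbers of blue edges follow by cancellation. -/
theorem sum_edgeWeight_eq_iff {S : Finset ℕ} {k l : ℕ} (hS : S ⊆ range m) (hk : k ≤ m)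
    (hM : m < M) : ∑ e ∈ S, edgeWeight M (c e) = k + M * l ↔
      (S.filter fun e => c e = 1).card = k ∧ (S.filter fun e => c e = 2).card = l := by
  rw [sum_edgeWeight]
  have h1 : (S.filter fun e => c e = 1).card ≤ m :=
    (card_filter_le _ _).trans ((card_le_card hS).trans (card_range m).le)
  constructor
  · intro h
    have h2 := congrArg (· % M) h
    simp only [Nat.add_mul_mod_self_left] at h2
    rw [Nat.mod_eq_of_lt (by omega), Nat.mod_eq_of_lt (by omega)] at h2
    refine ⟨h2, ?_⟩
    rw [h2] at h
    exact Nat.eq_of_mul_eq_mul_left (by omega) (Nat.add_left_cancel h)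
  · rintro ⟨h2, h3⟩
    rw [h2, h3]

/-- Distributes the edges at a vertex over its slots; total functions with junk values outside are
easier to use than a bijection of subtypes. -/
theorem exists_indexing {T : Finset ℕ} {a : ℕ} (h : T.card = a) : ∃ g h : ℕ → ℕ,
    (∀ e ∈ T, g e < a ∧ h (g e) = e) ∧ ∀ i < a, h i ∈ T ∧ g (h i) = i := by
  have σ : T ≃ range a := Finset.equivOfCardEq (by rw [h, card_range])
  refine ⟨fun e => if he : e ∈ T then σ ⟨e, he⟩ else 0,
    fun i => if hi : i ∈ range a then σ.symm ⟨i, hi⟩ else 0, fun e he => ?_, fun i hi => ?_⟩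
  · have h1 : ((σ ⟨e, he⟩ : range a) : ℕ) ∈ range a := Subtype.prop _
    beta_reduce
    rw [dif_pos he, dif_pos h1]
    exact ⟨mem_range.1 h1, by simp⟩
  · have hi' := mem_range.2 hi
    have h1 : ((σ.symm ⟨i, hi'⟩ : T) : ℕ) ∈ T := Subtype.prop _
    beta_reduce
    rw [dif_pos hi', dif_pos h1]
    exact ⟨h1, by simp⟩

/-- The matching of the gadgets that is given by a set of edges and an indexing of the edges at
every vertex. -/
def gadgetMatching (M : ℕ) (u v : ℕ → ℕ) (S : Finset ℕ) (g h : ℕ → ℕ → ℕ) : PairLabel → PairLabel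
  | .inl (w, i) => .inr (h w i, if u (h w i) = w then 0 else 2 * M + 1)
  | .inr (e, j) =>
    if e ∈ S then
      if j = 0 then .inl (u e, g (u e) e)
      else if j = 2 * M + 1 then .inl (v e, g (v e) e)
      else .inr (e, if j % 2 = 1 then j + 1 else j - 1)
    else .inr (e, if j % 2 = 0 then j + 1 else j - 1)

theorem exists_matching_of_edges {S : Finset ℕ} (hS : S ⊆ range m)
    (he : ∀ e < m, u e < n ∧ v e < n ∧ u e ≠ v e)
    (hd : ∀ w < n, (S.filter fun e => u e = w ∨ v e = w).card = b w) :
    ∃ f, FollowsEdges n m M b S f ∧ ∀ a ∈ gadgetLabels n m M b,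
      f a ∈ gadgetLabels n m M b ∧ f (f a) = a ∧ gadgetColor M u v c a (f a) ≠ 0 := by
  have := fun w (hw : w < n) => exists_indexing (hd w hw)
  choose! g h hg hh using this
  have hS : ∀ e ∈ S, e < m := fun e h => mem_range.1 (hS h)
  have hgu : ∀ e ∈ S, g (u e) e < b (u e) ∧ h (u e) (g (u e) e) = e := fun e h =>
    hg _ (he e (hS e h)).1 e (by simp [h])
  have hgv : ∀ e ∈ S, g (v e) e < b (v e) ∧ h (v e) (g (v e) e) = e := fun e h =>
    hg _ (he e (hS e h)).2.1 e (by simp [h])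
  refine ⟨gadgetMatching M u v S g h, ⟨?_, ?_, ?_, ?_, ?_⟩, ?_⟩
  · intro e _ he' j _
    simp [gadgetMatching, he']
  · intro e he' j h1 h2
    simp only [gadgetMatching, he', if_true]
    rw [if_neg (by omega), if_neg (by omega)]
  · intro e he'
    exact ⟨(u e, g (u e) e), by simp [gadgetMatching, he']⟩
  · intro e he'
    exact ⟨(v e, g (v e) e), by simp [gadgetMatching, he']⟩
  · intro w _ i _
    exact ⟨_, rfl⟩
  · rintro (⟨w, i⟩ | ⟨e, j⟩) ha
    · rw [inl_mem_labels] at ha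
      obtain ⟨h1, h2⟩ := hh w ha.1 i ha.2
      rw [mem_filter] at h1
      have h3 := he _ (hS _ h1.1)
      simp only [gadgetMatching, h1.1, if_true]
      by_cases h4 : u (h w i) = w
      · simp only [h4, if_true, inr_mem_labels, pairColor, slotColor]
        refine ⟨⟨hS _ h1.1, by omega⟩, ?_, by simp⟩
        rw [h2]
      · have h5 := h1.2.resolve_left h4
        simp only [h4, if_false, inr_mem_labels, pairColor, slotColor, h5]
        refine ⟨⟨hS _ h1.1, by omega⟩, ?_, by simp⟩
        rw [if_neg (by omega), if_pos trivial, h2]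
    · rw [inr_mem_labels] at ha
      by_cases he' : e ∈ S
      · have h3 := he _ ha.1
        rcases (by omega : j = 0 ∨ j = 2 * M + 1 ∨ (1 ≤ j ∧ j ≤ 2 * M)) with rfl | rfl | ⟨h1, h2⟩
        · simp only [gadgetMatching, he', if_true, inl_mem_labels, hgu e he', pairColor, slotColor,
            h3]
          simp
        · have h4 : ¬ 2 * M + 1 = 0 := by omega
          simp only [gadgetMatching, he', if_true, inl_mem_labels, hgv e he', pairColor, slotColor,
            h3, h4, if_false]
          simp
        · have h4 : gadgetMatching M u v S g h (.inr (e, j)) =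
              .inr (e, if j % 2 = 1 then j + 1 else j - 1) := by
            simp only [gadgetMatching, he', if_true]
            rw [if_neg (by omega), if_neg (by omega)]
          rw [h4, inr_mem_labels]
          refine ⟨⟨ha.1, by split_ifs <;> omega⟩, ?_, ?_⟩
          · simp only [gadgetMatching, he', if_true]
            have h5 : 1 ≤ (if j % 2 = 1 then j + 1 else j - 1) ∧
                (if j % 2 = 1 then j + 1 else j - 1) ≤ 2 * M := by split_ifs <;> omega
            rw [if_neg (show ¬ (if j % 2 = 1 then j + 1 else j - 1) = 0 by omega),
              if_neg (show ¬ (if j % 2 = 1 then j + 1 else j - 1) = 2 * M + 1 by omega),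
              odd_partner h1]
          · simp only [pairColor, pathColor]
            rw [if_pos ⟨trivial, by split_ifs <;> omega⟩]
            split_ifs <;> omega
      · simp only [gadgetMatching, he', if_false, inr_mem_labels, pairColor, pathColor]
        refine ⟨⟨ha.1, by split_ifs <;> omega⟩, ?_, ?_⟩
        · rw [even_partner]
        · rw [if_pos ⟨trivial, by split_ifs <;> omega⟩]
          split_ifs <;> omega

/-- Along a path the partner of the first vertex forces all others: either `0` is matched with `1`,
`2` with `3`, and so on up to the end, or `0` goes to a slot, `1` is matched with `2`, and so on,
which leaves the last vertex to a slot. Slots are matched with ends of used paths only, so the slots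
of `w` correspond to the used edges at `w`. -/
theorem exists_edges_of_matching (hM : 0 < M) {f : PairLabel → PairLabel}
    (he : ∀ e < m, u e ≠ v e)
    (hf : ∀ a ∈ gadgetLabels n m M b,
      f a ∈ gadgetLabels n m M b ∧ f (f a) = a ∧ gadgetColor M u v c a (f a) ≠ 0) :
    ∃ S ⊆ range m, FollowsEdges n m M b S f ∧
      ∀ w < n, (S.filter fun e => u e = w ∨ v e = w).card = b w := by
  have hnode : ∀ e < m, ∀ j < 2 * M + 2,
      (∃ w < n, ∃ i < b w, f (.inr (e, j)) = .inl (w, i) ∧ f (.inl (w, i)) = .inr (e, j) ∧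
        ((j = 0 ∧ u e = w) ∨ (j = 2 * M + 1 ∧ v e = w))) ∨
      (∃ j' < 2 * M + 2, f (.inr (e, j)) = .inr (e, j') ∧ f (.inr (e, j')) = .inr (e, j) ∧
        (j' = j + 1 ∨ j = j' + 1)) := by
    intro e he j hj
    obtain ⟨h1, h2, h3⟩ := hf (.inr (e, j)) (inr_mem_labels.2 ⟨he, hj⟩)
    rcases h4 : f (.inr (e, j)) with ⟨w, i⟩ | ⟨e', j'⟩ <;> rw [h4] at h1 h2 h3
    · rw [inl_mem_labels] at h1
      refine Or.inl ⟨w, h1.1, i, h1.2, rfl, h2, ?_⟩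
      by_contra h5
      exact h3 (if_neg h5)
    · rw [inr_mem_labels] at h1
      have h5 : e = e' ∧ (j' = j + 1 ∨ j = j' + 1) := by
        by_contra h5
        exact h3 (if_neg h5)
      obtain ⟨rfl, h5⟩ := h5
      exact Or.inr ⟨j', h1.2, rfl, h2, h5⟩
  have hslot : ∀ w < n, ∀ i < b w, ∃ e j, e < m ∧ f (.inl (w, i)) = .inr (e, j) ∧
      f (.inr (e, j)) = .inl (w, i) ∧ ((j = 0 ∧ u e = w) ∨ (j = 2 * M + 1 ∧ v e = w)) := by
    intro w hw i hi
    obtain ⟨h1, h2, h3⟩ := hf (.inl (w, i)) (inl_mem_labels.2 ⟨hw, hi⟩)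
    rcases h4 : f (.inl (w, i)) with ⟨w', i'⟩ | ⟨e, j⟩ <;> rw [h4] at h1 h2 h3
    · exact absurd rfl h3
    · rw [inr_mem_labels] at h1
      refine ⟨e, j, h1.1, rfl, h2, ?_⟩
      by_contra h5
      exact h3 (if_neg h5)
  let S := (range m).filter fun e => (f (.inr (e, 0))).isLeft
  have hS : ∀ {e}, e ∈ S ↔ e < m ∧ (f (.inr (e, 0))).isLeft := by simp [S]
  have hunused : ∀ e < m, e ∉ S → ∀ t ≤ M, f (.inr (e, 2 * t)) = .inr (e, 2 * t + 1) ∧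
      f (.inr (e, 2 * t + 1)) = .inr (e, 2 * t) := by
    intro e he' heS t ht
    induction t with
    | zero =>
      rcases hnode e he' (2 * 0) (by omega) with ⟨w, -, i, -, h1, -⟩ | ⟨j', h1, h2, h3, h4⟩
      · exact absurd (hS.2 ⟨he', by rw [h1]; rfl⟩) heS
      · obtain rfl : j' = 1 := by omega
        exact ⟨h2, h3⟩
    | succ t ih =>
      rcases hnode e he' (2 * (t + 1)) (by omega) with ⟨w, -, i, -, h1, -, h2⟩ | ⟨j', h1, h2, h3, h4⟩
      · omega
      · rcases h4 with rfl | h4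
        · exact ⟨h2, h3⟩
        · obtain rfl : j' = 2 * t + 1 := by omega
          rw [(ih (by omega)).2] at h3
          simp at h3
  have hused : ∀ e ∈ S, ∀ t < M, f (.inr (e, 2 * t + 1)) = .inr (e, 2 * t + 2) ∧
      f (.inr (e, 2 * t + 2)) = .inr (e, 2 * t + 1) := by
    intro e heS t ht
    obtain ⟨he', hl⟩ := hS.1 heS
    induction t with
    | zero =>
      rcases hnode e he' (2 * 0 + 1) (by omega) with ⟨w, -, i, -, h1, -, h2⟩ | ⟨j', h1, h2, h3, h4⟩
      · omega
      · rcases h4 with rfl | h4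
        · exact ⟨h2, h3⟩
        · obtain rfl : j' = 0 := by omega
          rw [h3] at hl
          simp at hl
    | succ t ih =>
      rcases hnode e he' (2 * (t + 1) + 1) (by omega) with
        ⟨w, -, i, -, h1, -, h2⟩ | ⟨j', h1, h2, h3, h4⟩
      · omega
      · rcases h4 with rfl | h4
        · exact ⟨h2, h3⟩
        · obtain rfl : j' = 2 * t + 2 := by omega
          rw [(ih (by omega)).2] at h3
          simp at h3
  have hfirst : ∀ e ∈ S, ∃ w < n, ∃ i < b w, f (.inr (e, 0)) = .inl (w, i) ∧
      f (.inl (w, i)) = .inr (e, 0) ∧ u e = w := by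
    intro e heS
    obtain ⟨he', hl⟩ := hS.1 heS
    rcases hnode e he' 0 (by omega) with ⟨w, h1, i, h2, h3, h4, h5⟩ | ⟨j', h1, h2, h3, h4⟩
    · exact ⟨w, h1, i, h2, h3, h4, by omega⟩
    · rw [h2] at hl
      simp at hl
  have hlast : ∀ e ∈ S, ∃ w < n, ∃ i < b w, f (.inr (e, 2 * M + 1)) = .inl (w, i) ∧
      f (.inl (w, i)) = .inr (e, 2 * M + 1) ∧ v e = w := by
    intro e heS
    obtain ⟨he', hl⟩ := hS.1 heS
    rcases hnode e he' (2 * M + 1) (by omega) with ⟨w, h1, i, h2, h3, h4, h5⟩ | ⟨j', h1, h2, h3, h4⟩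
    · exact ⟨w, h1, i, h2, h3, h4, by omega⟩
    · have h5 := (hused e heS (M - 1) (by omega)).2
      obtain rfl : j' = 2 * (M - 1) + 2 := by omega
      rw [h3] at h5
      simp only [Sum.inr.injEq, Prod.mk.injEq, true_and] at h5
      omega
  refine ⟨S, filter_subset _ _, ⟨?_, ?_, ?_, ?_, ?_⟩, ?_⟩
  · intro e he' heS j hj
    obtain ⟨h1, h2⟩ := hunused e he' heS (j / 2) (by omega)
    rcases Nat.mod_two_eq_zero_or_one j with h | h
    · rw [show 2 * (j / 2) = j by omega] at h1
      rw [h1, if_pos h]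
    · rw [show 2 * (j / 2) + 1 = j by omega] at h2
      rw [h2, if_neg (by omega), show 2 * (j / 2) = j - 1 by omega]
  · intro e heS j hj hj'
    obtain ⟨h1, h2⟩ := hused e heS ((j - 1) / 2) (by omega)
    rcases Nat.mod_two_eq_zero_or_one j with h | h
    · rw [show 2 * ((j - 1) / 2) + 2 = j by omega] at h2
      rw [h2, if_neg (by omega), show 2 * ((j - 1) / 2) + 1 = j - 1 by omega]
    · rw [show 2 * ((j - 1) / 2) + 1 = j by omega] at h1
      rw [h1, if_pos h, show 2 * ((j - 1) / 2) + 2 = j + 1 by omega]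
  · intro e heS
    obtain ⟨w, -, i, -, h, -⟩ := hfirst e heS
    exact ⟨_, h⟩
  · intro e heS
    obtain ⟨w, -, i, -, h, -⟩ := hlast e heS
    exact ⟨_, h⟩
  · intro w hw i hi
    obtain ⟨e, j, -, h, -⟩ := hslot w hw i hi
    exact ⟨_, h⟩
  · intro w hw
    choose! ε j h1 h2 h3 h4 using hslot w hw
    conv_rhs => rw [← card_range (b w)]
    symm
    refine card_bij (fun i _ => ε i) ?_ ?_ ?_
    · intro i hi
      rw [mem_range] at hi
      rw [mem_filter, hS]
      rcases h4 i hi with ⟨h5, h6⟩ | ⟨h5, h6⟩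
      · refine ⟨⟨h1 i hi, ?_⟩, Or.inl h6⟩
        rw [← h5, h3 i hi]
        rfl
      · refine ⟨?_, Or.inr h6⟩
        rw [← hS]
        -- The last vertex of an unused path has its partner inside the path, so it cannot be at a
        -- slot.
        by_contra h7
        have := (hunused _ (h1 i hi) h7 M le_rfl).2
        rw [← h5, h3 i hi] at this
        simp at this
    · intro i hi i' hi' h
      rw [mem_range] at hi hi'
      have h5 := h4 i hi
      have h6 := h4 i' hi'
      rw [h] at h5
      -- Two slots of `w` that belong to the same edge must meet the same end of its path, because
      -- the edge is not a loop; then they are the same slot.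
      have h7 := he _ (h1 i' hi')
      have h8 : j i = j i' := by
        rcases h5 with ⟨h8, h9⟩ | ⟨h8, h9⟩ <;> rcases h6 with ⟨h10, h11⟩ | ⟨h10, h11⟩
        · omega
        · exact absurd (h9.trans h11.symm) h7
        · exact absurd (h11.trans h9.symm) h7
        · omega
      have h9 := h3 i hi
      rw [h, h8, h3 i' hi'] at h9
      simpa using h9.symm
    · intro e heS
      rw [mem_filter] at heS
      rcases heS.2 with h5 | h5
      · obtain ⟨w', -, i, h6, -, h7, h8⟩ := hfirst e heS.1
        obtain rfl : w' = w := h8.symm.trans h5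
        refine ⟨i, mem_range.2 h6, ?_⟩
        have := h2 i h6
        rw [h7] at this
        simp only [Sum.inr.injEq, Prod.mk.injEq] at this
        exact this.1.symm
      · obtain ⟨w', -, i, h6, -, h7, h8⟩ := hlast e heS.1
        obtain rfl : w' = w := h8.symm.trans h5
        refine ⟨i, mem_range.2 h6, ?_⟩
        have := h2 i h6
        rw [h7] at this
        simp only [Sum.inr.injEq, Prod.mk.injEq] at this
        exact this.1.symm

theorem hasMatching_gadget {k l : ℕ} (hM : m < M) (hk : k ≤ m)
    (he : ∀ e < m, u e < n ∧ v e < n ∧ u e ≠ v e) :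
    HasMatching (gadgetLabels n m M b) (gadgetColor M u v c) (k + M * l) ↔
      HasBMatching n (List.range m) b u v c k l := by
  have hM' : 0 < M := by omega
  constructor
  · rintro ⟨f, h1, h2⟩
    obtain ⟨S, hS, h3, h4⟩ := exists_edges_of_matching hM' (fun e h => (he e h).2.2) h1
    rw [h3.card_two hM' hS] at h2
    obtain ⟨h5, h6⟩ := (sum_edgeWeight_eq_iff (c := c) (l := l) hS hk hM).1 (by omega)
    exact ⟨S, by rwa [List.toFinset_range], h5, h6, h4⟩
  · rintro ⟨S, hS, h1, h2, h3⟩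
    rw [List.toFinset_range] at hS
    obtain ⟨f, h4, h5⟩ := exists_matching_of_edges (M := M) (c := c) hS he h3
    refine ⟨f, h5, ?_⟩
    rw [h4.card_two hM' hS, (sum_edgeWeight_eq_iff hS hk hM).2 ⟨h1, h2⟩]

theorem HasBMatching.le {k l : ℕ} (h : HasBMatching n (List.range m) b u v c k l) :
    k ≤ m ∧ l ≤ m ∧ ∀ w < n, b w ≤ m := by
  obtain ⟨S, hS, rfl, rfl, h⟩ := h
  have hS : ∀ P : ℕ → Prop, ∀ [DecidablePred P], (S.filter P).card ≤ m := by
    intro P _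
    refine (card_filter_le _ _).trans ((card_le_card hS).trans ?_)
    rw [List.toFinset_range, card_range]
  exact ⟨hS _, hS _, fun w hw => h w hw ▸ hS _⟩

open Classical in
-- Capacities are read truncated, so there are only polynomially many slots. A `k` larger than the
-- number of edges would spoil the decoding of `k + M * l`; it is hopeless and sent to the
-- no-instance.
theorem genReduces_exactRedBluePerfectBMatching :
    GenReduces exactRedBluePerfectBMatching exactPerfectMatching := by
  refine ⟨fun x => encodeTable (if IsRedBlueWord x ∧ entry x 0 0 ≤ size x then
    matrixTable (gadgetLabels (width x) (size x) (size x + 1) (entry x 1))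
      (gadgetColor (size x + 1) (edgeAt x 0) (edgeAt x 1) (edgeAt x 2))
      (entry x 0 0 + (size x + 1) * entry x 0 1) else []), ?_, fun x => ?_⟩
  · have he : ∀ i j, LogFn fun x : Word => entry x i j := fun i j =>
      LogFn.entry (LogFn.const i) (LogFn.const j)
    refine LogTab.ite (LogPred.isRedBlueWord.and (LogPred.le (he 0 0) LogFn.size)) ?_ LogTab.nil
    refine LogTab.matrix_labels (γ := Word) (A := width) (C := size)
      (B := fun x => entry x 1) (D := fun x _ => 2 * (size x + 1) + 2) (e₁ := fun _ _ _ _ _ => 0)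
      (e₁₂ := fun x => slotColor (size x + 1) (edgeAt x 0) (edgeAt x 1))
      (e₂ := fun x => pathColor (size x + 1) (edgeAt x 2))
      ((he 0 0).add (LogFn.size.succ.mul (he 0 1))) LogFn.width LogFn.size
      (LogFn.entry (LogFn.const 1) LogFn.v0)
      (((LogFn.const 2).mul LogFn.size.succ).add (LogFn.const 2)) (LogFn.const 0) ?_ ?_
    · exact LogFn.ite (((LogPred.eq LogFn.v0 (LogFn.const 0)).and
        (LogPred.eq (LogFn.edgeAt 0 LogFn.v1) LogFn.v3)).or
        ((LogPred.eq LogFn.v0 (((LogFn.const 2).mul LogFn.size.succ).add (LogFn.const 1))).and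
        (LogPred.eq (LogFn.edgeAt 1 LogFn.v1) LogFn.v3))) (LogFn.const 1) (LogFn.const 0)
    · refine LogFn.ite ((LogPred.eq LogFn.v3 LogFn.v1).and ((LogPred.eq LogFn.v0 LogFn.v2.succ).or
        (LogPred.eq LogFn.v2 LogFn.v0.succ))) (LogFn.ite ((LogPred.eq
        (LogFn.v2.min LogFn.v0).mod_two (LogFn.const 1)).and (LogPred.lt (LogFn.v2.min LogFn.v0)
        ((LogFn.const 2).mul ?_))) (LogFn.const 2) (LogFn.const 1)) (LogFn.const 0)
      exact LogFn.ite (LogPred.eq (LogFn.edgeAt 2 LogFn.v3) (LogFn.const 1)) (LogFn.const 1)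
        (LogFn.ite (LogPred.eq (LogFn.edgeAt 2 LogFn.v3) (LogFn.const 2)) LogFn.size.succ
        (LogFn.const 0))
  · beta_reduce
    rw [mem_exactRedBluePerfectBMatching_iff]
    split_ifs with h
    · rw [mem_exactPerfectMatching nodup_labels, hasMatching_gadget (Nat.lt_succ_self _) h.2,
        and_iff_right h.1, and_iff_right isColoring_gadget]
      intro e he
      obtain ⟨h1, h2, h3, -⟩ := h.1.2 e he
      exact ⟨h1, h2, h3⟩
    · refine iff_of_false (fun h' => h ⟨h'.1, h'.2.le.1⟩) notMem_of_nil.1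

end Gadgets

end Logspace

namespace Logspace

open Finset

/-! ## From restricted matchings to elections -/

section Edges

/-- The handshake lemma: every edge is counted at each of its two distinct ends. For votes it says
that each voter gives exactly two points. -/
theorem sum_incidence {α : Type} (E : Finset α) {n : ℕ} (u v : α → ℕ)
    (h : ∀ e ∈ E, u e < n ∧ v e < n ∧ u e ≠ v e) :
    ∑ w ∈ range n, (E.filter fun e => u e = w ∨ v e = w).card = 2 * E.card := by
  simp only [card_filter]
  rw [sum_comm, mul_comm, card_eq_sum_ones, sum_mul]
  refine sum_congr rfl fun e he => ?_
  obtain ⟨h1, h2, h3⟩ := h e he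
  rw [← card_filter, one_mul]
  have : (range n).filter (fun w => u e = w ∨ v e = w) = {u e, v e} := by
    ext w
    simp only [mem_filter, mem_range, mem_insert, mem_singleton]
    omega
  rw [this, card_pair h3]

/-- The edges of a matching, as a set of ordered pairs. -/
theorem hasMatching_iff_edges {n k : ℕ} {col : ℕ → ℕ → ℕ} (hcol : IsColoring (List.range n) col) :
    HasMatching (List.range n) col k ↔ ∃ E : Finset (ℕ × ℕ),
      (∀ e ∈ E, e.1 < e.2 ∧ e.2 < n ∧ col e.1 e.2 ≠ 0) ∧
      (∀ c < n, (E.filter fun e => e.1 = c ∨ e.2 = c).card = 1) ∧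
      (E.filter fun e => col e.1 e.2 = 2).card = k := by
  have hsymm : ∀ u < n, ∀ v < n, col u v = col v u := fun u hu v hv =>
    ((hcol u (List.mem_range.2 hu)).2 v (List.mem_range.2 hv)).2
  constructor
  · rintro ⟨f, h1, h2⟩
    simp only [List.mem_range] at h1
    have hne : ∀ u < n, f u ≠ u := by
      intro u hu h
      have h3 := (h1 u hu).2.2
      rw [h] at h3
      exact h3 (hcol u (List.mem_range.2 hu)).1
    have hmem : ∀ {e : ℕ × ℕ}, e ∈ ((range n).filter fun u => u < f u).image (fun u => (u, f u)) ↔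
        e.1 < n ∧ e.1 < e.2 ∧ f e.1 = e.2 := by
      rintro ⟨u, v⟩
      simp only [mem_image, mem_filter, mem_range, Prod.mk.injEq]
      constructor
      · rintro ⟨u, h, rfl, rfl⟩
        exact ⟨h.1, h.2, rfl⟩
      · rintro ⟨h3, h4, rfl⟩
        exact ⟨u, ⟨h3, h4⟩, rfl, rfl⟩
    refine ⟨((range n).filter fun u => u < f u).image fun u => (u, f u), ?_, ?_, ?_⟩
    · rintro ⟨u, v⟩ he
      obtain ⟨h3, h4, h5⟩ := hmem.1 he
      dsimp only at h3 h4 h5 ⊢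
      subst h5
      exact ⟨h4, (h1 u h3).1, (h1 u h3).2.2⟩
    · intro c hc
      obtain ⟨h3, h4, -⟩ := h1 c hc
      have h5 := hne c hc
      rw [card_eq_one]
      by_cases h6 : c < f c
      · refine ⟨(c, f c), ?_⟩
        ext ⟨u, v⟩
        rw [mem_filter, hmem, mem_singleton, Prod.mk.injEq]
        constructor
        · rintro ⟨⟨h7, h8, h9⟩, rfl | rfl⟩
          · exact ⟨rfl, h9.symm⟩
          · dsimp only at h7 h8 h9 h4 h5 h6
            rw [← h9, (h1 u h7).2.1] at h6
            omega
        · rintro ⟨rfl, rfl⟩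
          exact ⟨⟨hc, h6, rfl⟩, Or.inl rfl⟩
      · refine ⟨(f c, c), ?_⟩
        ext ⟨u, v⟩
        rw [mem_filter, hmem, mem_singleton, Prod.mk.injEq]
        constructor
        · rintro ⟨⟨h7, h8, h9⟩, rfl | rfl⟩
          · dsimp only at h7 h8 h9 h6
            omega
          · dsimp only at h7 h8 h9 ⊢
            rw [← h9, (h1 u h7).2.1]
            exact ⟨rfl, rfl⟩
        · rintro ⟨rfl, rfl⟩
          exact ⟨⟨h3, by dsimp only; omega, h4⟩, Or.inr rfl⟩
    · rw [filter_image, card_image_of_injective _ fun a b h => (Prod.ext_iff.1 h).1, filter_filter]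
      rw [List.toFinset_range] at h2
      -- The involution exchanges smaller and larger ends of edges, so exactly half of the vertices
      -- on red edges are smaller ends, one for each red edge.
      have h3 : ((range n).filter fun u => u < f u ∧ col u (f u) = 2).card =
          ((range n).filter fun u => f u < u ∧ col u (f u) = 2).card := by
        refine card_bij (fun u _ => f u) ?_ ?_ ?_
        · intro u hu
          simp only [mem_filter, mem_range] at hu ⊢
          obtain ⟨h3, h4, -⟩ := h1 u hu.1
          rw [h4, hsymm _ h3 _ hu.1]
          exact ⟨h3, hu.2⟩
        · intro u hu u' hu' h
          simp only [mem_filter, mem_range] at hu hu'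
          rw [← (h1 u hu.1).2.1, h, (h1 u' hu'.1).2.1]
        · intro u hu
          simp only [mem_filter, mem_range] at hu
          obtain ⟨h3, h4, -⟩ := h1 u hu.1
          refine ⟨f u, ?_, h4⟩
          simp only [mem_filter, mem_range]
          rw [h4, hsymm _ h3 _ hu.1]
          exact ⟨h3, hu.2⟩
      have h4 : (range n).filter (fun u => col u (f u) = 2) =
          ((range n).filter fun u => u < f u ∧ col u (f u) = 2) ∪
            (range n).filter fun u => f u < u ∧ col u (f u) = 2 := by
        ext u
        simp only [mem_union, mem_filter, mem_range]
        have := hne u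
        constructor
        · rintro ⟨h5, h6⟩
          have := this h5
          omega
        · rintro (h | h) <;> exact ⟨h.1, h.2.2⟩
      rw [h4, card_union_of_disjoint, ← h3] at h2
      · change ((range n).filter fun u => u < f u ∧ col u (f u) = 2).card = k
        omega
      · rw [disjoint_filter]
        intro u _ h h'
        omega
  · rintro ⟨E, h1, h2, h3⟩
    have := fun c hc => card_eq_one.1 (h2 c hc)
    choose! ε hε using this
    have hmem : ∀ {c e}, c < n → (e ∈ E ∧ (e.1 = c ∨ e.2 = c) ↔ e = ε c) := by
      intro c e hc
      simpa only [mem_filter, mem_singleton] using Finset.ext_iff.1 (hε c hc) e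
    have hE : ∀ c < n, ε c ∈ E ∧ ((ε c).1 = c ∨ (ε c).2 = c) := fun c hc => (hmem hc).2 rfl
    let f : ℕ → ℕ := fun c => if (ε c).1 = c then (ε c).2 else (ε c).1
    have hf : ∀ c < n, f c < n ∧ f (f c) = c ∧ col c (f c) = col (ε c).1 (ε c).2 := by
      intro c hc
      obtain ⟨h4, h5⟩ := hE c hc
      obtain ⟨h6, h7, -⟩ := h1 _ h4
      by_cases h8 : (ε c).1 = c
      · have h9 : f c = (ε c).2 := if_pos h8
        have h10 : ε (f c) = ε c := ((hmem (by omega)).1 ⟨h4, Or.inr h9.symm⟩).symm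
        refine ⟨by omega, ?_, by rw [h9, h8]⟩
        change (if (ε (f c)).1 = f c then (ε (f c)).2 else (ε (f c)).1) = c
        rw [h10, if_neg (by omega), h8]
      · have h9 : f c = (ε c).1 := if_neg h8
        have h10 : ε (f c) = ε c := ((hmem (by omega)).1 ⟨h4, Or.inl h9.symm⟩).symm
        have h11 := h5.resolve_left h8
        refine ⟨by omega, ?_, ?_⟩
        · change (if (ε (f c)).1 = f c then (ε (f c)).2 else (ε (f c)).1) = c
          rw [h10, if_pos h9.symm, h11]
        · rw [h9, h11, hsymm _ hc _ (by omega)]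
    refine ⟨f, fun c hc => ?_, ?_⟩
    · rw [List.mem_range] at hc ⊢
      obtain ⟨h4, h5, h6⟩ := hf c hc
      exact ⟨h4, h5, h6 ▸ (h1 _ (hE c hc).1).2.2⟩
    -- The handshake lemma for the red edges of `E`: a vertex `c` contributes one if its unique edge
    -- `ε c` is red and nothing otherwise.
    · rw [← h3, ← sum_incidence (n := n) _ Prod.fst Prod.snd, List.toFinset_range, card_filter]
      · refine sum_congr rfl fun c hc => ?_
        rw [mem_range] at hc
        rw [filter_filter, (hf c hc).2.2]
        have : E.filter (fun e => col e.1 e.2 = 2 ∧ (e.1 = c ∨ e.2 = c)) =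
            if col (ε c).1 (ε c).2 = 2 then {ε c} else ∅ := by
          ext e
          rw [mem_filter, and_left_comm, hmem hc]
          split_ifs with h4
          · rw [mem_singleton]
            exact ⟨fun h => h.2, fun h => ⟨h ▸ h4, h⟩⟩
          · refine iff_of_false (fun h => h4 (h.2 ▸ h.1)) (notMem_empty _)
        rw [this]
        split_ifs <;> rfl
      · intro e he
        obtain ⟨h4, h5, -⟩ := h1 e (mem_filter.1 he).1
        exact ⟨by omega, h5, by omega⟩

def edgeList (n : ℕ) (col : ℕ → ℕ → ℕ) (a : ℕ) : List (ℕ × ℕ) :=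
  (pairList n fun _ => n).filter fun e => e.1 < e.2 ∧ col e.1 e.2 = a

theorem mem_edgeList {n a : ℕ} {col : ℕ → ℕ → ℕ} {e : ℕ × ℕ} :
    e ∈ edgeList n col a ↔ e.1 < e.2 ∧ e.2 < n ∧ col e.1 e.2 = a := by
  simp only [edgeList, List.mem_filter, mem_pairList, decide_eq_true_eq]
  constructor
  · rintro ⟨h1, h2, h3⟩
    exact ⟨h2, h1.2, h3⟩
  · rintro ⟨h1, h2, h3⟩
    exact ⟨⟨by omega, h2⟩, h1, h3⟩

theorem nodup_edgeList (n : ℕ) (col : ℕ → ℕ → ℕ) (a : ℕ) : (edgeList n col a).Nodup :=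
  (nodup_pairList _ _).filter _

theorem two_mul_length_edgeList {n a : ℕ} {col : ℕ → ℕ → ℕ} (h : IsColoring (List.range n) col)
    (ha : a ≠ 0) : 2 * (edgeList n col a).length =
      ((range n ×ˢ range n).filter fun p => col p.1 p.2 = a).card := by
  have hc : ∀ u < n, col u u = 0 ∧ ∀ v < n, col u v = col v u := fun u hu =>
    ⟨(h u (List.mem_range.2 hu)).1, fun v hv =>
      ((h u (List.mem_range.2 hu)).2 v (List.mem_range.2 hv)).2⟩
  rw [← List.toFinset_card_of_nodup (nodup_edgeList n col a)]
  have e : (range n ×ˢ range n).filter (fun p => col p.1 p.2 = a) =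
      (edgeList n col a).toFinset ∪ (edgeList n col a).toFinset.image Prod.swap := by
    ext ⟨u, v⟩
    simp only [mem_filter, mem_product, mem_range, mem_union, List.mem_toFinset, mem_edgeList,
      mem_image, Prod.exists, Prod.swap_prod_mk, Prod.mk.injEq]
    constructor
    · rintro ⟨⟨hu, hv⟩, h1⟩
      rcases lt_trichotomy u v with h2 | rfl | h2
      · exact Or.inl ⟨h2, hv, h1⟩
      · exact absurd ((hc u hu).1.symm.trans h1).symm ha
      · exact Or.inr ⟨v, u, ⟨h2, hu, by rw [(hc v hv).2 u hu, h1]⟩, rfl, rfl⟩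
    · rintro (⟨h1, h2, h3⟩ | ⟨v, u, ⟨h1, h2, h3⟩, rfl, rfl⟩)
      · exact ⟨⟨by omega, h2⟩, h3⟩
      · exact ⟨⟨h2, by omega⟩, by rw [(hc u h2).2 v (by omega), h3]⟩
  rw [e, card_union_of_disjoint, card_image_of_injective _ Prod.swap_injective, two_mul]
  rw [Finset.disjoint_left]
  rintro ⟨u, v⟩ h1 h2
  simp only [List.mem_toFinset, mem_edgeList, mem_image, Prod.exists, Prod.swap_prod_mk,
    Prod.mk.injEq] at h1 h2
  obtain ⟨v', u', h2, rfl, rfl⟩ := h2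
  omega

/-- A ranking that starts with `u` and `v`. -/
def edgeVote (e : ℕ × ℕ) (j : ℕ) : ℕ :=
  Equiv.swap 0 e.1 (Equiv.swap 1 (Equiv.swap 0 e.1 e.2) j)

theorem swap_lt {m a b j : ℕ} (ha : a < m) (hb : b < m) (hj : j < m) : Equiv.swap a b j < m := by
  rw [Equiv.swap_apply_def]
  split_ifs <;> assumption

theorem isRanking_edgeVote {m : ℕ} {e : ℕ × ℕ} (h : e.1 < m) (h' : e.2 < m) (hne : e.1 ≠ e.2) :
    IsRanking m (edgeVote e) := by
  intro j hj
  refine ⟨swap_lt (by omega) h (swap_lt (by omega) (swap_lt (by omega) h h') hj), fun j' _ h => ?_⟩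
  simpa [edgeVote] using h

theorem approves_edgeVote {m c : ℕ} {e : ℕ × ℕ} (hm : 1 < m) (hne : e.1 ≠ e.2) :
    Approves m (edgeVote e) c ↔ e.1 = c ∨ e.2 = c := by
  -- The inner transposition brings to place `1` whatever the outer one maps to `e.2`. It must not
  -- disturb place `0`, which is guaranteed by `e.1 ≠ e.2`.
  have h1 : Equiv.swap 0 e.1 e.2 ≠ 0 := by
    rw [Equiv.swap_apply_def]
    split_ifs <;> omega
  have h2 : edgeVote e 0 = e.1 := by
    rw [edgeVote, Equiv.swap_apply_of_ne_of_ne one_ne_zero.symm h1.symm, Equiv.swap_apply_left]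
  have h3 : edgeVote e 1 = e.2 := by
    rw [edgeVote, Equiv.swap_apply_left, Equiv.swap_apply_self]
  rw [Approves, h2, h3, and_iff_right hm]

/-- The registered voters are the red edges and one more voter; the unregistered voters are the
other edges. -/
theorem hasControl_edges {n N k : ℕ} {col : ℕ → ℕ → ℕ} (h : IsColoring (List.range n) col)
    (hn : n = 2 * N) (hk : k ≤ N) (hred : (edgeList n col 2).length = N) :
    HasControl (n + 2) n (N - k) (edgeList n col 2 ++ [(n, n + 1)]) (edgeList n col 1)
      edgeVote edgeVote ↔ HasMatching (List.range n) col k := by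
  have hmem : ∀ {a : ℕ} {e : ℕ × ℕ}, e ∈ (edgeList n col a).toFinset ↔
      e.1 < e.2 ∧ e.2 < n ∧ col e.1 e.2 = a := by
    intro a e
    rw [List.mem_toFinset, mem_edgeList]
  have hmem' : ∀ {e : ℕ × ℕ}, e ∈ (edgeList n col 2 ++ [(n, n + 1)]).toFinset ↔
      e ∈ (edgeList n col 2).toFinset ∨ e = (n, n + 1) := by
    intro e
    simp [or_comm]
  have happ : ∀ (S : Finset (ℕ × ℕ)) (c : ℕ), (∀ e ∈ S, e.1 < e.2) →
      (S.filter fun e => Approves (n + 2) (edgeVote e) c) =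
        S.filter fun e => e.1 = c ∨ e.2 = c := by
    intro S c hS
    refine filter_congr fun e he => approves_edgeVote (by omega) (hS e he).ne
  rw [hasMatching_iff_edges h]
  unfold HasControl
  rw [List.length_append, hred, List.length_singleton]
  constructor
  · rintro ⟨A, hA, B, hB, h1, h2, h3⟩
    have hA1 : ∀ e ∈ A, e = (n, n + 1) ∨ (e.1 < e.2 ∧ e.2 < n ∧ col e.1 e.2 = 2) := fun e he =>
      (hmem'.1 (hA he)).symm.imp_right hmem.1
    have hB1 : ∀ e ∈ B, e.1 < e.2 ∧ e.2 < n ∧ col e.1 e.2 = 1 := fun e he => hmem.1 (hB he)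
    have hA2 : ∀ e ∈ A, e.1 < e.2 := by
      intro e he
      rcases hA1 e he with rfl | h4
      · simp
      · exact h4.1
    have hB2 : ∀ e ∈ B, e.1 < e.2 := fun e he => (hB1 e he).1
    have h3 : ∀ c < n + 2, (A.filter fun e => e.1 = c ∨ e.2 = c).card +
        (B.filter fun e => e.1 = c ∨ e.2 = c).card ≤
        (A.filter fun e => e.1 = n ∨ e.2 = n).card + (B.filter fun e => e.1 = n ∨ e.2 = n).card := by
      intro c hc
      have := h3 c hc
      rwa [happ _ _ hA2, happ _ _ hB2, happ _ _ hA2, happ _ _ hB2] at this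
    have hBn : (B.filter fun e => e.1 = n ∨ e.2 = n) = ∅ := by
      rw [filter_eq_empty_iff]
      intro e he
      have := hB1 e he
      omega
    have hAn : (A.filter fun e => e.1 = n ∨ e.2 = n) ⊆ {(n, n + 1)} := by
      intro e he
      rw [mem_filter] at he
      rw [mem_singleton]
      rcases hA1 e he.1 with h4 | h4
      · exact h4
      · omega
    rw [hBn, card_empty] at h3
    -- Without this voter `p` would have no points, and as a winner would leave none to anybody; but
    -- `k + 1` voters are kept, and each gives points.
    have hpv : (n, n + 1) ∈ A := by
      by_contra hpv
      have h4 : (A.filter fun e => e.1 = n ∨ e.2 = n) = ∅ := by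
        rw [eq_empty_iff_forall_notMem]
        intro e he
        have h5 := mem_singleton.1 (hAn he)
        exact hpv (h5 ▸ (mem_filter.1 he).1)
      rw [h4, card_empty] at h3
      obtain ⟨e, he⟩ := card_pos.1 (by omega : 0 < A.card)
      have h5 := h3 e.1 (by
        rcases hA1 e he with rfl | h5
        · simp
        · omega)
      have h6 : 0 < (A.filter fun e' => e'.1 = e.1 ∨ e'.2 = e.1).card :=
        card_pos.2 ⟨e, mem_filter.2 ⟨he, Or.inl rfl⟩⟩
      omega
    have h4 := card_le_card hAn
    rw [card_singleton] at h4
    have hA3 : ∀ e ∈ A.erase (n, n + 1), e.1 < e.2 ∧ e.2 < n ∧ col e.1 e.2 = 2 := fun e he =>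
      (hA1 e (mem_erase.1 he).2).resolve_left (mem_erase.1 he).1
    have hdisj : Disjoint (A.erase (n, n + 1)) B := by
      rw [Finset.disjoint_left]
      intro e he he'
      have := hA3 e he
      have := hB1 e he'
      omega
    have hE : ∀ e ∈ A.erase (n, n + 1) ∪ B, e.1 < e.2 ∧ e.2 < n ∧ col e.1 e.2 ≠ 0 := by
      intro e he
      rcases mem_union.1 he with he | he
      · have := hA3 e he
        exact ⟨this.1, this.2.1, by omega⟩
      · have := hB1 e he
        exact ⟨this.1, this.2.1, by omega⟩
    have hcard : (A.erase (n, n + 1) ∪ B).card = N := by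
      rw [card_union_of_disjoint hdisj, card_erase_of_mem hpv]
      omega
    refine ⟨A.erase (n, n + 1) ∪ B, hE, ?_, ?_⟩
    -- The `N` edges give `2 * N = n` points to the `n` vertices, and no vertex may exceed the
    -- single point of `p`; so each vertex gets exactly one.
    · have h5 := sum_incidence (n := n) (A.erase (n, n + 1) ∪ B) Prod.fst Prod.snd fun e he => by
        have := hE e he
        exact ⟨by omega, by omega, by omega⟩
      have h6 : ∀ c ∈ range n,
          ((A.erase (n, n + 1) ∪ B).filter fun e => e.1 = c ∨ e.2 = c).card ≤ 1 := by
        intro c hc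
        rw [mem_range] at hc
        rw [filter_union]
        refine (card_union_le _ _).trans ?_
        have h7 := h3 c (by omega)
        have h8 := card_le_card (filter_subset_filter (fun e => e.1 = c ∨ e.2 = c)
          (erase_subset (n, n + 1) A))
        omega
      have h7 := (sum_eq_sum_iff_of_le h6).1 (by
        rw [h5, hcard, sum_const, card_range, smul_eq_mul]
        omega)
      exact fun c hc => h7 c (mem_range.2 hc)
    · have h5 : (A.erase (n, n + 1) ∪ B).filter (fun e => col e.1 e.2 = 2) = A.erase (n, n + 1) := by
        rw [filter_union, filter_true_of_mem fun e he => (hA3 e he).2.2,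
          filter_false_of_mem fun e he => by have := hB1 e he; omega, union_empty]
      rw [h5, card_erase_of_mem hpv]
      omega
  · rintro ⟨E, h1, h2, h3⟩
    have h4 := sum_incidence (n := n) E Prod.fst Prod.snd fun e he => by
      have := h1 e he
      exact ⟨by omega, by omega, by omega⟩
    rw [sum_congr rfl fun c hc => h2 c (mem_range.1 hc), sum_const, card_range, smul_eq_mul] at h4
    have h5 := card_filter_add_card_filter_not (s := E) fun e => col e.1 e.2 = 2
    have hpv : (n, n + 1) ∉ E.filter fun e => col e.1 e.2 = 2 := by
      intro h6
      have := (h1 _ (mem_filter.1 h6).1).2.1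
      simp at this
    have hA2 : ∀ e ∈ insert (n, n + 1) (E.filter fun e => col e.1 e.2 = 2), e.1 < e.2 := by
      intro e he
      rcases mem_insert.1 he with rfl | he
      · simp
      · exact (h1 e (mem_filter.1 he).1).1
    have hB2 : ∀ e ∈ E.filter fun e => ¬ col e.1 e.2 = 2, e.1 < e.2 := fun e he =>
      (h1 e (mem_filter.1 he).1).1
    refine ⟨insert (n, n + 1) (E.filter fun e => col e.1 e.2 = 2), ?_,
      E.filter fun e => ¬ col e.1 e.2 = 2, ?_, ?_, by omega, ?_⟩
    · intro e he
      rw [hmem', hmem]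
      rcases mem_insert.1 he with he | he
      · exact Or.inr he
      · have := h1 e (mem_filter.1 he).1
        exact Or.inl ⟨this.1, this.2.1, (mem_filter.1 he).2⟩
    · intro e he
      rw [mem_filter] at he
      have h6 := h1 e he.1
      have h7 := ((h e.1 (List.mem_range.2 (by omega))).2 e.2 (List.mem_range.2 h6.2.1)).1
      rw [hmem]
      exact ⟨h6.1, h6.2.1, by omega⟩
    · rw [card_insert_of_notMem hpv, h3]
      omega
    · intro c hc
      rw [happ _ _ hA2, happ _ _ hB2, happ _ _ hA2, happ _ _ hB2]
      have h6 : 1 ≤ ((insert (n, n + 1) (E.filter fun e => col e.1 e.2 = 2)).filter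
          fun e => e.1 = n ∨ e.2 = n).card :=
        card_pos.2 ⟨(n, n + 1), mem_filter.2 ⟨mem_insert_self _ _, Or.inl rfl⟩⟩
      have h7 := card_filter_add_card_filter_not (s := E.filter fun e => e.1 = c ∨ e.2 = c)
        fun e => col e.1 e.2 = 2
      rw [filter_comm, filter_comm (p := fun e : ℕ × ℕ => e.1 = c ∨ e.2 = c)] at h7
      -- It suffices that every candidate has at most one point: a vertex gets it from its matching
      -- edge, and `n` and `n + 1` can get it only from the additional voter.
      refine le_trans ?_ (h6.trans (Nat.le_add_right _ _))
      rw [filter_insert]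
      by_cases hcn : c < n
      · rw [if_neg (by dsimp only; omega), h7, h2 c hcn]
      · have h8 : (E.filter fun e => e.1 = c ∨ e.2 = c) = ∅ := by
          rw [filter_eq_empty_iff]
          intro e he
          have := h1 e he
          omega
        rw [h8, card_empty] at h7
        split_ifs
        · have := card_insert_le (n, n + 1) ((E.filter fun e => col e.1 e.2 = 2).filter
            fun e => e.1 = c ∨ e.2 = c)
          omega
        · omega

end Edges

section

variable {γ : Type} [Ctx γ]

theorem LogFn.swap {a b f : γ → ℕ} (ha : LogFn a) (hb : LogFn b) (hf : LogFn f) :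
    LogFn fun c => Equiv.swap (a c) (b c) (f c) := by
  simp only [Equiv.swap_apply_def]
  exact LogFn.ite (LogPred.eq hf ha) hb (LogFn.ite (LogPred.eq hf hb) ha hf)

theorem LogFn.edgeVote {a b f : γ → ℕ} (ha : LogFn a) (hb : LogFn b) (hf : LogFn f) :
    LogFn fun c => edgeVote (a c, b c) (f c) :=
  (LogFn.const 0).swap ha ((LogFn.const 1).swap ((LogFn.const 0).swap ha hb) hf)

theorem LogRow.range {n : γ → ℕ} (hn : LogFn n) : LogRow fun c => List.range (n c) := by
  simpa using LogRow.map (f := fun _ i => i) hn LogFn.v0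

theorem map_filter_eq_flatMap {α β : Type} (L : List α) (P : α → Prop) [DecidablePred P]
    (f : α → β) : (L.filter fun a => P a).map f = L.flatMap fun a => if P a then [f a] else [] := by
  induction L with
  | nil => rfl
  | cons a L ih =>
    rw [List.flatMap_cons, ← ih, List.filter_cons]
    by_cases h : P a <;> simp [h]

theorem LogTab.map_edgeList {n : γ → ℕ} {col : γ → ℕ → ℕ → ℕ} {f : γ → ℕ × ℕ → List ℕ} (a : ℕ)
    (hn : LogFn n) (hcol : LogFn fun p : (γ × ℕ) × ℕ => col p.1.1 p.1.2 p.2)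
    (hf : LogRow fun p : (γ × ℕ) × ℕ => f p.1.1 (p.1.2, p.2)) :
    LogTab fun c => (edgeList (n c) (col c) a).map (f c) := by
  simp only [edgeList, map_filter_eq_flatMap, pairList, List.flatMap_assoc, List.flatMap_map]
  refine LogTab.flatMap (r := fun c u => (List.range (n c)).flatMap fun v =>
    if u < v ∧ col c u v = a then [f c (u, v)] else []) hn ?_
  exact LogTab.flatMap (r := fun (p : γ × ℕ) v =>
    if p.2 < v ∧ col p.1 p.2 v = a then [f p.1 (p.2, v)] else []) hn.weak
    (LogTab.ite ((LogPred.lt LogFn.v1 LogFn.v0).and (LogPred.eq hcol (LogFn.const a)))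
      (LogTab.single hf) LogTab.nil)

open Classical in
-- The condition `redPairs x = order x` is the restriction itself, since `redPairs` counts every red
-- edge twice. The condition on `entry x 0 0` is necessary for a matching and prevents truncation in
-- the number of voters to be replaced.
theorem genReduces_restrictedExactPerfectMatching :
    GenReduces restrictedExactPerfectMatching (ccrvExact twoApproval) := by
  refine ⟨fun x => encodeTable (if IsMatchingWord x ∧ redPairs x = order x ∧
    entry x 0 0 ≤ order x / 2 then controlTable (order x + 2) (order x)
      (order x / 2 - entry x 0 0) (edgeList (order x) (colorAt x) 2 ++ [(order x, order x + 1)])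
      (edgeList (order x) (colorAt x) 1) edgeVote edgeVote else []), ?_, fun x => ?_⟩
  · have hk : LogFn fun x : Word => entry x 0 0 := LogFn.entry (LogFn.const 0) (LogFn.const 0)
    have ho : LogFn fun x : Word => order x := LogFn.order
    have ho2 : LogFn fun x : Word => order x + 2 := ho.succ.succ
    have hrow : ∀ a, LogRow fun p : (Word × ℕ) × ℕ =>
        a :: (List.range (order p.1.1 + 2)).map (edgeVote (p.1.2, p.2)) := fun a =>
      LogRow.cons (LogFn.const a) (LogRow.map (f := fun (p : (Word × ℕ) × ℕ) j =>
        edgeVote (p.1.2, p.2) j) ho2.weak.weak (LogFn.edgeVote LogFn.v2 LogFn.v1 LogFn.v0))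
    refine LogTab.ite (LogPred.isMatchingWord.and ((LogPred.eq LogFn.redPairs LogFn.order).and
      (LogPred.le hk ho.half))) ?_ LogTab.nil
    refine LogTab.cons ((LogRow.single ho).append (LogRow.single (ho.half.sub hk)))
      (LogTab.cons (LogRow.range ho2) (LogTab.append ?_ ?_))
    · simp only [List.map_append, List.map_singleton]
      refine LogTab.append (LogTab.map_edgeList (col := colorAt) (f := fun x e =>
        0 :: (List.range (order x + 2)).map (edgeVote e)) 2 ho (LogFn.v1.colorAt LogFn.v0)
        (hrow 0)) (LogTab.single (LogRow.cons (LogFn.const 0) ?_))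
      exact LogRow.map (f := fun (x : Word) j => edgeVote (order x, order x + 1) j) ho2
        (LogFn.edgeVote ho.weak ho.succ.weak LogFn.v0)
    · exact LogTab.map_edgeList (col := colorAt) (f := fun x e =>
        1 :: (List.range (order x + 2)).map (edgeVote e)) 1 ho (LogFn.v1.colorAt LogFn.v0) (hrow 1)
  · beta_reduce
    rw [mem_restrictedExactPerfectMatching_iff, ← redPairs_eq]
    split_ifs with h
    · obtain ⟨h1, h2, h3⟩ := h
      obtain ⟨N, hN⟩ := even_redPairs h1
      have h4 := two_mul_length_edgeList h1.isColoring two_ne_zero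
      rw [← redPairs_eq] at h4
      have hnot : (order x, order x + 1) ∉ edgeList (order x) (colorAt x) 2 := by
        rw [mem_edgeList]
        simp
      rw [mem_ccrvExact, hasControl_edges h1.isColoring (by omega) h3 (by omega), and_iff_right h1,
        and_iff_left h2, and_iff_right]
      · refine ⟨by omega, fun e he => ?_, fun e he => ?_⟩
        · rw [List.mem_append, mem_edgeList, List.mem_singleton] at he
          rcases he with he | rfl
          · exact isRanking_edgeVote (by omega) (by omega) (by omega)
          · exact isRanking_edgeVote (by simp) (by simp) (by simp)
        · rw [mem_edgeList] at he
          exact isRanking_edgeVote (by omega) (by omega) (by omega)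
      · exact (nodup_edgeList _ _ _).append (List.nodup_singleton _) (by simpa using hnot)
      · exact nodup_edgeList _ _ _
    · refine iff_of_false (fun h' => h ⟨h'.1, h'.2.2, ?_⟩) notMem_of_nil.2.2.2
      have := h'.2.1.two_mul_le
      rw [List.length_range] at this
      omega

end

end Logspace

namespace Logspace

open Finset

/-! ## From elections to `b`-matchings -/

section Exchange

/-- Elements with the property `P` can be exchanged for others, as long as there are any. -/
theorem exists_exchange {α : Type} [DecidableEq α] {U A : Finset α} (hA : A ⊆ U) (P : α → Prop)
    [DecidablePred P] : ∃ A' ⊆ U, A'.card = A.card ∧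
      (A'.filter P).card = min A.card (U.filter P).card ∧
      ∀ (Q : α → Prop) [DecidablePred Q],
        (A'.filter Q).card + (A.filter P).card ≤ (A.filter Q).card + (A'.filter P).card := by
  -- The set `X` keeps the elements of `A` with property `P` and adds as many more of them as fit;
  -- `Y` fills up to the size of `A` with old elements that lack `P`.
  have h0 := card_filter_add_card_filter_not (s := A) P
  have h1 : A.filter P ⊆ U.filter P := filter_subset_filter _ hA
  obtain ⟨X, h2, h3, h4⟩ := exists_subsuperset_card_eq (n := min A.card (U.filter P).card) h1
    (le_min (card_filter_le _ _) (card_le_card h1)) (min_le_right _ _)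
  have h5 := card_le_card h2
  obtain ⟨Y, h6, h7⟩ := exists_subset_card_eq
    (show A.card - X.card ≤ (A.filter fun a => ¬ P a).card by omega)
  have hXP : ∀ a ∈ X, P a := fun a ha => (mem_filter.1 (h3 ha)).2
  have hYP : ∀ a ∈ Y, ¬ P a := fun a ha => (mem_filter.1 (h6 ha)).2
  have hd : Disjoint X Y := Finset.disjoint_left.2 fun a ha ha' => hYP a ha' (hXP a ha)
  have h8 : (X ∪ Y).filter P = X := by
    rw [filter_union, filter_true_of_mem hXP, filter_false_of_mem hYP, union_empty]
  refine ⟨X ∪ Y, union_subset (h3.trans (filter_subset _ _))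
    ((h6.trans (filter_subset _ _)).trans hA), ?_, by rw [h8, h4], fun Q _ => ?_⟩
  · rw [card_union_of_disjoint hd]
    omega
  -- Whatever `Q` is, it gains at most the newly added elements, and each of these is a gain for
  -- `P`.
  · have h9 : (X ∪ Y).filter Q ⊆ A.filter Q ∪ (X \ A.filter P) := by
      intro a ha
      rw [mem_filter, mem_union] at ha
      rw [mem_union, mem_filter, mem_sdiff]
      rcases ha with ⟨ha | ha, hQ⟩
      · by_cases h10 : a ∈ A.filter P
        · exact Or.inl ⟨(mem_filter.1 h10).1, hQ⟩
        · exact Or.inr ⟨ha, h10⟩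
      · exact Or.inl ⟨(mem_filter.1 (h6 ha)).1, hQ⟩
    have h10 := (card_le_card h9).trans (card_union_le _ _)
    rw [card_sdiff_of_subset h2] at h10
    rw [h8]
    omega

theorem card_filter_disjSum {α β : Type} (A : Finset α) (B : Finset β) (P : α ⊕ β → Prop)
    [DecidablePred P] : ((A.disjSum B).filter P).card =
      (A.filter fun a => P (.inl a)).card + (B.filter fun b => P (.inr b)).card := by
  rw [card_filter, sum_disjSum, card_filter, card_filter]

theorem sum_pairList_toFinset {A : ℕ} {B : ℕ → ℕ} (f : ℕ × ℕ → ℕ) :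
    ∑ p ∈ (pairList A B).toFinset, f p = ∑ i ∈ range A, ∑ j ∈ range (B i), f (i, j) := by
  rw [List.sum_toFinset _ (nodup_pairList A B), sum_pairList]

end Exchange

section Slack

variable {α β : Type}

/-- The votes, and `t` edges to an additional vertex for every candidate other than `p`. -/
def slackList (m p t : ℕ) (L : List α) (L' : List β) : List (α ⊕ (β ⊕ ℕ × ℕ)) :=
  L.map .inl ++ (L'.map fun b => .inr (.inl b)) ++
    (pairList m fun c => if c = p then 0 else t).map fun q => .inr (.inr q)

def slackFst (w : α → ℕ → ℕ) (w' : β → ℕ → ℕ) : α ⊕ (β ⊕ ℕ × ℕ) → ℕ :=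
  Sum.elim (fun a => w a 0) (Sum.elim (fun b => w' b 0) Prod.fst)

def slackSnd (m : ℕ) (w : α → ℕ → ℕ) (w' : β → ℕ → ℕ) : α ⊕ (β ⊕ ℕ × ℕ) → ℕ :=
  Sum.elim (fun a => w a 1) (Sum.elim (fun b => w' b 1) fun _ => m)

def slackColor : α ⊕ (β ⊕ ℕ × ℕ) → ℕ := Sum.elim (fun _ => 1) (Sum.elim (fun _ => 2) fun _ => 0)

/-- Every final electorate has `r` voters and hence gives `2 * r` points in all, so the candidates
together lack `m * t - 2 * r` points of `t` each. -/
def slackCapacity (m t r w : ℕ) : ℕ := if w = m then m * t - 2 * r else t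

theorem nodup_slackList {m p t : ℕ} {L : List α} {L' : List β} (hL : L.Nodup) (hL' : L'.Nodup) :
    (slackList m p t L L').Nodup := by
  refine ((hL.map Sum.inl_injective).append (hL'.map ?_) ?_).append ((nodup_pairList _ _).map ?_) ?_
  · exact Sum.inr_injective.comp Sum.inl_injective
  · rw [List.disjoint_left]; simp
  · exact Sum.inr_injective.comp Sum.inr_injective
  · rw [List.disjoint_left]; simp

variable [DecidableEq α] [DecidableEq β]

theorem slackList_toFinset {m p t : ℕ} {L : List α} {L' : List β} :
    (slackList m p t L L').toFinset = L.toFinset.disjSum (L'.toFinset.disjSum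
      (pairList m fun c => if c = p then 0 else t).toFinset) := by
  ext (a | b | q) <;> simp [slackList]

/-- The number `t` is the largest score that `p` can have with `r - k` kept and `k` added voters. By
exchanging voters a winning `p` can be given this score and still wins; the missing points of the
others are then made up by slack edges. Conversely `p` has no slack edges, so a `b`-matching gives
it exactly `t` points and all others at most `t`. -/
theorem hasControl_iff_hasBMatching {m p k t : ℕ} {L : List α} {L' : List β} {w : α → ℕ → ℕ}
    {w' : β → ℕ → ℕ} (hm : 1 < m) (hp : p < m)
    (hw : ∀ e ∈ L, IsRanking m (w e)) (hw' : ∀ e ∈ L', IsRanking m (w' e)) (hk : k ≤ L.length)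
    (ht : t = min (L.length - k) (L.toFinset.filter fun e => Approves m (w e) p).card +
      min k (L'.toFinset.filter fun e => Approves m (w' e) p).card) :
    HasControl m p k L L' w w' ↔ HasBMatching (m + 1) (slackList m p t L L')
      (slackCapacity m t L.length) (slackFst w w') (slackSnd m w w') slackColor
      (L.length - k) k := by
  have htop : ∀ v : ℕ → ℕ, IsRanking m v → v 0 < m ∧ v 1 < m ∧ v 0 ≠ v 1 := fun v hv =>
    ⟨(hv 0 (by omega)).1, (hv 1 hm).1, fun h => zero_ne_one ((hv 0 (by omega)).2 1 hm h)⟩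
  have happ : ∀ (v : ℕ → ℕ) (c : ℕ), Approves m v c ↔ v 0 = c ∨ v 1 = c := by
    intro v c
    rw [Approves, and_iff_right hm]
  have hdeg : ∀ (A : Finset α) (B : Finset β) (X : Finset (ℕ × ℕ)) (c : ℕ), c < m →
      ((A.disjSum (B.disjSum X)).filter fun e => slackFst w w' e = c ∨ slackSnd m w w' e = c).card =
        (A.filter fun e => Approves m (w e) c).card + (B.filter fun e => Approves m (w' e) c).card +
          (X.filter fun q => q.1 = c).card := by
    intro A B X c hc
    rw [card_filter_disjSum, card_filter_disjSum, add_assoc]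
    simp only [happ]
    congr 3
    refine filter_congr fun q _ => or_iff_left ?_
    change m ≠ c
    omega
  have hred : ∀ (A : Finset α) (B : Finset β) (X : Finset (ℕ × ℕ)),
      ((A.disjSum (B.disjSum X)).filter fun e => slackColor e = 1).card = A.card ∧
      ((A.disjSum (B.disjSum X)).filter fun e => slackColor e = 2).card = B.card := by
    intro A B X
    rw [card_filter_disjSum, card_filter_disjSum, card_filter_disjSum, card_filter_disjSum]
    simp [slackColor]
  constructor
  · rintro ⟨A, hA, B, hB, h1, h2, h3⟩
    obtain ⟨A', a1, a2, a3, a4⟩ := exists_exchange hA fun e => Approves m (w e) p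
    obtain ⟨B', b1, b2, b3, b4⟩ := exists_exchange hB fun e => Approves m (w' e) p
    have hA1 : A.card = L.length - k := by omega
    rw [hA1] at a2 a3
    rw [h2] at b2 b3
    let sc : ℕ → ℕ := fun c => (A'.filter fun e => Approves m (w e) c).card +
      (B'.filter fun e => Approves m (w' e) c).card
    have hsp : sc p = t := by
      change _ + _ = t
      rw [a3, b3, ht]
    have hsc : ∀ c < m, sc c ≤ t := by
      intro c hc
      have h4 := h3 c hc
      have h5 := a4 fun e => Approves m (w e) c
      have h6 := b4 fun e => Approves m (w' e) c
      rw [← hsp]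
      change _ + _ ≤ _ + _
      omega
    have hsum : ∑ c ∈ range m, sc c = 2 * L.length := by
      have h4 := sum_incidence (n := m) A' (fun e => w e 0) (fun e => w e 1) fun e he =>
        htop _ (hw e (List.mem_toFinset.1 (a1 he)))
      have h5 := sum_incidence (n := m) B' (fun e => w' e 0) (fun e => w' e 1) fun e he =>
        htop _ (hw' e (List.mem_toFinset.1 (b1 he)))
      simp only [sc, happ, sum_add_distrib]
      rw [h4, h5, a2, b2]
      omega
    have hX : ∀ c < m, ((pairList m fun c => t - sc c).toFinset.filter fun q => q.1 = c).card =
        t - sc c := by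
      intro c hc
      rw [card_filter, sum_pairList_toFinset, sum_eq_single_of_mem c (mem_range.2 hc)]
      · simp
      · intro i _ hi
        simp [hi]
    have hXcard : (pairList m fun c => t - sc c).toFinset.card = m * t - 2 * L.length := by
      rw [card_eq_sum_ones, sum_pairList_toFinset]
      -- No subtraction is truncated, because all scores are at most `t`; so the number of slack
      -- edges is the capacity of the additional vertex.
      have h4 : ∑ c ∈ range m, (t - sc c) + ∑ c ∈ range m, sc c = m * t := by
        rw [← sum_add_distrib, sum_congr rfl fun c hc =>
          Nat.sub_add_cancel (hsc c (mem_range.1 hc))]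
        simp
      simp only [sum_const, card_range, smul_eq_mul, mul_one]
      omega
    refine ⟨A'.disjSum (B'.disjSum (pairList m fun c => t - sc c).toFinset), ?_, ?_, ?_, ?_⟩
    · rw [slackList_toFinset]
      refine disjSum_mono a1 (disjSum_mono b1 fun q hq => ?_)
      rw [List.mem_toFinset, mem_pairList] at hq ⊢
      refine ⟨hq.1, ?_⟩
      -- At `p` the score is exactly `t`, so no slack edge is asked for where none exists.
      split_ifs with h
      · rw [h, hsp] at hq
        omega
      · omega
    · rw [(hred _ _ _).1, a2]
    · rw [(hred _ _ _).2, b2]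
    · intro c hc
      by_cases hcm : c = m
      · subst hcm
        rw [slackCapacity, if_pos rfl, ← hXcard, card_filter_disjSum, card_filter_disjSum]
        have h4 : (A'.filter fun a => slackFst w w' (.inl a) = c ∨ slackSnd c w w' (.inl a) = c) =
            ∅ := by
          rw [filter_eq_empty_iff]
          intro a ha
          have := htop _ (hw a (List.mem_toFinset.1 (a1 ha)))
          simp only [slackFst, slackSnd, Sum.elim_inl]
          omega
        have h5 : (B'.filter fun b => slackFst w w' (.inr (.inl b)) = c ∨
            slackSnd c w w' (.inr (.inl b)) = c) = ∅ := by
          rw [filter_eq_empty_iff]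
          intro b hb
          have := htop _ (hw' b (List.mem_toFinset.1 (b1 hb)))
          simp only [slackFst, slackSnd, Sum.elim_inl, Sum.elim_inr]
          omega
        rw [h4, h5, card_empty, card_empty, zero_add, zero_add]
        congr 1
        exact filter_true_of_mem fun _ _ => Or.inr rfl
      · rw [slackCapacity, if_neg hcm, hdeg _ _ _ _ (by omega), hX c (by omega)]
        exact Nat.add_sub_of_le (hsc c (by omega))
  · rintro ⟨S, hS, h1, h2, h3⟩
    obtain ⟨A, B, X, rfl⟩ : ∃ A B X, S = A.disjSum (B.disjSum X) :=
      ⟨S.toLeft, S.toRight.toLeft, S.toRight.toRight, by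
        rw [toLeft_disjSum_toRight, toLeft_disjSum_toRight]⟩
    rw [slackList_toFinset] at hS
    rw [(hred _ _ _).1] at h1
    rw [(hred _ _ _).2] at h2
    have hX : X.filter (fun q => q.1 = p) = ∅ := by
      rw [filter_eq_empty_iff]
      rintro q hq h
      have h4 := hS (inr_mem_disjSum.2 (inr_mem_disjSum.2 hq))
      rw [inr_mem_disjSum, inr_mem_disjSum, List.mem_toFinset, mem_pairList, if_pos h] at h4
      omega
    refine ⟨A, fun a ha => inl_mem_disjSum.1 (hS (inl_mem_disjSum.2 ha)), B, fun b hb =>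
      inl_mem_disjSum.1 (inr_mem_disjSum.1 (hS (inr_mem_disjSum.2 (inl_mem_disjSum.2 hb)))),
      by omega, h2, fun c hc => ?_⟩
    have h4 := h3 c (by omega)
    have h5 := h3 p (by omega)
    rw [hdeg _ _ _ _ hc, slackCapacity, if_neg (by omega)] at h4
    rw [hdeg _ _ _ _ hp, slackCapacity, if_neg (by omega), hX, card_empty] at h5
    omega

/-- A single candidate always wins, so the only question is whether there are enough voters to
remove and to add. -/
theorem hasControl_one {k : ℕ} {L : List α} {L' : List β} {w : α → ℕ → ℕ} {w' : β → ℕ → ℕ}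
    (hL : L.Nodup) (hL' : L'.Nodup) (hk : k ≤ L.length) (hk' : k ≤ L'.length) :
    HasControl 1 0 k L L' w w' := by
  rw [← List.toFinset_card_of_nodup hL'] at hk'
  have hk2 : L.length - k ≤ L.toFinset.card := by
    rw [List.toFinset_card_of_nodup hL]
    omega
  obtain ⟨A, hA, h1⟩ := exists_subset_card_eq hk2
  obtain ⟨B, hB, h2⟩ := exists_subset_card_eq hk'
  refine ⟨A, hA, B, hB, by omega, h2, fun c hc => ?_⟩
  obtain rfl : c = 0 := by omega
  exact le_rfl

theorem HasControl.le {m p k : ℕ} {L : List α} {L' : List β} {w : α → ℕ → ℕ} {w' : β → ℕ → ℕ}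
    (h : HasControl m p k L L' w w') : k ≤ L.length ∧ k ≤ L'.length := by
  obtain ⟨A, -, B, hB, h1, h2, -⟩ := h
  have := (card_le_card hB).trans (List.toFinset_card_le L')
  omega

end Slack

section

variable {γ : Type} [Ctx γ]

/-- The number of points that `p` can get. -/
def targetScore (x : Word) : ℕ :=
  min (numReg x - entry x 0 1)
    ((range (numReg x)).filter fun i => Approves (width x) (voteAt x i) (entry x 0 0)).card +
  min (entry x 0 1) ((range (numUnreg x)).filter fun i =>
    Approves (width x) (voteAt x (numReg x + i)) (entry x 0 0)).card

theorem LogFn.targetScore : LogFn fun x : Word => targetScore x := by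
  have he : ∀ j, LogFn fun x : Word => Logspace.entry x 0 j := fun j =>
    LogFn.entry (LogFn.const 0) (LogFn.const j)
  have key : ∀ {f : Word × ℕ → ℕ}, LogFn f → LogPred fun q : Word × ℕ =>
      Approves (Logspace.width q.1) (Logspace.voteAt q.1 (f q)) (Logspace.entry q.1 0 0) :=
    fun hf => (LogPred.eq (hf.voteAt (LogFn.const 0)) (he 0).weak).or
      ((LogPred.lt (LogFn.const 1) LogFn.width).and
        (LogPred.eq (hf.voteAt (LogFn.const 1)) (he 0).weak))
  refine ((LogFn.numReg.sub (he 1)).min ?_).add ((he 1).min ?_)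
  · exact LogFn.count (P := fun (x : Word) i => Approves (Logspace.width x) (Logspace.voteAt x i)
      (Logspace.entry x 0 0)) LogFn.numReg (key LogFn.v0)
  · exact LogFn.count (P := fun (x : Word) i => Approves (Logspace.width x)
      (Logspace.voteAt x (Logspace.numReg x + i)) (Logspace.entry x 0 0)) LogFn.numUnreg
      (key (LogFn.numReg.add LogFn.v0))

/-- The fixed yes-instance for elections with one candidate. -/
theorem hasBMatching_zero : HasBMatching 0 ([] : List ℕ) (fun _ => 0) (fun _ => 0) (fun _ => 0)
    (fun _ => 0) 0 0 :=
  ⟨∅, empty_subset _, rfl, rfl, by simp⟩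

open Classical in
-- With one candidate a vote has no second place and is not an edge, so this case is decided
-- directly. Numbers `k` larger than the number of registered or of unregistered voters are
-- hopeless.
theorem genReduces_ccrvExact :
    GenReduces (ccrvExact twoApproval) exactRedBluePerfectBMatching := by
  refine ⟨fun x => encodeTable (if IsControlWord x ∧ entry x 0 1 ≤ numReg x ∧
    entry x 0 1 ≤ numUnreg x then if width x = 1 then
      redBlueTable 0 ([] : List ℕ) (fun _ => 0) (fun _ => 0) (fun _ => 0) (fun _ => 0) 0 0 else
      redBlueTable (width x + 1) (slackList (width x) (entry x 0 0) (targetScore x)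
        (List.range (numReg x)) (List.range (numUnreg x)))
        (slackCapacity (width x) (targetScore x) (numReg x))
        (slackFst (voteAt x) fun i => voteAt x (numReg x + i))
        (slackSnd (width x) (voteAt x) fun i => voteAt x (numReg x + i)) slackColor
        (numReg x - entry x 0 1) (entry x 0 1) else []), ?_, fun x => ?_⟩
  · have he : ∀ j, LogFn fun x : Word => entry x 0 j := fun j =>
      LogFn.entry (LogFn.const 0) (LogFn.const j)
    have hw : LogFn fun x : Word => width x := LogFn.width
    have hr : LogFn fun x : Word => numReg x := LogFn.numReg
    have hs : LogFn fun x : Word => numUnreg x := LogFn.numUnreg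
    refine LogTab.ite (LogPred.isControlWord.and ((LogPred.le (he 1) hr).and
      (LogPred.le (he 1) hs))) (LogTab.ite (LogPred.eq hw (LogFn.const 1)) ?_ ?_) LogTab.nil
    · exact LogTab.cons ((LogRow.single (LogFn.const 0)).append (LogRow.single (LogFn.const 0)))
        (LogTab.cons LogRow.nil LogTab.nil)
    · simp only [redBlueTable, slackList, List.map_append, List.map_map, Function.comp_def]
      refine LogTab.cons ((LogRow.single (hr.sub (he 1))).append (LogRow.single (he 1)))
        (LogTab.cons ?_ ((LogTab.append ?_ ?_).append ?_))
      · exact LogRow.map (f := fun x => slackCapacity (width x) (targetScore x) (numReg x)) hw.succ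
          (LogFn.ite (LogPred.eq LogFn.v0 hw.weak) ((hw.mul LogFn.targetScore).sub
            ((LogFn.const 2).mul hr)).weak LogFn.targetScore.weak)
      · exact LogTab.map (f := fun x i => [voteAt x i 0, voteAt x i 1, 1]) hr
          (((LogFn.v0.voteAt (LogFn.const 0)) |> LogRow.single).append
            (((LogFn.v0.voteAt (LogFn.const 1)) |> LogRow.single).append
              (LogRow.single (LogFn.const 1))))
      · have hi : LogFn fun q : Word × ℕ => numReg q.1 + q.2 := hr.weak.add LogFn.v0
        exact LogTab.map (f := fun x i => [voteAt x (numReg x + i) 0, voteAt x (numReg x + i) 1, 2])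
          hs ((LogRow.single (hi.voteAt (LogFn.const 0))).append
            ((LogRow.single (hi.voteAt (LogFn.const 1))).append (LogRow.single (LogFn.const 2))))
      · exact LogTab.map_pairList (B := fun x c => if c = entry x 0 0 then 0 else targetScore x)
          (f := fun x q => [q.1, width x, 0]) hw
          (LogFn.ite (LogPred.eq LogFn.v0 (he 0).weak) (LogFn.const 0) LogFn.targetScore.weak)
          ((LogRow.single LogFn.v1).append ((LogRow.single hw.weak.weak).append
            (LogRow.single (LogFn.const 0))))
  · beta_reduce
    rw [mem_ccrvExact_iff]
    split_ifs with h h1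
    · obtain ⟨h2, h3, h4⟩ := h
      refine iff_of_true ⟨h2, ?_⟩ ((mem_exactRedBluePerfectBMatching List.nodup_nil).2
        ⟨by simp, hasBMatching_zero⟩)
      have h5 := h2.2.1
      rw [h1] at h5 ⊢
      rw [show entry x 0 0 = 0 by omega]
      exact hasControl_one List.nodup_range List.nodup_range (by simpa using h3) (by simpa using h4)
    · obtain ⟨h2, h3, h4⟩ := h
      have h5 := h2.2.1
      have hadd := numReg_add_numUnreg x
      have hw : ∀ i ∈ List.range (numReg x), IsRanking (width x) (voteAt x i) := fun i hi =>
        h2.2.2.2.2 i (by rw [List.mem_range] at hi; omega)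
      have hw' : ∀ i ∈ List.range (numUnreg x), IsRanking (width x) (voteAt x (numReg x + i)) :=
        fun i hi => h2.2.2.2.2 _ (by rw [List.mem_range] at hi; omega)
      have hm : 1 < width x := by omega
      rw [mem_exactRedBluePerfectBMatching (nodup_slackList List.nodup_range List.nodup_range),
        and_iff_right h2, hasControl_iff_hasBMatching (t := targetScore x)
        hm h5 hw hw' (by simpa using h3), and_iff_right]
      · simp only [List.length_range]
      · have htop : ∀ v : ℕ → ℕ, IsRanking (width x) v →
            v 0 < width x + 1 ∧ v 1 < width x + 1 ∧ v 0 ≠ v 1 := fun v hv =>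
          ⟨(hv 0 (by omega)).1.trans (Nat.lt_succ_self _), (hv 1 hm).1.trans (Nat.lt_succ_self _),
            fun h => zero_ne_one ((hv 0 (by omega)).2 1 hm h)⟩
        rintro (i | i | ⟨c, j⟩) he <;> simp only [slackList, List.mem_append, List.mem_map,
          Sum.inl.injEq, Sum.inr.injEq, reduceCtorEq, and_false, exists_false, or_false, false_or,
          exists_eq_right] at he
        · obtain ⟨e1, e2, e3⟩ := htop _ (hw i he)
          exact ⟨e1, e2, e3, by simp [slackColor]⟩
        · obtain ⟨e1, e2, e3⟩ := htop _ (hw' i he)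
          exact ⟨e1, e2, e3, by simp [slackColor]⟩
        · rw [mem_pairList] at he
          have := he.1
          dsimp only at this
          refine ⟨?_, Nat.lt_succ_self _, ?_, by simp [slackColor]⟩
          · change c < _
            omega
          · change c ≠ width x
            omega
      · rw [List.length_range, List.toFinset_range, List.toFinset_range]
        rfl
    · refine iff_of_false (fun h' => h ⟨h'.1, ?_⟩) notMem_of_nil.2.2.1
      simpa using h'.2.le

end

end Logspace

/-! ### The reductions combined. -/

open Logspace

theorem mainTheorem4 :
    LogspaceEquivalent (ccrvExact twoApproval) exactPerfectMatching ∧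
    (LogspaceReduces (ccrvExact twoApproval) exactRedBluePerfectBMatching ∧
      LogspaceReduces exactRedBluePerfectBMatching exactPerfectMatching) ∧
    (LogspaceReduces exactPerfectMatching restrictedExactPerfectMatching ∧
      LogspaceReduces restrictedExactPerfectMatching (ccrvExact twoApproval)) :=
  ⟨⟨(genReduces_ccrvExact.trans genReduces_exactRedBluePerfectBMatching).logspaceReduces,
    (genReduces_exactPerfectMatching_restricted.trans
      genReduces_restrictedExactPerfectMatching).logspaceReduces⟩,
    ⟨genReduces_ccrvExact.logspaceReduces,
      genReduces_exactRedBluePerfectBMatching.logspaceReduces⟩,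
    genReduces_exactPerfectMatching_restricted.logspaceReduces,
    genReduces_restrictedExactPerfectMatching.logspaceReduces⟩
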